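/- Let $\beta\ge 0$. On $C_0(\mathbb R_+)$, the continuous functions on $\mathbb R_+=[0,\infty)$ vanishing at infinity, there is a unique Feller semigroup $Q^{(\beta)}=(Q^{(\beta)}_t)_{t\ge0}$ (the squared Bessel semigroup) whose generator acts as $x\partial^2+\beta\partial$ on the smooth compactly supported functions on $[0,\infty)$. On $c_0(\mathbb Z_+)$, the functions on $\mathbb Z_+=\{0,1,2,\dots\}$ vanishing at infinity, there is a unique Feller semigroup $\mathbb Q^{(\beta)}=(\mathbb Q^{(\beta)}_t)_{t\ge0}$ (the linear birth–death semigroup) whose generator acts as $(n+\beta)\partial_++n\partial_-$ on the finitely supported functions, where $\partial_\pm g(n)=g(n\pm1)-g(n)$. (Feller semigroups are understood as given by Markov transition kernels.) Define the Markov kernels $$\Lambda g(x)=\mathbb E[g(\mathrm{Pois}(x))],\quad x\ge 0,\qquad \Lambda^*f(n)=\mathbb E[f(\mathrm{Gam}(n+\beta))],\quad n\in\mathbb Z_+,$$ where $\mathrm{Pois}(x)$ is a Poisson variable of parameter $x$ and $\mathrm{Gam}(a)$ is a standard gamma variable of shape parameter $a$ (with $\mathrm{Gam}(0)=0$). 1.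 $\Lambda$ maps $c_0(\mathbb Z_+)$ to $C_0(\mathbb R_+)$ and $\Lambda^*$ maps $C_0(\mathbb R_+)$ to $c_0(\mathbb Z_+)$, as bounded operators, and for all $t\ge0$ $$Q^{(\beta)}_t\Lambda=\Lambda\,\mathbb Q^{(\beta)}_t\ \text{ on } c_0(\mathbb Z_+),\qquad \mathbb Q^{(\beta)}_t\Lambda^*=\Lambda^*Q^{(\beta)}_t\ \text{ on } C_0(\mathbb R_+).$$ 2. Let $\beta>0$, and put $\mathfrak m_\beta(n)=\frac{(n+\beta-1)(n+\beta-2)\cdots\beta}{n!}$, $n\in\mathbb Z_+$, and $\mu_\beta(dx)=\frac{x^{\beta-1}}{\Gamma(\beta)}\,dx$, $x>0$. Then the kernels $\Lambda$, $\Lambda^*$, $Q^{(\beta)}_t$, $\mathbb Q^{(\beta)}_t$ define, through the same integral formulas (convergent almost everywhere), bounded operators $\ell^2(\mathfrak m_\beta)\to L^2(\mu_\beta)$, $L^2(\mu_\beta)\to\ell^2(\mathfrak m_\beta)$, $L^2(\mu_\beta)\to L^2(\mu_\beta)$ and $\ell^2(\mathfrak m_\beta)\to\ell^2(\mathfrak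 m_\beta)$ respectively, and for all $t\ge 0$, $Q^{(\beta)}_t\Lambda=\Lambda\,\mathbb Q^{(\beta)}_t$ on $\ell^2(\mathfrak m_\beta)$ and $\mathbb Q^{(\beta)}_t\Lambda^*=\Lambda^*Q^{(\beta)}_t$ on $L^2(\mu_\beta)$. Moreover $\Lambda:\ell^2(\mathfrak m_\beta)\to L^2(\mu_\beta)$ is a quasi-affinity (bounded, one-to-one, with dense range), and the two semigroups are unitarily equivalent: there is a surjective linear isometry $U:\ell^2(\mathfrak m_\beta)\to L^2(\mu_\beta)$, not depending on $t$, with $Q^{(\beta)}_tU=U\,\mathbb Q^{(\beta)}_t$ for all $t\ge0$. -/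

import Mathlib

open MeasureTheory ProbabilityTheory Filter Topology
open scoped NNReal ENNReal ContDiff ZeroAtInfty Nat

/-! ### Feller semigroups given by transition kernels -/

/-- `P` is the transition function of a (conservative) Feller semigroup on the space `C₀(E, ℝ)`
of continuous functions vanishing at infinity: Markov kernels satisfying the Chapman-Kolmogorov
equation, preserving `C₀(E, ℝ)` and strongly continuous there. -/
structure IsFellerSemigroup {E : Type*} [TopologicalSpace E] [MeasurableSpace E]
    (P : ℝ≥0 → Kernel E E) : Prop where
  markov : ∀ t, IsMarkovKernel (P t)
  zero : P 0 = Kernel.id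
  add : ∀ s t, P (s + t) = P t ∘ₖ P s
  mapsTo : ∀ (t : ℝ≥0) (f : C₀(E, ℝ)), ∃ g : C₀(E, ℝ), ∀ x, g x = ∫ y, f y ∂(P t x)
  continuous : ∀ f : C₀(E, ℝ),
    TendstoUniformly (fun (t : ℝ≥0) (x : E) => ∫ y, f y ∂(P t x)) (fun x => f x) (𝓝 0)

/-- `f` is in the domain of the infinitesimal generator of `P` (with respect to the uniform
norm) and `g` is its image. -/
def InGenerator {E : Type*} [MeasurableSpace E] (P : ℝ≥0 → Kernel E E) (f g : E → ℝ) : Prop :=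
  TendstoUniformly (fun (t : ℝ≥0) (x : E) => ((∫ y, f y ∂(P t x)) - f x) / (t : ℝ)) g (𝓝[>] 0)

/-- `Q` is the squared Bessel semigroup with parameter `β`: the Feller semigroup on `[0, ∞)`
whose generator is `x ∂² + β ∂` on the smooth compactly supported functions on `[0, ∞)`
(the restrictions to `[0, ∞)` of smooth compactly supported functions on the line, so that
there is no condition at the boundary point `0`). -/
structure IsSquaredBesselSemigroup (β : ℝ) (Q : ℝ≥0 → Kernel ℝ≥0 ℝ≥0) : Prop where
  feller : IsFellerSemigroup Q
  generator : ∀ f : ℝ → ℝ, ContDiff ℝ ∞ f → HasCompactSupport f →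
    InGenerator Q (fun x : ℝ≥0 => f x)
      (fun x : ℝ≥0 => (x : ℝ) * deriv (deriv f) x + β * deriv f x)

/-- `D` is the linear birth-death semigroup with parameter `β`: the Feller semigroup on the
nonnegative integers whose generator is `(n + β) ∂₊ + n ∂₋` on the finitely supported functions,
where `∂± f n = f (n ± 1) - f n`. (At `n = 0` the value of `f (n - 1)` is irrelevant.) -/
structure IsBirthDeathSemigroup (β : ℝ) (D : ℝ≥0 → Kernel ℕ ℕ) : Prop where
  feller : IsFellerSemigroup D
  generator : ∀ f : ℕ → ℝ, f.support.Finite →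
    InGenerator D f
      (fun n : ℕ => ((n : ℝ) + β) * (f (n + 1) - f n) + (n : ℝ) * (f (n - 1) - f n))

/-! ### The two gateway kernels and the reference measures -/

/-- The Markov kernel `Λ` from `[0, ∞)` to the nonnegative integers: `Λ x` is the Poisson
distribution with parameter `x`. -/
noncomputable def poissonGateway : Kernel ℝ≥0 ℕ where
  toFun x := poissonMeasure x
  measurable' := by
    refine Measure.measurable_of_measurable_coe _ fun s hs => ?_
    simp only [poissonMeasure, Measure.sum_apply _ hs, Measure.smul_apply]
    refine Measurable.ennreal_tsum fun n => ?_
    refine Measurable.smul_const ?_ _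
    fun_prop

/-- The standard gamma distribution with shape parameter `a ≥ 0`, as a measure on `[0, ∞)`.
For `a = 0` it is the Dirac mass at `0`. -/
noncomputable def gammaLaw (a : ℝ) : Measure ℝ≥0 :=
  if a = 0 then Measure.dirac 0 else (gammaMeasure a 1).map Real.toNNReal

/-- The Markov kernel `Λ*` from the nonnegative integers to `[0, ∞)`: `Λ* n` is the standard
gamma distribution with shape parameter `n + β`. -/
noncomputable def gammaGateway (β : ℝ) : Kernel ℕ ℝ≥0 where
  toFun n := gammaLaw ((n : ℝ) + β)
  measurable' := measurable_of_countable _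

/-- The measure `μ_β(dx) = x ^ (β - 1) / Γ(β) dx` on `(0, ∞)`, seen as a measure on `[0, ∞)`. -/
noncomputable def besselMeasure (β : ℝ) : Measure ℝ≥0 :=
  ((volume.restrict (Set.Ioi (0 : ℝ))).withDensity
    (fun x => ENNReal.ofReal (x ^ (β - 1) / Real.Gamma β))).map Real.toNNReal

/-- The measure `m_β` on the nonnegative integers, with
`m_β(n) = β (β + 1) ⋯ (β + n - 1) / n!`. -/
noncomputable def birthDeathMeasure (β : ℝ) : Measure ℕ :=
  Measure.sum fun n =>
    ENNReal.ofReal ((∏ k ∈ Finset.range n, (β + (k : ℝ))) / (n ! : ℝ)) • Measure.dirac n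

/-! ### Operators given by kernels -/

/-- `T` is the operator `f ↦ (x ↦ ∫ f dκ(x, ·))` on functions vanishing at infinity. -/
def IsC0Operator {X Y : Type*} [TopologicalSpace X] [MeasurableSpace X] [TopologicalSpace Y]
    [MeasurableSpace Y] (κ : Kernel X Y) (T : C₀(Y, ℝ) →L[ℝ] C₀(X, ℝ)) : Prop :=
  ∀ (f : C₀(Y, ℝ)) (x : X), T f x = ∫ y, f y ∂(κ x)

/-- `T` is the operator `f ↦ (x ↦ ∫ f dκ(x, ·))` from `L²(ν)` to `L²(μ)`: for every square
integrable `f` the integral converges for almost every `x` and defines the class `T f`. -/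
def IsL2Operator {X Y : Type*} [MeasurableSpace X] [MeasurableSpace Y] (κ : Kernel X Y)
    (ν : Measure Y) (μ : Measure X) (T : Lp ℝ 2 ν →L[ℝ] Lp ℝ 2 μ) : Prop :=
  ∀ (f : Y → ℝ) (hf : MemLp f 2 ν),
    (∀ᵐ x ∂μ, Integrable f (κ x)) ∧ T (hf.toLp f) =ᵐ[μ] fun x => ∫ y, f y ∂(κ x)

/-- A quasi-affinity: a bounded linear operator which is one-to-one with dense range. -/
def IsQuasiAffinity {V W : Type*} [NormedAddCommGroup V] [NormedSpace ℝ V]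
    [NormedAddCommGroup W] [NormedSpace ℝ W] (T : V →L[ℝ] W) : Prop :=
  Function.Injective T ∧ DenseRange T

/-! Everything is computed on exponentials `e_l(x) = exp(-l x)` and geometric sequences `s ^ n`,
which the four kernels map to multiples of each other: `Q_t e_l = (1 + l t)^(-β) e_{l/(1+lt)}`, `Λ
(s^n) = e_{1-s}`, `Λ* e_l = (1 + l)^(-β) (1 + l)^(-n)`, and `D_t (s^n) = (1 + t(1-s))^(-β) (1 -
(1-s)/(1+t(1-s)))^n`. Both state spaces are handled at once through a coordinate `ι`, a closed
embedding into the half-line. Exponentials in `ι` span a dense subspace of `C₀` (Stone–Weierstrass),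
and a measure is determined by its Laplace transform on `(0, 1)` (`IsCoordinate.ext_of_laplace`).
Chapman–Kolmogorov, `Q_t Λ = Λ D_t`, `D_t Λ* = Λ* Q_t` and `Λ Λ* = Q_1` thus become identities
between elementary functions of `l`.

Existence uses explicit kernels with these transforms. For the generators, a uniform Taylor
expansion in `t` treats the exponentials; since the generator of a contraction semigroup is closed
(`isGenerated_of_approx`), test functions are reached by approximation. The birth-death generator is
obtained from the Bessel one through `Λ*`. For uniqueness the approximation is run backwards: a
semigroup with the given generator on test functions has the expected generator on exponentials. The
explicit semigroup maps exponentials to multiples of exponentials, so the two generators agree along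
its orbits, and `eq_of_isGenerated` identifies the semigroups.

In `L²`, `Λ` transports `μ_β` to `m_β`, `Λ*` transports `m_β` to `μ_β`, and the semigroups leave
these measures invariant, so by Jensen all four kernels give contractions. Inner products of
exponentials show that `Λ*` is the adjoint of `Λ` and that `Q_t` is self-adjoint; totality of the
exponentials makes `Λ` and `Λ*` injective, hence with dense range. Finally `Λ Λ* = Q_1 = Q_{1/2}²`,
so `Q_{1/2}` is the modulus of `Λ*`, and the isometry `Q_{1/2} v ↦ Λ* v` of the polar decomposition
extends to a unitary which carries one semigroup to the other (`exists_unitary_of_comp_eq_sq`). -/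

/-! ### Contraction semigroups on a normed space -/

section Semigroup

variable {X : Type*} [NormedAddCommGroup X] [NormedSpace ℝ X]

/-- A strongly continuous semigroup of contractions. -/
structure IsContractionSemigroup (T : ℝ≥0 → X →L[ℝ] X) : Prop where
  norm_le : ∀ t f, ‖T t f‖ ≤ ‖f‖
  zero : ∀ f, T 0 f = f
  add : ∀ s t f, T (s + t) f = T s (T t f)
  continuous : ∀ f, Tendsto (fun t => T t f) (𝓝 0) (𝓝 f)

/-- `f` is in the domain of the generator of `T`, with image `g`. -/
def IsGenerated (T : ℝ≥0 → X →L[ℝ] X) (f g : X) : Prop :=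
  Tendsto (fun t : ℝ≥0 => (t : ℝ)⁻¹ • (T t f - f)) (𝓝[>] 0) (𝓝 g)

theorem IsGenerated.add {T : ℝ≥0 → X →L[ℝ] X} {f g f' g' : X} (h : IsGenerated T f g)
    (h' : IsGenerated T f' g') : IsGenerated T (f + f') (g + g') := by
  refine (Tendsto.add h h').congr fun t => ?_
  rw [← smul_add, map_add]
  congr 1
  abel

theorem IsGenerated.smul {T : ℝ≥0 → X →L[ℝ] X} {f g : X} (c : ℝ) (h : IsGenerated T f g) :
    IsGenerated T (c • f) (c • g) := by
  refine (Tendsto.const_smul h c).congr fun t => ?_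
  rw [map_smul, ← smul_sub, smul_comm]

/-- A bounded intertwiner commutes with the difference quotients. With `A = Λ*` this carries the
Bessel generator over to the birth-death generator. -/
theorem IsGenerated.map {Y : Type*} [NormedAddCommGroup Y] [NormedSpace ℝ Y]
    {T : ℝ≥0 → X →L[ℝ] X} {S : ℝ≥0 → Y →L[ℝ] Y} {A : X →L[ℝ] Y}
    (hA : ∀ t f, S t (A f) = A (T t f)) {f g : X} (h : IsGenerated T f g) :
    IsGenerated S (A f) (A g) := by
  refine ((A.continuous.tendsto g).comp h).congr fun t => ?_
  simp [hA]

namespace IsContractionSemigroup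

variable {T T' : ℝ≥0 → X →L[ℝ] X}

theorem norm_sub_le (hT : IsContractionSemigroup T) (s h : ℝ≥0) (f : X) :
    ‖T (s + h) f - T s f‖ ≤ ‖T h f - f‖ := by
  rw [hT.add, ← map_sub]
  exact hT.norm_le _ _

theorem continuous_orbit (hT : IsContractionSemigroup T) (f : X) :
    Continuous fun t => T t f := by
  rw [continuous_iff_continuousAt]
  intro t
  rw [ContinuousAt, tendsto_iff_norm_sub_tendsto_zero]
  have h0 : Tendsto (fun h => ‖T h f - f‖) (𝓝 0) (𝓝 0) :=
    tendsto_iff_norm_sub_tendsto_zero.1 (hT.continuous f)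
  -- With truncated subtraction, `(s - t) + (t - s)` is the distance `|s - t|` inside `ℝ≥0`.
  have h1 : Tendsto (fun s : ℝ≥0 => (s - t) + (t - s)) (𝓝 t) (𝓝 0) := by
    have : Continuous fun s : ℝ≥0 => (s - t) + (t - s) := by fun_prop
    simpa using this.tendsto t
  refine squeeze_zero (fun _ => norm_nonneg _) (fun s => ?_) (h0.comp h1)
  rcases le_total s t with h | h
  · simp only [Function.comp, tsub_eq_zero_of_le h, zero_add]
    conv_lhs => rw [← add_tsub_cancel_of_le h, norm_sub_rev]
    simpa using hT.norm_sub_le s (t - s) f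
  · simp only [Function.comp, tsub_eq_zero_of_le h, add_zero]
    conv_lhs => rw [← add_tsub_cancel_of_le h]
    simpa using hT.norm_sub_le t (s - t) f

/-- Since `T_r f - T_s f = T_s (T_{r-s} f - f)`, the right derivative at `s` is `T_s` applied to the
one at `0`. Right derivatives are all that the mean value inequality needs. -/
theorem hasDerivWithinAt_orbit (hT : IsContractionSemigroup T) {f g : X}
    (h : IsGenerated T f g) {s : ℝ} (hs : 0 ≤ s) :
    HasDerivWithinAt (fun r : ℝ => T r.toNNReal f) (T s.toNNReal g) (Set.Ici s) s := by
  rw [hasDerivWithinAt_iff_tendsto_slope, Set.Ici_sdiff_left]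
  have h1 : Tendsto (fun r : ℝ => (r - s).toNNReal) (𝓝[>] s) (𝓝[>] 0) := by
    refine tendsto_nhdsWithin_iff.2 ⟨?_, ?_⟩
    · have : Continuous fun r : ℝ => (r - s).toNNReal := by fun_prop
      simpa using (this.tendsto s).mono_left nhdsWithin_le_nhds
    · filter_upwards [self_mem_nhdsWithin] with r hr
      simpa using hr
  refine (((T s.toNNReal).continuous.tendsto g).comp (h.comp h1)).congr' ?_
  filter_upwards [self_mem_nhdsWithin] with r (hr : s < r)
  have e : r.toNNReal = s.toNNReal + (r - s).toNNReal := by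
    rw [← Real.toNNReal_add hs (by linarith)]
    simp
  simp only [Function.comp, slope, vsub_eq_sub, map_smul, map_sub]
  rw [e, hT.add, Real.coe_toNNReal _ (by linarith : (0 : ℝ) ≤ r - s)]

/-- Mean value inequality for `r ↦ T_r f - r g`, whose right derivative is `T_r g - g`. The modulus
`δ` depends on `g` alone, which makes the estimate stable under approximation of the pair `(f, g)`.
-/
theorem norm_sub_sub_le (hT : IsContractionSemigroup T) {f g : X} (h : IsGenerated T f g)
    {t : ℝ≥0} {δ : ℝ} (hδ : ∀ s ≤ t, ‖T s g - g‖ ≤ δ) :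
    ‖T t f - f - (t : ℝ) • g‖ ≤ δ * t := by
  have key := norm_image_sub_le_of_norm_deriv_right_le_segment
    (f := fun r : ℝ => T r.toNNReal f - r • g) (f' := fun r : ℝ => T r.toNNReal g - g)
    (a := 0) (b := t) (C := δ) ?_ ?_ ?_ t ⟨t.2, le_rfl⟩
  · simp only [Real.toNNReal_coe, Real.toNNReal_zero, zero_smul, sub_zero, hT.zero] at key
    convert key using 2
    abel
  · exact (((hT.continuous_orbit f).comp continuous_real_toNNReal).sub
      (continuous_id.smul continuous_const)).continuousOn
  · intro r hr
    refine (hT.hasDerivWithinAt_orbit h hr.1).sub ?_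
    simpa using ((hasDerivAt_id r).smul_const g).hasDerivWithinAt
  · intro r hr
    refine hδ _ ?_
    rw [Real.toNNReal_le_iff_le_coe]
    exact hr.2.le

/-- The generator of a contraction semigroup is closed. -/
theorem isGenerated_of_approx (hT : IsContractionSemigroup T) {f g : X}
    (h : ∀ ε > 0, ∃ f' g', IsGenerated T f' g' ∧ ‖f' - f‖ ≤ ε ∧ ‖g' - g‖ ≤ ε) :
    IsGenerated T f g := by
  -- The estimate of `norm_sub_sub_le` passes to the limit, although `f` is not yet known to lie in
  -- the domain.
  have bound : ∀ (t : ℝ≥0) (δ : ℝ), (∀ s ≤ t, ‖T s g - g‖ ≤ δ) →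
      ‖T t f - f - (t : ℝ) • g‖ ≤ δ * t := by
    intro t δ hδ
    refine le_of_forall_pos_le_add fun ε hε => ?_
    -- The approximation errors add up to `2 η t + (η + t η) + η = η (2 + 3 t)`.
    have ht : (0 : ℝ) < 2 + 3 * t := by positivity
    obtain ⟨f', g', hg, hf', hg'⟩ := h (ε / (2 + 3 * t)) (by positivity)
    set η := ε / (2 + 3 * t) with hη
    have h1 := hT.norm_sub_sub_le hg (t := t) (δ := δ + 2 * η) fun s hs => by
      calc ‖T s g' - g'‖ = ‖T s (g' - g) + (T s g - g) - (g' - g)‖ := by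
            rw [map_sub]; congr 1; abel
        _ ≤ ‖T s (g' - g)‖ + ‖T s g - g‖ + ‖g' - g‖ :=
          (_root_.norm_sub_le _ _).trans (add_le_add_left (norm_add_le _ _) _)
        _ ≤ η + δ + η := by
            gcongr
            · exact (hT.norm_le _ _).trans hg'
            · exact hδ s hs
        _ = δ + 2 * η := by ring
    calc ‖T t f - f - (t : ℝ) • g‖
        = ‖(T t f' - f' - (t : ℝ) • g') + ((f' - f) + (t : ℝ) • (g' - g)) - T t (f' - f)‖ := by
          rw [map_sub, smul_sub]; congr 1; abel
      _ ≤ ‖T t f' - f' - (t : ℝ) • g'‖ + ‖(f' - f) + (t : ℝ) • (g' - g)‖ + ‖T t (f' - f)‖ :=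
          (_root_.norm_sub_le _ _).trans (add_le_add_left (norm_add_le _ _) _)
      _ ≤ (δ + 2 * η) * t + (η + t * η) + η := by
          gcongr
          · refine (norm_add_le _ _).trans ?_
            rw [norm_smul, Real.norm_of_nonneg t.coe_nonneg]
            gcongr
          · exact (hT.norm_le _ _).trans hf'
      _ = δ * t + η * (2 + 3 * t) := by ring
      _ = δ * t + ε := by rw [hη, div_mul_cancel₀ _ ht.ne']
  rw [IsGenerated, Metric.tendsto_nhds]
  intro ε hε
  have h0 := Metric.tendsto_nhds.1 (hT.continuous g) (ε / 2) (by positivity)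
  obtain ⟨r, hr, hr'⟩ := Metric.eventually_nhds_iff.1 h0
  have h2 : ∀ᶠ t : ℝ≥0 in 𝓝[>] 0, dist t 0 < r :=
    nhdsWithin_le_nhds (Metric.ball_mem_nhds _ hr)
  filter_upwards [h2, self_mem_nhdsWithin] with t ht (ht0 : 0 < t)
  have ht1 : (0 : ℝ) < t := ht0
  have h3 := bound t (ε / 2) fun s hs => by
    rw [← dist_eq_norm]
    refine (hr' (lt_of_le_of_lt ?_ ht)).le
    rw [NNReal.dist_eq, NNReal.dist_eq]
    simpa using hs
  rw [dist_eq_norm]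
  calc ‖(t : ℝ)⁻¹ • (T t f - f) - g‖ = ‖(t : ℝ)⁻¹ • (T t f - f - (t : ℝ) • g)‖ := by
        rw [smul_sub _ _ ((t : ℝ) • g), smul_smul, inv_mul_cancel₀ ht1.ne', one_smul]
    _ ≤ (t : ℝ)⁻¹ * (ε / 2 * t) := by
        rw [norm_smul, norm_inv, Real.norm_of_nonneg t.coe_nonneg]
        gcongr
    _ = ε / 2 := by field_simp
    _ < ε := by linarith

/-- Two contraction semigroups agree at `f` as soon as their generators agree along the orbit
of `f` under one of them. -/
theorem eq_of_isGenerated (hT : IsContractionSemigroup T) (hT' : IsContractionSemigroup T')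
    {f : X} (h : ∀ s, ∃ g, IsGenerated T (T s f) g ∧ IsGenerated T' (T s f) g) (t : ℝ≥0) :
    T' t f = T t f := by
  -- The path `r ↦ T'_{t-r} T_r f` joins `T'_t f` to `T_t f` and will have zero right derivative.
  have key := constant_of_has_deriv_right_zero
    (f := fun r : ℝ => T' (t - r.toNNReal) (T r.toNNReal f)) (a := 0) (b := t) ?_ ?_ t ⟨t.2, le_rfl⟩
  · simpa [hT.zero, hT'.zero] using key.symm
  · refine Continuous.continuousOn ?_
    have : Continuous fun s : ℝ≥0 => T' (t - s) (T s f) := by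
      rw [continuous_iff_continuousAt]
      intro s
      rw [ContinuousAt, tendsto_iff_norm_sub_tendsto_zero]
      have h1 : Tendsto (fun r => ‖T r f - T s f‖) (𝓝 s) (𝓝 0) :=
        tendsto_iff_norm_sub_tendsto_zero.1 ((hT.continuous_orbit f).tendsto s)
      have h2 : Tendsto (fun r => ‖T' (t - r) (T s f) - T' (t - s) (T s f)‖) (𝓝 s) (𝓝 0) := by
        refine tendsto_iff_norm_sub_tendsto_zero.1 ?_
        have : Continuous fun r : ℝ≥0 => T' (t - r) (T s f) :=
          (hT'.continuous_orbit (T s f)).comp (by fun_prop)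
        exact this.tendsto s
      refine squeeze_zero (fun _ => norm_nonneg _) (fun r => ?_) (by simpa using h1.add h2)
      calc ‖T' (t - r) (T r f) - T' (t - s) (T s f)‖
          = ‖T' (t - r) (T r f - T s f) + (T' (t - r) (T s f) - T' (t - s) (T s f))‖ := by
            rw [map_sub]; congr 1; abel
        _ ≤ _ := (norm_add_le _ _).trans (add_le_add_left (hT'.norm_le _ _) _)
    exact this.comp continuous_real_toNNReal
  · intro s hs
    obtain ⟨g, hg, hg'⟩ := h s.toNNReal
    rw [hasDerivWithinAt_iff_tendsto_slope, Set.Ici_sdiff_left]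
    have h1 : Tendsto (fun r : ℝ => (r - s).toNNReal) (𝓝[>] s) (𝓝[>] 0) := by
      refine tendsto_nhdsWithin_iff.2 ⟨?_, ?_⟩
      · have : Continuous fun r : ℝ => (r - s).toNNReal := by fun_prop
        simpa using (this.tendsto s).mono_left nhdsWithin_le_nhds
      · filter_upwards [self_mem_nhdsWithin] with r hr
        simpa using hr
    -- With `h = T_s f`, the increment of the path from `s` to `r` is `T'_{t-r} (T_{r-s} h -
    -- T'_{r-s} h)`. By contractivity its quotient is bounded by the difference of two quotients
    -- which both tend to `g`.
    have h2 := ((Tendsto.sub hg hg').comp h1).norm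
    rw [sub_self, norm_zero] at h2
    refine squeeze_zero_norm' ?_ h2
    have hst : ∀ᶠ r in 𝓝[>] s, r < (t : ℝ) := nhdsWithin_le_nhds (Iio_mem_nhds hs.2)
    filter_upwards [self_mem_nhdsWithin, hst] with r (hr : s < r) hrt
    have hr0 : 0 ≤ r := hs.1.trans hr.le
    have e : r.toNNReal = s.toNNReal + (r - s).toNNReal := by
      rw [← Real.toNNReal_add hs.1 (by linarith)]
      simp
    have e' : t - s.toNNReal = (t - r.toNNReal) + (r - s).toNNReal := by
      have h3 : r.toNNReal ≤ t := by
        rw [Real.toNNReal_le_iff_le_coe]; exact hrt.le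
      have h4 : s.toNNReal ≤ t := by
        rw [Real.toNNReal_le_iff_le_coe]; exact hs.2.le
      apply NNReal.coe_injective
      rw [NNReal.coe_add, NNReal.coe_sub h3, NNReal.coe_sub h4, Real.coe_toNNReal _ hr0,
        Real.coe_toNNReal _ hs.1, Real.coe_toNNReal _ (by linarith)]
      ring
    have e2 : T r.toNNReal f = T (r - s).toNNReal (T s.toNNReal f) := by
      rw [← hT.add, e, add_comm]
    simp only [slope, vsub_eq_sub, Function.comp]
    rw [e', hT'.add, e2, ← map_sub, ← smul_sub, norm_smul, norm_smul,
      Real.coe_toNNReal _ (by linarith : (0 : ℝ) ≤ r - s)]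
    refine mul_le_mul_of_nonneg_left ?_ (norm_nonneg _)
    refine (hT'.norm_le _ _).trans_eq ?_
    congr 1
    abel

end IsContractionSemigroup

end Semigroup

/-! ### Laplace transforms -/

section Laplace

/-- The moment generating functions extend analytically to the strip `|Re z| < δ`. Agreeing on a
real interval they agree on the strip, in particular on the imaginary axis, where they are the
characteristic functions. -/
theorem eq_of_lintegral_exp_eq {μ ν : Measure ℝ} [IsFiniteMeasure μ] [IsFiniteMeasure ν] {δ : ℝ}
    (hδ : 0 < δ)
    (h : ∀ t ∈ Set.Ioo (-δ) δ, ∫⁻ x, ENNReal.ofReal (Real.exp (t * x)) ∂μ =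
      ∫⁻ x, ENNReal.ofReal (Real.exp (t * x)) ∂ν)
    (hμ : ∀ t ∈ Set.Ioo (-δ) δ, ∫⁻ x, ENNReal.ofReal (Real.exp (t * x)) ∂μ ≠ ⊤) : μ = ν := by
  have int (ρ : Measure ℝ) (t : ℝ) (ht : ∫⁻ x, ENNReal.ofReal (Real.exp (t * x)) ∂ρ ≠ ⊤) :
      t ∈ integrableExpSet id ρ := by
    rw [integrableExpSet, Set.mem_ofPred_eq]
    refine ⟨by fun_prop, ?_⟩
    rw [hasFiniteIntegral_iff_ofReal (ae_of_all _ fun x => (Real.exp_pos _).le)]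
    exact ht.lt_top
  have sub (ρ : Measure ℝ) (hρ : ∀ t ∈ Set.Ioo (-δ) δ,
      ∫⁻ x, ENNReal.ofReal (Real.exp (t * x)) ∂ρ ≠ ⊤) :
      Set.Ioo (-δ) δ ⊆ interior (integrableExpSet id ρ) :=
    interior_maximal (fun t ht => int ρ t (hρ t ht)) isOpen_Ioo
  have hν : ∀ t ∈ Set.Ioo (-δ) δ, ∫⁻ x, ENNReal.ofReal (Real.exp (t * x)) ∂ν ≠ ⊤ :=
    fun t ht => (h t ht) ▸ hμ t ht
  have hmgf : ∀ t ∈ Set.Ioo (-δ) δ, mgf id μ t = mgf id ν t := by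
    intro t ht
    simp only [mgf, id]
    rw [integral_eq_lintegral_of_nonneg_ae (ae_of_all _ fun x => (Real.exp_pos _).le) (by fun_prop),
      integral_eq_lintegral_of_nonneg_ae (ae_of_all _ fun x => (Real.exp_pos _).le) (by fun_prop),
      h t ht]
  have hA : AnalyticOnNhd ℂ (complexMGF id μ) {z : ℂ | z.re ∈ Set.Ioo (-δ) δ} :=
    analyticOnNhd_complexMGF.mono fun z hz => sub μ hμ hz
  have hB : AnalyticOnNhd ℂ (complexMGF id ν) {z : ℂ | z.re ∈ Set.Ioo (-δ) δ} :=
    analyticOnNhd_complexMGF.mono fun z hz => sub ν hν hz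
  have key : Set.EqOn (complexMGF id μ) (complexMGF id ν) {z : ℂ | z.re ∈ Set.Ioo (-δ) δ} := by
    refine AnalyticOnNhd.eqOn_of_preconnected_of_frequently_eq hA hB
      ((convex_Ioo (-δ) δ).linear_preimage Complex.reLm).isPreconnected
      (z₀ := ((0 : ℝ) : ℂ)) (by simp [hδ]) ?_
    have h_real : ∃ᶠ x : ℝ in 𝓝[≠] 0, complexMGF id μ x = complexMGF id ν x := by
      refine Eventually.frequently ?_
      filter_upwards [nhdsWithin_le_nhds (Ioo_mem_nhds (neg_lt_zero.2 hδ) hδ)] with y hy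
      rw [complexMGF_ofReal, complexMGF_ofReal, hmgf y hy]
    rw [frequently_iff_seq_forall] at h_real ⊢
    obtain ⟨xs, hx_tendsto, hx_eq⟩ := h_real
    refine ⟨fun n ↦ xs n, ?_, fun n ↦ ?_⟩
    · rw [tendsto_nhdsWithin_iff] at hx_tendsto ⊢
      constructor
      · exact (Complex.continuous_ofReal.tendsto 0).comp hx_tendsto.1
      · simpa using hx_tendsto.2
    · simp [hx_eq]
  refine Measure.ext_of_charFun ?_
  ext t
  rw [← complexMGF_id_mul_I, ← complexMGF_id_mul_I]
  exact key (by simp [hδ])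

/-- A coordinate on `E`: a closed embedding into the nonnegative real half-line. -/
structure IsCoordinate {E : Type*} [TopologicalSpace E] (ι : E → ℝ) : Prop where
  isClosedEmbedding : IsClosedEmbedding ι
  nonneg : ∀ x, 0 ≤ ι x

theorem isCoordinate_nnreal : IsCoordinate (fun x : ℝ≥0 => (x : ℝ)) :=
  ⟨NNReal.isClosedEmbedding_coe, fun x => x.2⟩

theorem isCoordinate_nat : IsCoordinate (fun n : ℕ => (n : ℝ)) :=
  ⟨Nat.isClosedEmbedding_coe_real, fun n => n.cast_nonneg⟩

/-- The Laplace transform of a measure, with respect to the coordinate `ι`. -/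
noncomputable def laplace {E : Type*} [MeasurableSpace E] (ι : E → ℝ) (μ : Measure E) (l : ℝ) :
    ℝ≥0∞ :=
  ∫⁻ x, ENNReal.ofReal (Real.exp (-(l * ι x))) ∂μ

theorem laplace_ne_top {E : Type*} [TopologicalSpace E] [MeasurableSpace E] {ι : E → ℝ}
    {μ : Measure E} [IsFiniteMeasure μ] (hι : IsCoordinate ι) {l : ℝ}
    (hl : 0 ≤ l) : laplace ι μ l ≠ ⊤ := by
  refine ((lintegral_mono fun x => ?_).trans_lt (b := ∫⁻ _, 1 ∂μ) (by simp)).ne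
  rw [← ENNReal.ofReal_one]
  exact ENNReal.ofReal_le_ofReal (Real.exp_le_one_iff.2 (by
    have := mul_nonneg hl (hι.nonneg x); linarith))

variable {E : Type*} [TopologicalSpace E] [MeasurableSpace E] [BorelSpace E] {ι : E → ℝ}

theorem IsCoordinate.measurable (hι : IsCoordinate ι) : Measurable ι :=
  hι.isClosedEmbedding.continuous.measurable

theorem IsCoordinate.measurable_exp (hι : IsCoordinate ι) (l : ℝ) :
    Measurable fun x => ENNReal.ofReal (Real.exp (-(l * ι x))) := by
  have := hι.measurable
  fun_prop

/-- A measure is determined by the restriction of its Laplace transform to `(0, 1)`, if this is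
finite. -/
theorem IsCoordinate.ext_of_laplace (hι : IsCoordinate ι) {μ ν : Measure E}
    (h : ∀ l ∈ Set.Ioo (0 : ℝ) 1, laplace ι μ l = laplace ι ν l)
    (hμ : ∀ l ∈ Set.Ioo (0 : ℝ) 1, laplace ι μ l ≠ ⊤) : μ = ν := by
  -- Tilting by `exp (-ι / 2)` makes a possibly infinite measure finite and moves the interval `(0,
  -- 1)` of frequencies to `(-1/2, 1/2)`, a neighbourhood of `0`.
  set w : E → ℝ≥0∞ := fun x => ENNReal.ofReal (Real.exp (-(1 / 2 * ι x))) with hw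
  have wm : Measurable w := hι.measurable_exp _
  have tilt (ρ : Measure E) (t : ℝ) :
      ∫⁻ x, ENNReal.ofReal (Real.exp (t * x)) ∂((ρ.withDensity w).map ι) =
        laplace ι ρ (1 / 2 - t) := by
    rw [lintegral_map (by fun_prop) hι.measurable, lintegral_withDensity_eq_lintegral_mul _ wm
      (by have := hι.measurable; fun_prop), laplace]
    refine lintegral_congr fun x => ?_
    rw [Pi.mul_apply, hw, ← ENNReal.ofReal_mul (Real.exp_pos _).le, ← Real.exp_add]
    ring_nf
  have fin (ρ : Measure E) (hρ : laplace ι ρ (1 / 2) ≠ ⊤) :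
      IsFiniteMeasure ((ρ.withDensity w).map ι) := by
    refine ⟨?_⟩
    have := tilt ρ 0
    simp only [zero_mul, Real.exp_zero, ENNReal.ofReal_one, lintegral_one, sub_zero] at this
    rw [this]
    exact hρ.lt_top
  have h2 : (1 / 2 : ℝ) ∈ Set.Ioo (0 : ℝ) 1 := by norm_num
  have := fin μ (hμ _ h2)
  have := fin ν (h _ h2 ▸ hμ _ h2)
  have key : (μ.withDensity w).map ι = (ν.withDensity w).map ι := by
    have mem (t : ℝ) (ht : t ∈ Set.Ioo (-(1 / 2) : ℝ) (1 / 2)) : 1 / 2 - t ∈ Set.Ioo (0 : ℝ) 1 :=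
      ⟨by linarith [ht.2], by linarith [ht.1]⟩
    refine eq_of_lintegral_exp_eq (δ := 1 / 2) (by norm_num) ?_ ?_
    · intro t ht
      rw [tilt, tilt, h _ (mem t ht)]
    · intro t ht
      rw [tilt]
      exact hμ _ (mem t ht)
  have e := hι.isClosedEmbedding.measurableEmbedding
  have key2 : μ.withDensity w = ν.withDensity w := by
    rw [← e.comap_map (μ.withDensity w), key, e.comap_map]
  -- The weight is positive and finite, so the tilt can be undone.
  have inv (ρ : Measure E) : (ρ.withDensity w).withDensity w⁻¹ = ρ :=
    withDensity_inv_same wm (ae_of_all _ fun x => by simp [hw, Real.exp_pos])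
      (ae_of_all _ fun x => by simp [hw])
  rw [← inv μ, key2, inv]

theorem IsCoordinate.kernel_ext (hι : IsCoordinate ι) {Y : Type*} [MeasurableSpace Y]
    {κ η : Kernel Y E} [IsMarkovKernel κ]
    (h : ∀ y, ∀ l ∈ Set.Ioo (0 : ℝ) 1, laplace ι (κ y) l = laplace ι (η y) l) : κ = η := by
  ext1 y
  exact hι.ext_of_laplace (h y) fun l hl => laplace_ne_top hι hl.1.le

end Laplace

/-! ### Exponentials in the space of functions vanishing at infinity -/

section Exponentials

open Polynomial

variable {E : Type*} [TopologicalSpace E] {ι : E → ℝ}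

/-- The function `x ↦ exp (-l * ι x)`. -/
noncomputable def IsCoordinate.expC0 (hι : IsCoordinate ι) (l : ℝ) (hl : 0 < l) : C₀(E, ℝ) where
  toFun x := Real.exp (-(l * ι x))
  continuous_toFun := by
    have := hι.isClosedEmbedding.continuous
    fun_prop
  zero_at_infty' := by
    have h1 : Tendsto (fun x => |ι x|) (cocompact E) atTop :=
      (tendsto_norm_cocompact_atTop (E := ℝ)).comp hι.isClosedEmbedding.tendsto_cocompact
    simp only [abs_of_nonneg (hι.nonneg _)] at h1
    exact Real.tendsto_exp_neg_atTop_nhds_zero.comp (h1.const_mul_atTop hl)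

@[simp]
theorem IsCoordinate.expC0_apply (hι : IsCoordinate ι) (l : ℝ) (hl : 0 < l) (x : E) :
    hι.expC0 l hl x = Real.exp (-(l * ι x)) := rfl

/-- Stone–Weierstrass on the one-point compactification: `z = exp (-ι)`, extended by `0`, separates
points, so polynomials in `z` are dense. The constant term is small because `f` vanishes at
infinity, and dropping it leaves a multiple of `z`. -/
theorem IsCoordinate.exists_polynomial_near (hι : IsCoordinate ι) (f : C₀(E, ℝ)) {ε : ℝ}
    (hε : 0 < ε) : ∃ q : ℝ[X],
      ∀ x, |Real.exp (-ι x) * q.eval (Real.exp (-ι x)) - f x| ≤ ε := by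
  have : T2Space E := hι.isClosedEmbedding.isEmbedding.t2Space
  have ext_cont (g : C₀(E, ℝ)) : Continuous fun y : OnePoint E => y.elim 0 g := by
    rw [OnePoint.continuous_iff]
    refine ⟨?_, g.continuous⟩
    rw [Filter.coclosedCompact_eq_cocompact]
    exact g.zero_at_infty'
  let ext (g : C₀(E, ℝ)) : C(OnePoint E, ℝ) := ⟨fun y => y.elim 0 g, ext_cont g⟩
  set z := ext (hι.expC0 1 one_pos) with hz
  have hzx (x : E) : z (x : OnePoint E) = Real.exp (-ι x) := by
    simp [hz, ext]
  have hzi : z OnePoint.infty = 0 := rfl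
  have sep : (Algebra.adjoin ℝ {z}).SeparatesPoints := by
    intro x y hxy
    refine ⟨z, ⟨z, Algebra.subset_adjoin rfl, rfl⟩, ?_⟩
    induction x using OnePoint.rec with
    | infty =>
      induction y using OnePoint.rec with
      | infty => exact absurd rfl hxy
      | coe y => rw [hzx, hzi]; exact (Real.exp_pos _).ne
    | coe x =>
      induction y using OnePoint.rec with
      | infty => rw [hzx, hzi]; exact (Real.exp_pos _).ne'
      | coe y =>
        rw [hzx, hzx]
        intro h
        refine hxy (congrArg _ (hι.isClosedEmbedding.injective ?_))
        simpa using h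
  -- One half of `ε` is for the error at `x`, the other for the constant term, which is the error at
  -- infinity.
  obtain ⟨⟨g, hg⟩, hgf⟩ := ContinuousMap.exists_mem_subalgebra_near_continuousMap_of_separatesPoints
    _ sep (ext f) (ε / 2) (half_pos hε)
  rw [Algebra.adjoin_singleton_eq_range_aeval] at hg
  obtain ⟨p, rfl⟩ := hg
  have hgf' (y : OnePoint E) : |p.eval (z y) - ext f y| < ε / 2 := by
    have := (ContinuousMap.norm_coe_le_norm _ y).trans_lt hgf
    simpa [Polynomial.aeval_continuousMap_apply] using this
  refine ⟨p.divX, fun x => ?_⟩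
  have h1 := hgf' x
  have h2 := hgf' OnePoint.infty
  have h3 : p.eval (z x) = Real.exp (-ι x) * p.divX.eval (Real.exp (-ι x)) + p.eval 0 := by
    have h4 := congrArg (Polynomial.eval (z x)) p.divX_mul_X_add
    rw [← h4, hzx, ← p.coeff_zero_eq_eval_zero, eval_add, eval_mul, eval_X, eval_C, mul_comm]
  rw [h3] at h1
  rw [hzi] at h2
  change |_ - f x| < _ at h1
  change |_ - (0 : ℝ)| < _ at h2
  rw [abs_lt] at h1 h2
  rw [abs_le]
  constructor <;> linarith [h1.1, h1.2, h2.1, h2.2]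

theorem IsCoordinate.exists_polynomial_expC0 (hι : IsCoordinate ι) (q : ℝ[X])
    (M : Submodule ℝ C₀(E, ℝ)) (h : ∀ k : ℕ, hι.expC0 (k + 1) (by positivity) ∈ M) :
    ∃ g ∈ M, ∀ x, g x = Real.exp (-ι x) * q.eval (Real.exp (-ι x)) := by
  induction q using Polynomial.induction_on' with
  | add p q hp hq =>
    obtain ⟨g, hg, hg'⟩ := hp
    obtain ⟨k, hk, hk'⟩ := hq
    exact ⟨g + k, M.add_mem hg hk, fun x => by simp [hg', hk', mul_add]⟩
  | monomial n a =>
    refine ⟨a • hι.expC0 (n + 1) (by positivity), M.smul_mem _ (h n), fun x => ?_⟩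
    simp only [ZeroAtInftyContinuousMap.smul_apply, expC0_apply, smul_eq_mul, eval_monomial]
    rw [← Real.exp_nat_mul, mul_left_comm, ← Real.exp_add]
    ring_nf

/-- The exponentials span a dense subspace. -/
theorem IsCoordinate.eq_top_of_expC0_mem (hι : IsCoordinate ι)
    (M : Submodule ℝ C₀(E, ℝ)) (hM : IsClosed (M : Set C₀(E, ℝ)))
    (h : ∀ k : ℕ, hι.expC0 (k + 1) (by positivity) ∈ M) : M = ⊤ := by
  rw [eq_top_iff]
  intro f _
  refine hM.closure_subset_iff.2 subset_rfl (Metric.mem_closure_iff.2 fun ε hε => ?_)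
  obtain ⟨q, hq⟩ := hι.exists_polynomial_near f (half_pos hε)
  obtain ⟨g, hg, hg'⟩ := hι.exists_polynomial_expC0 q M h
  refine ⟨g, hg, ?_⟩
  rw [dist_comm, ← ZeroAtInftyContinuousMap.dist_toBCF_eq_dist]
  refine lt_of_le_of_lt ((BoundedContinuousFunction.dist_le (half_pos hε).le).2 fun x => ?_)
    (half_lt_self hε)
  rw [Real.dist_eq]
  simpa [hg'] using hq x

end Exponentials

/-! ### Markov kernels acting on functions vanishing at infinity -/

section KernelOperator

theorem C0_norm_le {X : Type*} [TopologicalSpace X] {f : C₀(X, ℝ)} {C : ℝ} (hC : 0 ≤ C)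
    (h : ∀ x, |f x| ≤ C) : ‖f‖ ≤ C := by
  rw [← ZeroAtInftyContinuousMap.norm_toBCF_eq_norm]
  exact (BoundedContinuousFunction.norm_le hC).2 h

theorem C0_abs_le_norm {X : Type*} [TopologicalSpace X] (f : C₀(X, ℝ)) (x : X) : |f x| ≤ ‖f‖ := by
  rw [← ZeroAtInftyContinuousMap.norm_toBCF_eq_norm]
  exact f.toBCF.norm_coe_le_norm x

variable {X Y : Type*} [TopologicalSpace X] [MeasurableSpace X] [TopologicalSpace Y]
  [MeasurableSpace Y]

/-- The kernel `κ` maps functions vanishing at infinity to functions vanishing at infinity. -/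
def PreservesC0 (κ : Kernel X Y) : Prop :=
  ∀ f : C₀(Y, ℝ), ∃ g : C₀(X, ℝ), ∀ x, g x = ∫ y, f y ∂(κ x)

theorem C0_integrable [OpensMeasurableSpace X] (f : C₀(X, ℝ)) (μ : Measure X) [IsFiniteMeasure μ] :
    Integrable f μ :=
  f.toBCF.integrable μ

theorem abs_integral_C0_le (f : C₀(X, ℝ)) (μ : Measure X)
    [IsProbabilityMeasure μ] : |∫ x, f x ∂μ| ≤ ‖f‖ := by
  simpa using norm_integral_le_of_norm_le_const (μ := μ) (f := f)
    (ae_of_all _ fun x => C0_abs_le_norm f x)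

variable [OpensMeasurableSpace Y]

/-- The operator on functions vanishing at infinity given by a Markov kernel. -/
noncomputable def PreservesC0.toCLM {κ : Kernel X Y} [IsMarkovKernel κ] (hκ : PreservesC0 κ) :
    C₀(Y, ℝ) →L[ℝ] C₀(X, ℝ) :=
  LinearMap.mkContinuous
    { toFun := fun f => (hκ f).choose
      map_add' := fun f g => by
        ext x
        rw [ZeroAtInftyContinuousMap.add_apply, (hκ _).choose_spec, (hκ _).choose_spec,
          (hκ _).choose_spec, ← integral_add (C0_integrable f _) (C0_integrable g _)]
        rfl
      map_smul' := fun c f => by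
        ext x
        rw [RingHom.id_apply, ZeroAtInftyContinuousMap.smul_apply, (hκ _).choose_spec,
          (hκ _).choose_spec, smul_eq_mul, ← integral_const_mul]
        rfl } 1
    fun f => by
      rw [one_mul]
      refine C0_norm_le (norm_nonneg f) fun x => ?_
      change |(hκ f).choose x| ≤ _
      rw [(hκ f).choose_spec]
      exact abs_integral_C0_le f _

theorem PreservesC0.toCLM_apply {κ : Kernel X Y} [IsMarkovKernel κ] (hκ : PreservesC0 κ)
    (f : C₀(Y, ℝ)) (x : X) : hκ.toCLM f x = ∫ y, f y ∂(κ x) :=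
  (hκ f).choose_spec x

theorem PreservesC0.norm_toCLM_apply_le {κ : Kernel X Y} [IsMarkovKernel κ] (hκ : PreservesC0 κ)
    (f : C₀(Y, ℝ)) : ‖hκ.toCLM f‖ ≤ ‖f‖ :=
  C0_norm_le (norm_nonneg f) fun x => by
    rw [hκ.toCLM_apply]
    exact abs_integral_C0_le f _

/-- It is enough to check `PreservesC0` on the exponentials. -/
theorem IsCoordinate.preservesC0 {ι : Y → ℝ} (hι : IsCoordinate ι) (κ : Kernel X Y)
    [IsMarkovKernel κ]
    (h : ∀ (l : ℝ) (hl : 0 < l), ∃ g : C₀(X, ℝ), ∀ x, g x = ∫ y, hι.expC0 l hl y ∂(κ x)) :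
    PreservesC0 κ := by
  let M : Submodule ℝ C₀(Y, ℝ) :=
    { carrier := {f | ∃ g : C₀(X, ℝ), ∀ x, g x = ∫ y, f y ∂(κ x)}
      add_mem' := by
        rintro f f' ⟨g, hg⟩ ⟨g', hg'⟩
        refine ⟨g + g', fun x => ?_⟩
        rw [ZeroAtInftyContinuousMap.add_apply, hg, hg',
          ← integral_add (C0_integrable f _) (C0_integrable f' _)]
        rfl
      zero_mem' := ⟨0, fun x => by simp⟩
      smul_mem' := by
        rintro c f ⟨g, hg⟩
        refine ⟨c • g, fun x => ?_⟩
        rw [ZeroAtInftyContinuousMap.smul_apply, hg, smul_eq_mul, ← integral_const_mul]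
        rfl }
  -- Averaging against a probability measure is a sup-norm contraction, so images of a convergent
  -- sequence are Cauchy in `C₀(X, ℝ)`.
  have hM : IsClosed (M : Set C₀(Y, ℝ)) := by
    refine IsSeqClosed.isClosed fun u f hu huf => ?_
    choose g hg using hu
    have hc : CauchySeq g := by
      rw [Metric.cauchySeq_iff']
      intro ε hε
      obtain ⟨N, hN⟩ := Metric.cauchySeq_iff'.1 huf.cauchySeq (ε / 2) (half_pos hε)
      refine ⟨N, fun n hn => lt_of_le_of_lt ?_ (half_lt_self hε)⟩
      rw [dist_eq_norm]
      refine C0_norm_le (half_pos hε).le fun x => ?_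
      rw [ZeroAtInftyContinuousMap.sub_apply, hg, hg,
        ← integral_sub (C0_integrable _ _) (C0_integrable _ _)]
      refine (abs_integral_C0_le (u n - u N) (κ x)).trans ?_
      rw [← dist_eq_norm]
      exact (hN n hn).le
    obtain ⟨k, hk⟩ := cauchySeq_tendsto_of_complete hc
    refine ⟨k, fun x => ?_⟩
    have h1 : Tendsto (fun n => g n x) atTop (𝓝 (k x)) :=
      (ZeroAtInftyContinuousMap.tendsto_iff_tendstoUniformly.1 hk).tendsto_at x
    refine tendsto_nhds_unique h1 ?_
    simp only [hg]
    rw [tendsto_iff_norm_sub_tendsto_zero]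
    refine squeeze_zero (fun _ => norm_nonneg _) (fun n => ?_)
      (tendsto_iff_norm_sub_tendsto_zero.1 huf)
    rw [← integral_sub (C0_integrable _ _) (C0_integrable _ _)]
    exact abs_integral_C0_le (u n - f) (κ x)
  have key := hι.eq_top_of_expC0_mem M hM fun k => h _ _
  intro f
  have : f ∈ M := key ▸ Submodule.mem_top
  exact this

end KernelOperator

/-! ### Feller semigroups as contraction semigroups -/

section Feller

variable {E : Type*} [TopologicalSpace E] [MeasurableSpace E] [BorelSpace E]
  {P P' : ℝ≥0 → Kernel E E}

theorem integral_exp_eq_toReal_laplace {ι : E → ℝ} (hι : IsCoordinate ι) {l : ℝ} (hl : 0 < l)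
    (μ : Measure E) : ∫ x, hι.expC0 l hl x ∂μ = (laplace ι μ l).toReal := by
  have := hι.measurable
  simp only [hι.expC0_apply]
  rw [integral_eq_lintegral_of_nonneg_ae (ae_of_all _ fun x => (Real.exp_pos _).le)
    (by fun_prop), laplace]

/-- The contraction semigroup on functions vanishing at infinity of a Feller semigroup. -/
noncomputable def IsFellerSemigroup.op (hP : IsFellerSemigroup P) (t : ℝ≥0) :
    C₀(E, ℝ) →L[ℝ] C₀(E, ℝ) :=
  haveI := hP.markov t
  PreservesC0.toCLM (hP.mapsTo t)

theorem IsFellerSemigroup.op_apply (hP : IsFellerSemigroup P) (t : ℝ≥0) (f : C₀(E, ℝ)) (x : E) :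
    hP.op t f x = ∫ y, f y ∂(P t x) :=
  haveI := hP.markov t
  PreservesC0.toCLM_apply _ _ _

theorem IsFellerSemigroup.isContractionSemigroup (hP : IsFellerSemigroup P) :
    IsContractionSemigroup hP.op where
  norm_le t f :=
    haveI := hP.markov t
    PreservesC0.norm_toCLM_apply_le _ _
  zero f := by
    ext x
    rw [hP.op_apply, hP.zero, Kernel.id_apply,
      integral_dirac' (fun y => f y) x f.continuous.stronglyMeasurable]
  add s t f := by
    have := hP.markov
    ext x
    rw [hP.op_apply, hP.op_apply, hP.add, Kernel.integral_comp (C0_integrable f _)]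
    simp [hP.op_apply]
  continuous f := by
    rw [ZeroAtInftyContinuousMap.tendsto_iff_tendstoUniformly]
    simpa only [← hP.op_apply] using hP.continuous f

theorem IsFellerSemigroup.inGenerator_iff (hP : IsFellerSemigroup P) (f g : C₀(E, ℝ)) :
    InGenerator P f g ↔ IsGenerated hP.op f g := by
  rw [IsGenerated, ZeroAtInftyContinuousMap.tendsto_iff_tendstoUniformly, InGenerator]
  refine tendstoUniformly_congr (Eventually.of_forall fun t => funext fun x => ?_)
  simp [hP.op_apply, div_eq_inv_mul]

/-- Families of Markov kernels which are compatible with the exponentials form a Feller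
semigroup. -/
theorem IsCoordinate.isFellerSemigroup {ι : E → ℝ} (hι : IsCoordinate ι)
    (hP : ∀ t, IsMarkovKernel (P t)) (h0 : P 0 = Kernel.id)
    (hadd : ∀ s t x, ∀ l ∈ Set.Ioo (0 : ℝ) 1,
      laplace ι (P (s + t) x) l = laplace ι ((P t ∘ₖ P s) x) l)
    (hmaps : ∀ (t : ℝ≥0) (l : ℝ) (hl : 0 < l),
      ∃ g : C₀(E, ℝ), ∀ x, g x = ∫ y, hι.expC0 l hl y ∂(P t x))
    (hcont : ∀ (l : ℝ) (hl : 0 < l),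
      TendstoUniformly (fun (t : ℝ≥0) (x : E) => ∫ y, hι.expC0 l hl y ∂(P t x))
        (fun x => hι.expC0 l hl x) (𝓝 0)) : IsFellerSemigroup P := by
  have hmaps' (t : ℝ≥0) : PreservesC0 (P t) := hι.preservesC0 (P t) (hmaps t)
  refine ⟨hP, h0, fun s t => hι.kernel_ext (hadd s t), hmaps', ?_⟩
  let A (t : ℝ≥0) : C₀(E, ℝ) →L[ℝ] C₀(E, ℝ) := (hmaps' t).toCLM
  have hA (t f) : ‖A t f‖ ≤ ‖f‖ := (hmaps' t).norm_toCLM_apply_le f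
  have conv (f : C₀(E, ℝ)) :
      TendstoUniformly (fun (t : ℝ≥0) (x : E) => ∫ y, f y ∂(P t x)) (fun x => f x) (𝓝 0) ↔
        Tendsto (fun t => A t f) (𝓝 0) (𝓝 f) := by
    rw [ZeroAtInftyContinuousMap.tendsto_iff_tendstoUniformly]
    refine tendstoUniformly_congr (Eventually.of_forall fun t => funext fun x => ?_)
    exact ((hmaps' t).toCLM_apply f x).symm
  let M : Submodule ℝ C₀(E, ℝ) :=
    { carrier := {f | Tendsto (fun t => A t f) (𝓝 0) (𝓝 f)}
      add_mem' := fun {f g} hf hg => by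
        simpa using Tendsto.add hf hg
      zero_mem' := by simp
      smul_mem' := fun c f hf => by
        simpa using Tendsto.const_smul hf c }
  have hM : IsClosed (M : Set C₀(E, ℝ)) := by
    refine isClosed_of_closure_subset fun f hf => ?_
    change Tendsto (fun t => A t f) (𝓝 0) (𝓝 f)
    rw [Metric.tendsto_nhds]
    intro ε hε
    obtain ⟨g, hg, hfg⟩ := Metric.mem_closure_iff.1 hf (ε / 3) (by positivity)
    filter_upwards [Metric.tendsto_nhds.1 hg (ε / 3) (by positivity)] with t ht
    have h1 : dist (A t f) (A t g) ≤ dist f g := by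
      rw [dist_eq_norm, dist_eq_norm, ← map_sub]
      exact hA _ _
    calc dist (A t f) f ≤ dist (A t f) (A t g) + dist (A t g) g + dist g f :=
          dist_triangle4 _ _ _ _
      _ < ε / 3 + ε / 3 + ε / 3 := by
          rw [dist_comm g f]
          gcongr
          exact h1.trans_lt hfg
      _ = ε := by ring
  have key := hι.eq_top_of_expC0_mem M hM fun k => (conv _).1 (hcont _ _)
  intro f
  have : f ∈ M := key ▸ Submodule.mem_top
  exact (conv f).2 this

/-- Two Feller semigroups coincide if their generators agree along the orbits of the
exponentials. -/
theorem IsCoordinate.fellerSemigroup_eq {ι : E → ℝ} (hι : IsCoordinate ι)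
    (hP : IsFellerSemigroup P) (hP' : IsFellerSemigroup P')
    (h : ∀ (l : ℝ) (hl : 0 < l) (s : ℝ≥0),
      ∃ g, IsGenerated hP.op (hP.op s (hι.expC0 l hl)) g ∧
        IsGenerated hP'.op (hP.op s (hι.expC0 l hl)) g) : P' = P := by
  have := hP.markov
  have := hP'.markov
  funext t
  refine hι.kernel_ext fun x l hl => ?_
  have key := hP.isContractionSemigroup.eq_of_isGenerated hP'.isContractionSemigroup
    (h l hl.1) t
  have key' := DFunLike.congr_fun key x
  rw [hP.op_apply, hP'.op_apply, integral_exp_eq_toReal_laplace,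
    integral_exp_eq_toReal_laplace] at key'
  exact (ENNReal.toReal_eq_toReal_iff' (laplace_ne_top hι hl.1.le)
    (laplace_ne_top hι hl.1.le)).1 key'

end Feller

/-! ### Transforms of the gateway kernels -/

section Gateways

theorem lintegral_rpow_mul_exp {a r : ℝ} (ha : 0 < a) (hr : 0 < r) :
    ∫⁻ x in Set.Ioi (0 : ℝ), ENNReal.ofReal (x ^ (a - 1) * Real.exp (-(r * x))) =
      ENNReal.ofReal ((1 / r) ^ a * Real.Gamma a) := by
  have h := Real.integral_rpow_mul_exp_neg_mul_Ioi ha hr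
  rw [← h, ofReal_integral_eq_lintegral_ofReal]
  · refine Integrable.of_integral_ne_zero ?_
    rw [h]
    have := Real.Gamma_pos_of_pos ha
    positivity
  · rw [EventuallyLE, ae_restrict_iff' measurableSet_Ioi]
    refine ae_of_all _ fun x (hx : 0 < x) => ?_
    simp only [Pi.zero_apply]
    positivity

theorem lintegral_gammaLaw {a : ℝ} (ha : 0 < a) {g : ℝ≥0 → ℝ≥0∞} (hg : Measurable g) :
    ∫⁻ x, g x ∂(gammaLaw a) = ∫⁻ x in Set.Ioi (0 : ℝ),
      ENNReal.ofReal (x ^ (a - 1) * Real.exp (-x) / Real.Gamma a) * g x.toNNReal := by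
  rw [gammaLaw, if_neg ha.ne', lintegral_map hg (by fun_prop), gammaMeasure,
    lintegral_withDensity_eq_lintegral_mul _ (by unfold gammaPDF; fun_prop) (by fun_prop),
    ← setLIntegral_univ, ← Set.Iio_union_Ici (a := (0 : ℝ)),
    lintegral_union measurableSet_Ici (Set.Iio_disjoint_Ici le_rfl),
    setLIntegral_congr_fun (g := fun _ => 0) measurableSet_Iio, lintegral_zero, zero_add,
    setLIntegral_congr Ioi_ae_eq_Ici.symm]
  · refine setLIntegral_congr_fun measurableSet_Ioi fun x (hx : 0 < x) => ?_
    simp only [Pi.mul_apply]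
    rw [gammaPDF_of_nonneg hx.le]
    simp only [Real.one_rpow, one_mul]
    congr 2
    ring
  · intro x (hx : x < 0)
    simp [gammaPDF_of_neg hx]

theorem lintegral_besselMeasure (β : ℝ) {g : ℝ≥0 → ℝ≥0∞} (hg : Measurable g) :
    ∫⁻ x, g x ∂(besselMeasure β) = ∫⁻ x in Set.Ioi (0 : ℝ),
      ENNReal.ofReal (x ^ (β - 1) / Real.Gamma β) * g x.toNNReal := by
  rw [besselMeasure, lintegral_map hg (by fun_prop),
    lintegral_withDensity_eq_lintegral_mul _ (by fun_prop) (by fun_prop)]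
  rfl

/-- The case `k = 0` is the Laplace transform; `k = 1` gives the image under `Λ*` of `x exp (-l x)`,
which appears in the generator. -/
theorem lintegral_rpow_mul_exp_gammaLaw {a : ℝ} (ha : 0 < a) {l : ℝ} (hl : -1 < l) {k : ℝ}
    (hk : 0 ≤ k) :
    ∫⁻ x, ENNReal.ofReal ((x : ℝ) ^ k * Real.exp (-(l * x))) ∂(gammaLaw a) =
      ENNReal.ofReal (Real.Gamma (a + k) / Real.Gamma a * (1 + l) ^ (-(a + k))) := by
  have hG := Real.Gamma_pos_of_pos ha
  rw [lintegral_gammaLaw ha (by fun_prop)]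
  calc _ = ∫⁻ x in Set.Ioi (0 : ℝ), ENNReal.ofReal (1 / Real.Gamma a) *
        ENNReal.ofReal (x ^ (a + k - 1) * Real.exp (-((1 + l) * x))) := by
        refine setLIntegral_congr_fun measurableSet_Ioi fun x (hx : 0 < x) => ?_
        simp only [Real.coe_toNNReal x hx.le]
        rw [← ENNReal.ofReal_mul (by positivity), ← ENNReal.ofReal_mul (by positivity)]
        congr 1
        rw [show a + k - 1 = (a - 1) + k by ring, Real.rpow_add hx,
          show -((1 + l) * x) = -x + -(l * x) by ring, Real.exp_add]
        ring
    _ = _ := by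
        rw [lintegral_const_mul _ (by fun_prop),
          lintegral_rpow_mul_exp (by linarith) (by linarith),
          ← ENNReal.ofReal_mul (by positivity)]
        congr 1
        rw [one_div (1 + l), Real.inv_rpow (by linarith), ← Real.rpow_neg (by linarith)]
        ring

/-- The case `k = 0` is the Laplace transform; `l = 1` with `k = n` gives the weights `m_β(n)` when
`μ_β` is mixed over Poisson laws. -/
theorem lintegral_rpow_mul_exp_besselMeasure {β : ℝ} (hβ : 0 < β) {l : ℝ} (hl : 0 < l) {k : ℝ}
    (hk : 0 ≤ k) :
    ∫⁻ x, ENNReal.ofReal ((x : ℝ) ^ k * Real.exp (-(l * x))) ∂(besselMeasure β) =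
      ENNReal.ofReal (Real.Gamma (β + k) / Real.Gamma β * l ^ (-(β + k))) := by
  have hG := Real.Gamma_pos_of_pos hβ
  rw [lintegral_besselMeasure β (by fun_prop)]
  calc _ = ∫⁻ x in Set.Ioi (0 : ℝ), ENNReal.ofReal (1 / Real.Gamma β) *
        ENNReal.ofReal (x ^ (β + k - 1) * Real.exp (-(l * x))) := by
        refine setLIntegral_congr_fun measurableSet_Ioi fun x (hx : 0 < x) => ?_
        simp only [Real.coe_toNNReal x hx.le]
        rw [← ENNReal.ofReal_mul (by positivity), ← ENNReal.ofReal_mul (by positivity)]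
        congr 1
        rw [show β + k - 1 = (β - 1) + k by ring, Real.rpow_add hx]
        ring
    _ = _ := by
        rw [lintegral_const_mul _ (by fun_prop), lintegral_rpow_mul_exp (by linarith) hl,
          ← ENNReal.ofReal_mul (by positivity)]
        congr 1
        rw [one_div l, Real.inv_rpow hl.le, ← Real.rpow_neg hl.le]
        ring

theorem laplace_besselMeasure {β : ℝ} (hβ : 0 < β) {l : ℝ} (hl : 0 < l) :
    laplace (fun x : ℝ≥0 => (x : ℝ)) (besselMeasure β) l = ENNReal.ofReal (l ^ (-β)) := by
  have h := lintegral_rpow_mul_exp_besselMeasure hβ hl le_rfl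
  simpa [laplace, (Real.Gamma_pos_of_pos hβ).ne'] using h

theorem laplace_gammaLaw {a : ℝ} (ha : 0 ≤ a) {l : ℝ} (hl : -1 < l) :
    laplace (fun x : ℝ≥0 => (x : ℝ)) (gammaLaw a) l = ENNReal.ofReal ((1 + l) ^ (-a)) := by
  rcases ha.eq_or_lt with rfl | ha
  · rw [laplace, gammaLaw, if_pos rfl, lintegral_dirac]
    simp
  · have h := lintegral_rpow_mul_exp_gammaLaw ha hl le_rfl
    simpa [laplace, (Real.Gamma_pos_of_pos ha).ne'] using h

theorem lintegral_mul_exp_gammaLaw {a : ℝ} (ha : 0 ≤ a) {l : ℝ} (hl : -1 < l) :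
    ∫⁻ x : ℝ≥0, ENNReal.ofReal (x * Real.exp (-(l * x))) ∂(gammaLaw a) =
      ENNReal.ofReal (a * (1 + l) ^ (-(a + 1))) := by
  rcases ha.eq_or_lt with rfl | ha
  · rw [gammaLaw, if_pos rfl, lintegral_dirac]
    simp
  · have h := lintegral_rpow_mul_exp_gammaLaw ha hl zero_le_one
    simpa [Real.Gamma_add_one ha.ne', (Real.Gamma_pos_of_pos ha).ne'] using h

theorem isProbabilityMeasure_gammaLaw {a : ℝ} (ha : 0 ≤ a) : IsProbabilityMeasure (gammaLaw a) := by
  refine ⟨?_⟩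
  simpa [laplace] using laplace_gammaLaw ha (l := 0) (by norm_num)

theorem isMarkovKernel_gammaGateway {β : ℝ} (hβ : 0 ≤ β) : IsMarkovKernel (gammaGateway β) :=
  ⟨fun n => isProbabilityMeasure_gammaLaw (add_nonneg n.cast_nonneg hβ)⟩

theorem lintegral_pow_poissonMeasure (x : ℝ≥0) {s : ℝ} (hs : 0 ≤ s) :
    ∫⁻ n, ENNReal.ofReal (s ^ n) ∂(poissonMeasure x) =
      ENNReal.ofReal (Real.exp (-(x * (1 - s)))) := by
  rw [poissonMeasure, lintegral_sum_measure]
  simp only [lintegral_smul_measure, lintegral_dirac, smul_eq_mul]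
  have h : HasSum (fun n : ℕ => Real.exp (-x) * (x : ℝ) ^ n / n ! * s ^ n)
      (Real.exp (-(x * (1 - s)))) := by
    have := (NormedSpace.expSeries_div_hasSum_exp ((x : ℝ) * s)).mul_left (Real.exp (-x))
    rw [← Real.exp_eq_exp_ℝ, ← Real.exp_add] at this
    rw [show -((x : ℝ) * (1 - s)) = -x + x * s by ring]
    refine HasSum.congr_fun this fun n => ?_
    rw [mul_pow]
    ring
  rw [← h.tsum_eq, ENNReal.ofReal_tsum_of_nonneg (fun n => by positivity) h.summable]
  refine tsum_congr fun n => ?_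
  rw [← ENNReal.ofReal_mul (by positivity)]

theorem isMarkovKernel_poissonGateway : IsMarkovKernel poissonGateway :=
  ⟨fun x => inferInstanceAs (IsProbabilityMeasure (poissonMeasure x))⟩

theorem laplace_nat (μ : Measure ℕ) (l : ℝ) :
    laplace (fun n : ℕ => (n : ℝ)) μ l = ∫⁻ n, ENNReal.ofReal (Real.exp (-l) ^ n) ∂μ := by
  refine lintegral_congr fun n => ?_
  rw [← Real.exp_nat_mul]
  ring_nf

theorem rpow_neg_nat_add {c : ℝ} (hc : 0 < c) (n : ℕ) (β : ℝ) :
    c ^ (-((n : ℝ) + β)) = c ^ (-β) * (c⁻¹) ^ n := by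
  rw [neg_add, Real.rpow_add hc, Real.rpow_neg hc.le, Real.rpow_natCast, inv_pow, mul_comm]

theorem laplace_gammaGateway {β : ℝ} (hβ : 0 ≤ β) (n : ℕ) {l : ℝ} (hl : -1 < l) :
    laplace (fun x : ℝ≥0 => (x : ℝ)) (gammaGateway β n) l =
      ENNReal.ofReal ((1 + l) ^ (-β) * ((1 + l)⁻¹) ^ n) := by
  change laplace _ (gammaLaw (n + β)) l = _
  rw [laplace_gammaLaw (by positivity) hl, rpow_neg_nat_add (by linarith)]

theorem laplace_map_mul (μ : Measure ℝ≥0) (t : ℝ≥0) (l : ℝ) :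
    laplace (fun x : ℝ≥0 => (x : ℝ)) (μ.map (t * ·)) l =
      laplace (fun x : ℝ≥0 => (x : ℝ)) μ (l * t) := by
  rw [laplace, lintegral_map (isCoordinate_nnreal.measurable_exp l) (by fun_prop), laplace]
  refine lintegral_congr fun x => ?_
  push_cast
  ring_nf

theorem laplace_comp {X E : Type*} [MeasurableSpace X] [TopologicalSpace E] [MeasurableSpace E]
    [BorelSpace E] {ι : E → ℝ} (hι : IsCoordinate ι) (κ : Kernel X E) (μ : Measure X) (l : ℝ) :
    laplace ι (κ ∘ₘ μ) l = ∫⁻ x, laplace ι (κ x) l ∂μ := by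
  rw [laplace, Measure.lintegral_bind κ.measurable.aemeasurable
    (hι.measurable_exp l).aemeasurable]
  rfl

/-- Averaging `(1 + l)^(-β-N)` over a Poisson `N` is the Poisson generating function at `s =
1/(1+l)`, where `1 - s = l/(1+l)`. -/
theorem laplace_gamma_comp_poisson {β : ℝ} (hβ : 0 ≤ β) (y : ℝ≥0) {l : ℝ} (hl : 0 ≤ l) :
    laplace (fun x : ℝ≥0 => (x : ℝ)) (gammaGateway β ∘ₘ poissonMeasure y) l =
      ENNReal.ofReal ((1 + l) ^ (-β) * Real.exp (-(l / (1 + l) * y))) := by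
  rw [laplace_comp isCoordinate_nnreal]
  simp only [laplace_gammaGateway hβ _ (by linarith : -1 < l)]
  simp only [ENNReal.ofReal_mul (by positivity : 0 ≤ (1 + l) ^ (-β))]
  rw [lintegral_const_mul _ (by fun_prop), lintegral_pow_poissonMeasure _ (by positivity)]
  congr 4
  have : 1 + l ≠ 0 := by positivity
  field_simp
  ring

end Gateways

/-! ### The transition kernels -/

section Transition

/-- The transition kernels of the squared Bessel semigroup. -/
noncomputable def besselKernel (β : ℝ) (t : ℝ≥0) : Kernel ℝ≥0 ℝ≥0 :=
  if t = 0 then Kernel.id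
  -- The law of `t · Gam(N + β)` with `N` Poisson of parameter `x / t`, that is, `Λ Λ*` conjugated
  -- by the scaling by `t`.
  else ((gammaGateway β ∘ₖ poissonGateway.comap (fun x => x / t) (by fun_prop))).map (t * ·)

theorem isMarkovKernel_besselKernel {β : ℝ} (hβ : 0 ≤ β) (t : ℝ≥0) :
    IsMarkovKernel (besselKernel β t) := by
  have := isMarkovKernel_gammaGateway hβ
  have := isMarkovKernel_poissonGateway
  rw [besselKernel]
  split_ifs with h
  · infer_instance
  · exact Kernel.IsMarkovKernel.map _ (by fun_prop)

theorem laplace_besselKernel {β : ℝ} (hβ : 0 ≤ β) (t x : ℝ≥0) {l : ℝ} (hl : 0 ≤ l) :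
    laplace (fun x : ℝ≥0 => (x : ℝ)) (besselKernel β t x) l =
      ENNReal.ofReal ((1 + l * t) ^ (-β) * Real.exp (-(l / (1 + l * t) * x))) := by
  rw [besselKernel]
  split_ifs with h
  · subst h
    rw [Kernel.id_apply, laplace, lintegral_dirac' _ (isCoordinate_nnreal.measurable_exp l)]
    simp
  · have ht : (t : ℝ) ≠ 0 := by simpa using h
    rw [Kernel.map_apply _ (by fun_prop), laplace_map_mul, Kernel.comp_apply,
      Kernel.comap_apply]
    change laplace _ (gammaGateway β ∘ₘ poissonMeasure (x / t)) _ = _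
    rw [laplace_gamma_comp_poisson hβ _ (by positivity)]
    congr 4
    have : 1 + l * t ≠ 0 := by positivity
    push_cast
    field_simp

/-- The transition kernels of the linear birth-death semigroup. -/
noncomputable def birthDeathKernel (β : ℝ) (t : ℝ≥0) : Kernel ℕ ℕ where
  -- Each of the `n` initial individuals has living descendants at time `t` with probability
  -- `1/(1+t)`. Given `k` such families, the population is `k` plus a Poisson variable of random
  -- parameter `t · Gam(k + β)`, the summand `β` in the shape accounting for immigration.
  toFun n := ∑ k ∈ Finset.range (n + 1),
    ENNReal.ofReal ((1 / (1 + t : ℝ)) ^ k * (t / (1 + t : ℝ)) ^ (n - k) * n.choose k) •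
      (poissonGateway ∘ₘ ((gammaLaw (k + β)).map (t * ·))).map (k + ·)
  measurable' := measurable_of_countable _

/-- The transform of the `k`-th term is geometric in `k`, so the binomial theorem sums the mixture.
-/
theorem lintegral_pow_birthDeathKernel {β : ℝ} (hβ : 0 ≤ β) (t : ℝ≥0) (n : ℕ) {s : ℝ} (hs : 0 ≤ s)
    (hs1 : s ≤ 1) : ∫⁻ m, ENNReal.ofReal (s ^ m) ∂(birthDeathKernel β t n) =
      ENNReal.ofReal ((1 + t * (1 - s)) ^ (-β) * (1 - (1 - s) / (1 + t * (1 - s))) ^ n) := by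
  have hu : 0 ≤ 1 - s := by linarith
  have hc : 0 < 1 + t * (1 - s) := by positivity
  have hk (k : ℕ) : ∫⁻ m, ENNReal.ofReal (s ^ m)
      ∂((poissonGateway ∘ₘ ((gammaLaw (k + β)).map (t * ·))).map (k + ·)) =
      ENNReal.ofReal (s ^ k * ((1 + t * (1 - s)) ^ (-β) * ((1 + t * (1 - s))⁻¹) ^ k)) := by
    rw [lintegral_map (by fun_prop) (by fun_prop)]
    simp only [pow_add, ENNReal.ofReal_mul (pow_nonneg hs k)]
    rw [lintegral_const_mul _ (by fun_prop), Measure.lintegral_bind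
      poissonGateway.measurable.aemeasurable (by fun_prop)]
    congr 1
    change ∫⁻ x, ∫⁻ m, ENNReal.ofReal (s ^ m) ∂(poissonMeasure x) ∂_ = _
    simp only [lintegral_pow_poissonMeasure _ hs]
    have := laplace_map_mul (gammaLaw (k + β)) t (1 - s)
    rw [laplace, laplace_gammaLaw (by positivity) (by nlinarith [t.coe_nonneg]),
      mul_comm (1 - s) (t : ℝ), rpow_neg_nat_add hc] at this
    simpa only [mul_comm] using this
  change ∫⁻ m, ENNReal.ofReal (s ^ m) ∂(∑ k ∈ Finset.range (n + 1), _) = _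
  rw [lintegral_finsetSum_measure]
  simp only [lintegral_smul_measure, hk, smul_eq_mul]
  calc _ = ∑ k ∈ Finset.range (n + 1), ENNReal.ofReal ((1 + t * (1 - s)) ^ (-β) *
        ((s * (1 / (1 + t)) * (1 + t * (1 - s))⁻¹) ^ k * (t / (1 + t : ℝ)) ^ (n - k)
          * n.choose k)) := by
        refine Finset.sum_congr rfl fun k _ => ?_
        rw [← ENNReal.ofReal_mul (by positivity)]
        congr 1
        rw [mul_pow, mul_pow]
        ring
    _ = _ := by
        rw [← ENNReal.ofReal_sum_of_nonneg (fun k _ => by positivity), ← Finset.mul_sum,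
          ← add_pow]
        congr 3
        have : (1 : ℝ) + t ≠ 0 := by positivity
        field_simp
        ring

theorem isMarkovKernel_birthDeathKernel {β : ℝ} (hβ : 0 ≤ β) (t : ℝ≥0) :
    IsMarkovKernel (birthDeathKernel β t) := by
  refine ⟨fun n => ⟨?_⟩⟩
  simpa using lintegral_pow_birthDeathKernel hβ t n zero_le_one le_rfl

end Transition

/-! ### The squared Bessel semigroup on exponentials -/

section BesselExponentials

theorem pow_mul_exp_neg_le {m : ℝ} (hm : 0 < m) (k : ℕ) {x : ℝ} (hx : 0 ≤ x) :
    x ^ k * Real.exp (-(m * x)) ≤ k ! / m ^ k := by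
  have h := Real.pow_div_factorial_le_exp (m * x) (by positivity) k
  rw [Real.exp_neg, ← div_eq_mul_inv, div_le_div_iff₀ (Real.exp_pos _) (by positivity)]
  rw [div_le_iff₀ (by positivity), mul_pow] at h
  linarith

theorem exists_quadratic_mul_exp_le {m : ℝ} (hm : 0 < m) (a b c : ℝ) :
    ∃ C, 0 ≤ C ∧ ∀ x, 0 ≤ x → (a * x ^ 2 + b * x + c) * Real.exp (-(m * x)) ≤ C := by
  refine ⟨|a| * (2 ! / m ^ 2) + |b| * (1 ! / m ^ 1) + |c| * (0 ! / m ^ 0), by positivity,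
    fun x hx => ?_⟩
  have h2 := pow_mul_exp_neg_le hm 2 hx
  have h1 := pow_mul_exp_neg_le hm 1 hx
  have h0 := pow_mul_exp_neg_le hm 0 hx
  have e := Real.exp_pos (-(m * x))
  calc (a * x ^ 2 + b * x + c) * Real.exp (-(m * x))
      = a * (x ^ 2 * Real.exp (-(m * x))) + b * (x ^ 1 * Real.exp (-(m * x)))
        + c * (x ^ 0 * Real.exp (-(m * x))) := by ring
    _ ≤ |a| * (x ^ 2 * Real.exp (-(m * x))) + |b| * (x ^ 1 * Real.exp (-(m * x)))
        + |c| * (x ^ 0 * Real.exp (-(m * x))) := by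
        gcongr <;> exact le_abs_self _
    _ ≤ _ := by gcongr

/-- The mean value inequality is applied to `F'` and then to `F r - r F'(0)`. The constant is not
the sharp `C / 2`; only the order `t²` matters. -/
theorem abs_sub_sub_mul_le {F F' F'' : ℝ → ℝ} {C : ℝ}
    (h1 : ∀ r ∈ Set.Icc (0 : ℝ) 1, HasDerivAt F (F' r) r)
    (h2 : ∀ r ∈ Set.Icc (0 : ℝ) 1, HasDerivAt F' (F'' r) r)
    (hC : ∀ r ∈ Set.Icc (0 : ℝ) 1, |F'' r| ≤ C) {t : ℝ} (ht : t ∈ Set.Icc (0 : ℝ) 1) :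
    |F t - F 0 - t * F' 0| ≤ C * t ^ 2 := by
  have key1 : ∀ r ∈ Set.Icc (0 : ℝ) t, |F' r - F' 0| ≤ C * t := by
    intro r hr
    have := (convex_Icc (0 : ℝ) 1).norm_image_sub_le_of_norm_hasDerivWithin_le (f := F')
      (f' := F'') (C := C) (fun x hx => (h2 x hx).hasDerivWithinAt) hC
      (x := 0) (y := r) (by simp) ⟨hr.1, hr.2.trans ht.2⟩
    rw [sub_zero, Real.norm_of_nonneg hr.1] at this
    refine this.trans ?_
    have hC0 : 0 ≤ C := (abs_nonneg _).trans (hC 0 (by simp))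
    gcongr
    exact hr.2
  have key2 := (convex_Icc (0 : ℝ) t).norm_image_sub_le_of_norm_hasDerivWithin_le
    (f := fun r => F r - r * F' 0) (f' := fun r => F' r - F' 0) (C := C * t) (fun x hx =>
      ((h1 x ⟨hx.1, hx.2.trans ht.2⟩).sub (((hasDerivAt_id x).mul_const (F' 0)).congr_deriv
        (one_mul _))).hasDerivWithinAt) key1 (x := 0) (y := t)
      ⟨le_rfl, ht.1⟩ ⟨ht.1, le_rfl⟩
  simp only [zero_mul, sub_zero, Real.norm_of_nonneg ht.1, Real.norm_eq_abs] at key2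
  rw [show F t - F 0 - t * F' 0 = F t - t * F' 0 - F 0 by ring]
  linarith

/-- A Taylor expansion of `Q_t e_l` in `t`, uniform in `x`. For `t ≤ 1` the decay rate `l/(1+lt)`
stays above `l/(1+l)`, and this exponential absorbs the quadratic growth in `x` of the second
derivative in `t`. It gives both strong continuity and the generator on exponentials. -/
theorem exists_bessel_exp_bound {β : ℝ} (hβ : 0 ≤ β) {l : ℝ} (hl : 0 < l) :
    ∃ C, 0 ≤ C ∧ ∀ t x : ℝ, 0 ≤ t → t ≤ 1 → 0 ≤ x →
      |(1 + l * t) ^ (-β) * Real.exp (-(l / (1 + l * t) * x)) - Real.exp (-(l * x))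
        - t * (l ^ 2 * (x * Real.exp (-(l * x))) - β * l * Real.exp (-(l * x)))| ≤ C * t ^ 2 := by
  -- These are the coefficients of `(2 x l³ + β l²) + (x l² + β l)²`, the bound below for `G' + G²`.
  obtain ⟨C, hC0, hC⟩ := exists_quadratic_mul_exp_le (m := l / (1 + l)) (by positivity)
    (l ^ 4) (2 * β * l ^ 3 + 2 * l ^ 3) (β ^ 2 * l ^ 2 + β * l ^ 2)
  refine ⟨C, hC0, fun t x ht ht1 hx => ?_⟩
  -- `G` is the logarithmic derivative of `F`, so `F' = G F` and `F'' = (G' + G²) F`.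
  let F : ℝ → ℝ := fun r => (1 + l * r) ^ (-β) * Real.exp (-(l / (1 + l * r) * x))
  let G : ℝ → ℝ := fun r => x * l ^ 2 / (1 + l * r) ^ 2 - β * l / (1 + l * r)
  let G' : ℝ → ℝ := fun r => -(2 * x * l ^ 3 / (1 + l * r) ^ 3) + β * l ^ 2 / (1 + l * r) ^ 2
  have hc (r : ℝ) (hr : r ∈ Set.Icc (0 : ℝ) 1) : 1 ≤ 1 + l * r := by
    have := mul_nonneg hl.le hr.1; linarith
  have hlin (r : ℝ) : HasDerivAt (fun r => 1 + l * r) l r := by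
    simpa using ((hasDerivAt_id r).const_mul l).const_add 1
  have hF (r : ℝ) (hr : r ∈ Set.Icc (0 : ℝ) 1) : HasDerivAt F (G r * F r) r := by
    have c0 : 0 < 1 + l * r := zero_lt_one.trans_le (hc r hr)
    have d1 := (hlin r).rpow_const (p := -β) (Or.inl c0.ne')
    have d2 := ((((hasDerivAt_const r l).div (hlin r) c0.ne').mul_const x).neg).exp
    refine (d1.mul d2).congr_deriv ?_
    simp only [F, G]
    rw [Real.rpow_sub_one c0.ne']
    field_simp
    simp
    ring_nf
  have hG (r : ℝ) (hr : r ∈ Set.Icc (0 : ℝ) 1) : HasDerivAt G (G' r) r := by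
    have c0 : 0 < 1 + l * r := zero_lt_one.trans_le (hc r hr)
    have d1 := (hasDerivAt_const r (x * l ^ 2)).div ((hlin r).pow 2) (pow_pos c0 2).ne'
    have d2 := (hasDerivAt_const r (β * l)).div (hlin r) c0.ne'
    refine (d1.sub d2).congr_deriv ?_
    simp only [G']
    simp
    field_simp
    ring
  have key := abs_sub_sub_mul_le (F := F) (F' := fun r => G r * F r)
    (F'' := fun r => G' r * F r + G r * (G r * F r)) (C := C) hF
    (fun r hr => (hG r hr).mul (hF r hr)) ?_ (t := t) ⟨ht, ht1⟩
  · refine le_trans (le_of_eq (congrArg abs ?_)) key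
    simp only [F, G, mul_zero, add_zero, div_one, one_pow, Real.one_rpow, one_mul]
    ring
  · intro r hr
    have h1 := hc r hr
    have c0 : 0 < 1 + l * r := zero_lt_one.trans_le h1
    have hFpos : 0 ≤ F r := by positivity
    have hFle : F r ≤ Real.exp (-(l / (1 + l) * x)) := by
      refine (mul_le_of_le_one_left (Real.exp_pos _).le
        (Real.rpow_le_one_of_one_le_of_nonpos h1 (by linarith))).trans ?_
      gcongr
      nlinarith [hr.2]
    have div_le (a : ℝ) (ha : 0 ≤ a) (k : ℕ) : a / (1 + l * r) ^ k ≤ a :=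
      div_le_self ha (one_le_pow₀ h1)
    have hGabs : |G r| ≤ x * l ^ 2 + β * l := by
      refine (abs_sub _ _).trans ?_
      rw [abs_of_nonneg (by positivity), abs_of_nonneg (by positivity)]
      have := div_le (x * l ^ 2) (by positivity) 2
      have := div_le (β * l) (by positivity) 1
      rw [pow_one] at this
      linarith
    have hG'abs : |G' r| ≤ 2 * x * l ^ 3 + β * l ^ 2 := by
      refine (abs_add_le _ _).trans ?_
      rw [abs_neg, abs_of_nonneg (by positivity), abs_of_nonneg (by positivity)]
      have := div_le (2 * x * l ^ 3) (by positivity) 3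
      have := div_le (β * l ^ 2) (by positivity) 2
      linarith
    calc |G' r * F r + G r * (G r * F r)| = |G' r + G r ^ 2| * F r := by
          rw [← abs_of_nonneg hFpos, ← abs_mul, abs_of_nonneg hFpos]
          congr 1
          ring
      _ ≤ ((2 * x * l ^ 3 + β * l ^ 2) + (x * l ^ 2 + β * l) ^ 2) *
          Real.exp (-(l / (1 + l) * x)) := by
          gcongr
          refine (abs_add_le _ _).trans ?_
          rw [abs_pow]
          gcongr
      _ ≤ C := by
          refine le_trans (le_of_eq ?_) (hC x hx)
          ring

/-- The function `x ↦ x * exp (-l * x)`. -/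
noncomputable def mulExpC0 (l : ℝ) (hl : 0 < l) : C₀(ℝ≥0, ℝ) where
  toFun x := x * Real.exp (-(l * x))
  continuous_toFun := by fun_prop
  zero_at_infty' := by
    obtain ⟨C, -, hC⟩ := exists_quadratic_mul_exp_le (m := l / 2) (by positivity) 0 1 0
    have h := (isCoordinate_nnreal.expC0 (l / 2) (by positivity)).zero_at_infty'.const_mul C
    rw [mul_zero] at h
    refine squeeze_zero (fun x => by positivity) (fun x => ?_) h
    change _ ≤ C * Real.exp (-(l / 2 * x))
    have := hC x x.2
    calc (x : ℝ) * Real.exp (-(l * x))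
        = (0 * (x : ℝ) ^ 2 + 1 * x + 0) * Real.exp (-(l / 2 * x)) * Real.exp (-(l / 2 * x)) := by
          rw [mul_assoc, ← Real.exp_add]
          ring_nf
      _ ≤ _ := by gcongr

/-- The image of `x ↦ exp (-l * x)` under the generator of the squared Bessel semigroup. -/
noncomputable def besselExpC0 (β l : ℝ) (hl : 0 < l) : C₀(ℝ≥0, ℝ) :=
  l ^ 2 • mulExpC0 l hl - (β * l) • isCoordinate_nnreal.expC0 l hl

theorem besselExpC0_apply (β l : ℝ) (hl : 0 < l) (x : ℝ≥0) : besselExpC0 β l hl x =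
    l ^ 2 * (x * Real.exp (-(l * x))) - β * l * Real.exp (-(l * x)) := rfl

theorem integral_expC0_besselKernel {β : ℝ} (hβ : 0 ≤ β) (t x : ℝ≥0) {l : ℝ} (hl : 0 < l) :
    ∫ y, isCoordinate_nnreal.expC0 l hl y ∂(besselKernel β t x) =
      (1 + l * t) ^ (-β) * Real.exp (-(l / (1 + l * t) * x)) := by
  rw [integral_exp_eq_toReal_laplace, laplace_besselKernel hβ t x hl.le,
    ENNReal.toReal_ofReal (by positivity)]

/-- The maps `l ↦ l/(1+lt)` compose additively in `t`, and the prefactors match because `(1 + l t)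
(1 + s l/(1+lt)) = 1 + l (s + t)`. -/
theorem isFellerSemigroup_besselKernel {β : ℝ} (hβ : 0 ≤ β) :
    IsFellerSemigroup (besselKernel β) := by
  refine isCoordinate_nnreal.isFellerSemigroup (isMarkovKernel_besselKernel hβ)
    (by simp [besselKernel]) ?_ ?_ ?_
  · intro s t x l hl
    have hl0 := hl.1.le
    rw [Kernel.comp_apply, laplace_comp isCoordinate_nnreal]
    simp only [laplace_besselKernel hβ _ _ hl0,
      ENNReal.ofReal_mul (by positivity : 0 ≤ (1 + l * (t : ℝ)) ^ (-β))]
    rw [lintegral_const_mul _ (by fun_prop)]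
    have := laplace_besselKernel hβ s x (l := l / (1 + l * t)) (by positivity)
    rw [laplace] at this
    rw [this, ← ENNReal.ofReal_mul (by positivity), ← mul_assoc,
      ← Real.mul_rpow (by positivity) (by positivity)]
    have : 1 + l * (t : ℝ) ≠ 0 := by positivity
    have : 1 + l * (t : ℝ) + l * s ≠ 0 := by positivity
    push_cast
    congr 4
    · field_simp
      ring
    · field_simp
      ring
  · intro t l hl
    refine ⟨(1 + l * t : ℝ) ^ (-β) • isCoordinate_nnreal.expC0 (l / (1 + l * t)) (by positivity),
      fun x => ?_⟩
    rw [integral_expC0_besselKernel hβ]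
    rfl
  · intro l hl
    obtain ⟨C, hC0, hC⟩ := exists_bessel_exp_bound hβ hl
    set K := ‖besselExpC0 β l hl‖ with hK
    have hlim : Tendsto (fun t : ℝ≥0 => C * (t : ℝ) ^ 2 + t * K) (𝓝 0) (𝓝 0) := by
      have : Continuous fun t : ℝ≥0 => C * (t : ℝ) ^ 2 + t * K := by fun_prop
      simpa using this.tendsto 0
    rw [Metric.tendstoUniformly_iff]
    intro ε hε
    have h1 : ∀ᶠ t : ℝ≥0 in 𝓝 0, t < 1 := Iio_mem_nhds one_pos
    filter_upwards [hlim.eventually_lt_const hε, h1] with t ht ht1 x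
    rw [integral_expC0_besselKernel hβ, dist_comm, Real.dist_eq]
    refine lt_of_le_of_lt ?_ ht
    have h2 := hC t x t.2 (by exact_mod_cast ht1.le) x.2
    rw [← besselExpC0_apply β l hl] at h2
    have h3 := C0_abs_le_norm (besselExpC0 β l hl) x
    have h4 : |(t : ℝ) * besselExpC0 β l hl x| ≤ t * K := by
      rw [abs_mul, abs_of_nonneg t.coe_nonneg]
      gcongr
    rw [isCoordinate_nnreal.expC0_apply]
    rw [abs_le] at h2 h4 ⊢
    constructor <;> linarith [h2.1, h2.2, h4.1, h4.2]

theorem op_besselKernel_expC0 {β : ℝ} (hβ : 0 ≤ β)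
    (t : ℝ≥0) {l : ℝ} (hl : 0 < l) :
    (isFellerSemigroup_besselKernel hβ).op t (isCoordinate_nnreal.expC0 l hl) =
      (1 + l * t : ℝ) ^ (-β) • isCoordinate_nnreal.expC0 (l / (1 + l * t)) (by positivity) := by
  ext x
  rw [IsFellerSemigroup.op_apply, integral_expC0_besselKernel hβ]
  rfl

theorem isGenerated_expC0_besselKernel {β : ℝ} (hβ : 0 ≤ β) {l : ℝ} (hl : 0 < l) :
    IsGenerated (isFellerSemigroup_besselKernel hβ).op (isCoordinate_nnreal.expC0 l hl)
      (besselExpC0 β l hl) := by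
  obtain ⟨C, hC0, hC⟩ := exists_bessel_exp_bound hβ hl
  rw [IsGenerated, tendsto_iff_norm_sub_tendsto_zero]
  have hlim : Tendsto (fun t : ℝ≥0 => C * (t : ℝ)) (𝓝[>] 0) (𝓝 0) := by
    have : Continuous fun t : ℝ≥0 => C * (t : ℝ) := by fun_prop
    simpa using (this.tendsto 0).mono_left nhdsWithin_le_nhds
  refine squeeze_zero' (Eventually.of_forall fun _ => norm_nonneg _) ?_ hlim
  have h1 : ∀ᶠ t : ℝ≥0 in 𝓝[>] 0, t < 1 := nhdsWithin_le_nhds (Iio_mem_nhds one_pos)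
  filter_upwards [h1, self_mem_nhdsWithin] with t ht1 (ht0 : 0 < t)
  have ht : (0 : ℝ) < t := ht0
  refine C0_norm_le (by positivity) fun x => ?_
  have h2 := hC t x t.2 (by exact_mod_cast ht1.le) x.2
  rw [← besselExpC0_apply β l hl] at h2
  rw [op_besselKernel_expC0 hβ]
  change |(t : ℝ)⁻¹ * ((1 + l * t : ℝ) ^ (-β) * Real.exp (-(l / (1 + l * t) * x)) -
    Real.exp (-(l * x))) - besselExpC0 β l hl x| ≤ _
  calc _ = (t : ℝ)⁻¹ * |(1 + l * t : ℝ) ^ (-β) * Real.exp (-(l / (1 + l * t) * x)) -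
        Real.exp (-(l * x)) - t * besselExpC0 β l hl x| := by
        rw [← abs_of_pos (inv_pos.2 ht), ← abs_mul, abs_of_pos (inv_pos.2 ht)]
        congr 1
        field_simp
    _ ≤ (t : ℝ)⁻¹ * (C * t ^ 2) := by gcongr
    _ = C * t := by field_simp

end BesselExponentials

/-! ### Approximation of test functions by combinations of exponentials -/

section Approximation

open Polynomial

theorem Polynomial.exists_antiderivative (p : ℝ[X]) :
    ∃ q : ℝ[X], derivative q = p ∧ q.eval 0 = 0 := by
  induction p using Polynomial.induction_on' with
  | add p r hp hr =>
    obtain ⟨q, hq, hq'⟩ := hp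
    obtain ⟨s, hs, hs'⟩ := hr
    exact ⟨q + s, by simp [hq, hs], by simp [hq', hs']⟩
  | monomial n a =>
    refine ⟨monomial (n + 1) (a / (n + 1)), ?_, by simp⟩
    rw [derivative_monomial]
    have : (n : ℝ) + 1 ≠ 0 := by positivity
    simp only [Nat.add_sub_cancel]
    congr 1
    push_cast
    field_simp

/-- The function `F` with `F (exp (-x)) = f x`, extended by zero to the nonpositive half-line. -/
noncomputable def compNegLog (f : ℝ → ℝ) (z : ℝ) : ℝ :=
  if 0 < z then f (-Real.log z) else 0

theorem compNegLog_exp (f : ℝ → ℝ) (x : ℝ) : compNegLog f (Real.exp (-x)) = f x := by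
  simp [compNegLog, Real.exp_pos]

theorem exists_compNegLog_eq_zero {f : ℝ → ℝ} (hc : HasCompactSupport f) :
    ∃ δ > 0, ∀ z < δ, compNegLog f z = 0 := by
  obtain ⟨R, hR⟩ := hc.isCompact.isBounded.subset_closedBall 0
  refine ⟨Real.exp (-R), Real.exp_pos _, fun z hz => ?_⟩
  rw [compNegLog]
  split_ifs with h
  · by_contra hne
    have h1 := hR (subset_tsupport f (Function.mem_support.2 hne))
    rw [mem_closedBall_zero_iff, Real.norm_eq_abs] at h1
    have h2 := (Real.lt_log_iff_exp_lt h).not.2 (not_lt.2 hz.le)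
    have h3 := (Real.log_lt_iff_lt_exp h).2 hz
    linarith [le_abs_self (-Real.log z)]
  · rfl

/-- Near `0` the argument `-log z` leaves the compact support of `f`, so the function vanishes
identically below some `δ > 0` and the gluing at `0` creates no singularity. -/
theorem contDiff_compNegLog {f : ℝ → ℝ} (hf : ContDiff ℝ ∞ f) (hc : HasCompactSupport f) :
    ContDiff ℝ ∞ (compNegLog f) := by
  rw [contDiff_iff_contDiffAt]
  intro z
  rcases le_or_gt z 0 with hz | hz
  · obtain ⟨δ, hδ, h⟩ := exists_compNegLog_eq_zero hc
    refine (contDiffAt_const (c := (0 : ℝ))).congr_of_eventuallyEq ?_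
    filter_upwards [Iio_mem_nhds (hz.trans_lt hδ)] with y hy
    exact h y hy
  · have : ContDiffAt ℝ ∞ (fun y => f (-Real.log y)) z :=
      hf.contDiffAt.comp z (Real.contDiffAt_log.2 hz.ne').neg
    refine this.congr_of_eventuallyEq ?_
    filter_upwards [Ioi_mem_nhds hz] with y (hy : 0 < y)
    rw [compNegLog, if_pos hy]

/-- A Weierstrass approximation of `F''` is integrated twice from `0`, where `F` and `F'` vanish.
The resulting polynomial has no constant term, so it becomes a combination of decaying exponentials
when `z = exp (-x)`. -/
theorem exists_polynomial_approx_C2 {F : ℝ → ℝ} (hF : ContDiff ℝ ∞ F) (h0 : F 0 = 0)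
    (h0' : deriv F 0 = 0) {ε : ℝ} (hε : 0 < ε) :
    ∃ q : ℝ[X], ∀ z ∈ Set.Icc (0 : ℝ) 1,
      |z * q.eval z - F z| ≤ ε * z ∧
      |(derivative (X * q)).eval z - deriv F z| ≤ ε ∧
      |(derivative (derivative (X * q))).eval z - deriv (deriv F) z| ≤ ε := by
  have hF1 : ContDiff ℝ ∞ (deriv F) := (contDiff_infty_iff_deriv.1 hF).2
  have hF2 : ContDiff ℝ ∞ (deriv (deriv F)) := (contDiff_infty_iff_deriv.1 hF1).2
  obtain ⟨p, hp⟩ := exists_polynomial_near_of_continuousOn 0 1 _ hF2.continuous.continuousOn ε hε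
  obtain ⟨q1, hq1, hq1'⟩ := p.exists_antiderivative
  obtain ⟨q0, hq0, hq0'⟩ := q1.exists_antiderivative
  have hX : X * q0.divX = q0 := by
    have := q0.X_mul_divX_add
    rwa [q0.coeff_zero_eq_eval_zero, hq0', C_0, add_zero] at this
  have b1 : ∀ z ∈ Set.Icc (0 : ℝ) 1, |q1.eval z - deriv F z| ≤ ε * z := by
    intro z hz
    have := (convex_Icc (0 : ℝ) 1).norm_image_sub_le_of_norm_hasDerivWithin_le
      (f := fun z => q1.eval z - deriv F z) (f' := fun z => p.eval z - deriv (deriv F) z)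
      (C := ε) (fun x _ => by
        have h1 := q1.hasDerivAt x
        rw [hq1] at h1
        exact (h1.sub (hF1.differentiable (by simp) x).hasDerivAt).hasDerivWithinAt)
      (fun x hx => (hp x hx).le) (x := 0) (y := z) (by simp) hz
    rwa [hq1', h0', sub_self, sub_zero, sub_zero, Real.norm_of_nonneg hz.1] at this
  have b1' : ∀ z ∈ Set.Icc (0 : ℝ) 1, |q1.eval z - deriv F z| ≤ ε := fun z hz =>
    (b1 z hz).trans (mul_le_of_le_one_right hε.le hz.2)
  have b0 : ∀ z ∈ Set.Icc (0 : ℝ) 1, |q0.eval z - F z| ≤ ε * z := by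
    intro z hz
    have := (convex_Icc (0 : ℝ) 1).norm_image_sub_le_of_norm_hasDerivWithin_le
      (f := fun z => q0.eval z - F z) (f' := fun z => q1.eval z - deriv F z)
      (C := ε) (fun x _ => by
        have h1 := q0.hasDerivAt x
        rw [hq0] at h1
        exact (h1.sub (hF.differentiable (by simp) x).hasDerivAt).hasDerivWithinAt)
      b1' (x := 0) (y := z) (by simp) hz
    rwa [hq0', h0, sub_self, sub_zero, sub_zero, Real.norm_of_nonneg hz.1] at this
  refine ⟨q0.divX, fun z hz => ?_⟩
  have e : z * q0.divX.eval z = q0.eval z := by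
    have := congrArg (eval z) hX
    rwa [eval_mul, eval_X] at this
  rw [hX, hq0, hq1, e]
  exact ⟨b0 z hz, b1' z hz, (hp z hz).le⟩

/-- Test functions are approximated by combinations of exponentials, together with their
derivatives. -/
theorem exists_polynomial_approx_testFunction {f : ℝ → ℝ} (hf : ContDiff ℝ ∞ f)
    (hc : HasCompactSupport f) {ε : ℝ} (hε : 0 < ε) :
    ∃ q : ℝ[X], ∀ x z : ℝ, 0 ≤ x → z = Real.exp (-x) →
      |z * q.eval z - f x| ≤ ε * z ∧
      |-(z * (derivative (X * q)).eval z) - deriv f x| ≤ ε * z ∧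
      |z * (derivative (X * q)).eval z + z ^ 2 * (derivative (derivative (X * q))).eval z -
        deriv (deriv f) x| ≤ ε * z := by
  set F := compNegLog f with hFdef
  have hF : ContDiff ℝ ∞ F := contDiff_compNegLog hf hc
  have hF1 : ContDiff ℝ ∞ (deriv F) := (contDiff_infty_iff_deriv.1 hF).2
  obtain ⟨δ, hδ, hzero⟩ := exists_compNegLog_eq_zero hc
  have hE : F =ᶠ[𝓝 0] fun _ => 0 := by
    filter_upwards [Iio_mem_nhds hδ] with y hy using hzero y hy
  have h0' : deriv F 0 = 0 := by rw [hE.deriv_eq, deriv_const]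
  -- With `z = exp (-x)` one has `f' = -z F'` and `f'' = z F' + z² F''`; the two terms of `f''`
  -- share `ε`. The factor `z` kept in the errors will compensate the unbounded coefficient `x` of
  -- the generator.
  obtain ⟨q, hq⟩ := exists_polynomial_approx_C2 hF (hzero 0 hδ) h0' (half_pos hε)
  refine ⟨q, fun x z hx hz => ?_⟩
  have hexp (x : ℝ) : HasDerivAt (fun x => Real.exp (-x)) (-Real.exp (-x)) x := by
    simpa using (hasDerivAt_neg x).exp
  have hfF : f = fun x => F (Real.exp (-x)) := funext fun x => (compNegLog_exp f x).symm
  have hd1 : deriv f = fun x => -(Real.exp (-x) * deriv F (Real.exp (-x))) := by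
    funext x
    have h := ((hF.differentiable (by simp) (Real.exp (-x))).hasDerivAt).comp x (hexp x)
    have h' : HasDerivAt f (deriv F (Real.exp (-x)) * -Real.exp (-x)) x := by
      rw [hfF]; exact h
    rw [h'.deriv]
    ring
  have hd2 : deriv (deriv f) x = z * deriv F z + z ^ 2 * deriv (deriv F) z := by
    have h := ((hF1.differentiable (by simp) (Real.exp (-x))).hasDerivAt).comp x (hexp x)
    rw [hd1]
    refine (((hexp x).mul h).neg.deriv).trans ?_
    rw [hz]
    simp only [Function.comp]
    ring
  have hzpos : 0 < z := hz ▸ Real.exp_pos _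
  have hz1 : z ≤ 1 := hz ▸ Real.exp_le_one_iff.2 (by linarith)
  obtain ⟨h1, h2, h3⟩ := hq z ⟨hzpos.le, hz1⟩
  have hzz : z ^ 2 ≤ z := by nlinarith
  refine ⟨?_, ?_, ?_⟩
  · rw [show f x = F z by rw [hz, hFdef, compNegLog_exp]]
    nlinarith
  · rw [show deriv f x = -(z * deriv F z) by rw [hd1, hz],
      show ∀ a b : ℝ, -(z * a) - -(z * b) = -z * (a - b) by intros; ring, abs_mul, abs_neg,
      abs_of_pos hzpos]
    nlinarith [abs_nonneg ((derivative (X * q)).eval z - deriv F z)]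
  · rw [hd2, show ∀ a b c d : ℝ, z * a + z ^ 2 * b - (z * c + z ^ 2 * d) =
      z * (a - c) + z ^ 2 * (b - d) by intros; ring]
    refine (abs_add_le _ _).trans ?_
    rw [abs_mul, abs_mul, abs_of_pos hzpos, abs_of_pos (pow_pos hzpos 2)]
    calc _ ≤ z * (ε / 2) + z * (ε / 2) := by gcongr
      _ = ε * z := by ring

end Approximation

/-! ### Existence and uniqueness of the squared Bessel semigroup -/

section SquaredBessel

open Polynomial

/-- By linearity from the exponentials with integer rates. The formula for `g` is `x ∂² + β ∂`
applied to `p(exp (-x))`, with `p = X q` and `∂ = -z d/dz`. -/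
theorem exists_isGenerated_polynomial {T : ℝ≥0 → C₀(ℝ≥0, ℝ) →L[ℝ] C₀(ℝ≥0, ℝ)} {β : ℝ}
    (hT : ∀ (l : ℝ) (hl : 0 < l),
      IsGenerated T (isCoordinate_nnreal.expC0 l hl) (besselExpC0 β l hl)) (q : ℝ[X]) :
    ∃ h g : C₀(ℝ≥0, ℝ), IsGenerated T h g ∧ ∀ (x : ℝ≥0) (z : ℝ), z = Real.exp (-x) →
      h x = z * q.eval z ∧
      g x = x * (z * (derivative (X * q)).eval z +
        z ^ 2 * (derivative (derivative (X * q))).eval z) +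
        β * -(z * (derivative (X * q)).eval z) := by
  induction q using Polynomial.induction_on' with
  | add p r hp hr =>
    obtain ⟨h, g, hg, H⟩ := hp
    obtain ⟨h', g', hg', H'⟩ := hr
    refine ⟨h + h', g + g', hg.add hg', fun x z hz => ⟨?_, ?_⟩⟩
    · simp [(H x z hz).1, (H' x z hz).1, mul_add]
    · simp only [ZeroAtInftyContinuousMap.add_apply, (H x z hz).2, (H' x z hz).2, mul_add,
        derivative_add, eval_add]
      ring
  | monomial n a =>
    have hn : (0 : ℝ) < n + 1 := by positivity
    refine ⟨a • isCoordinate_nnreal.expC0 (n + 1) hn, a • besselExpC0 β (n + 1) hn,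
      (hT _ hn).smul a, fun x z hz => ?_⟩
    have e : Real.exp (-((n + 1 : ℝ) * x)) = z ^ (n + 1) := by
      rw [hz, ← Real.exp_nat_mul]
      push_cast
      ring_nf
    rw [X_mul_monomial]
    simp only [ZeroAtInftyContinuousMap.smul_apply, IsCoordinate.expC0_apply, besselExpC0_apply, e,
      smul_eq_mul, eval_monomial, derivative_monomial]
    constructor
    · ring
    · rcases n with _ | n
      · simp
        ring
      · simp
        ring

theorem continuous_testFunction_gen {f : ℝ → ℝ} (hf : ContDiff ℝ ∞ f) (β : ℝ) :
    Continuous fun x => x * deriv (deriv f) x + β * deriv f x := by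
  have hf1 : ContDiff ℝ ∞ (deriv f) := (contDiff_infty_iff_deriv.1 hf).2
  have hf2 : ContDiff ℝ ∞ (deriv (deriv f)) := (contDiff_infty_iff_deriv.1 hf1).2
  have := hf1.continuous
  have := hf2.continuous
  fun_prop

/-- The restriction to the half-line of a compactly supported continuous function. -/
noncomputable def restrictC0 (f : ℝ → ℝ) (hf : Continuous f) (hc : HasCompactSupport f) :
    C₀(ℝ≥0, ℝ) where
  toFun x := f x
  continuous_toFun := by fun_prop
  zero_at_infty' :=
    hc.is_zero_at_infty.comp isCoordinate_nnreal.isClosedEmbedding.tendsto_cocompact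

theorem hasCompactSupport_testFunction_gen {f : ℝ → ℝ} (hc : HasCompactSupport f) (β : ℝ) :
    HasCompactSupport fun x => x * deriv (deriv f) x + β * deriv f x := by
  have h1 : HasCompactSupport (deriv f) := hc.deriv
  exact (h1.deriv.mul_left (f := fun x => x)).add (h1.mul_left (f := fun _ => β))

/-- The restriction to the half-line of a test function. -/
noncomputable def testC0 (f : ℝ → ℝ) (hf : ContDiff ℝ ∞ f) (hc : HasCompactSupport f) :
    C₀(ℝ≥0, ℝ) :=
  restrictC0 f hf.continuous hc

/-- The image of a test function under the generator of the squared Bessel semigroup. -/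
noncomputable def testGenC0 (β : ℝ) (f : ℝ → ℝ) (hf : ContDiff ℝ ∞ f) (hc : HasCompactSupport f) :
    C₀(ℝ≥0, ℝ) :=
  restrictC0 _ (continuous_testFunction_gen hf β) (hasCompactSupport_testFunction_gen hc β)

theorem isGenerated_testC0_of_expC0 {T : ℝ≥0 → C₀(ℝ≥0, ℝ) →L[ℝ] C₀(ℝ≥0, ℝ)} {β : ℝ} (hβ : 0 ≤ β)
    (hT : IsContractionSemigroup T)
    (hgen : ∀ (l : ℝ) (hl : 0 < l),
      IsGenerated T (isCoordinate_nnreal.expC0 l hl) (besselExpC0 β l hl))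
    {f : ℝ → ℝ} (hf : ContDiff ℝ ∞ f) (hc : HasCompactSupport f) :
    IsGenerated T (testC0 f hf hc) (testGenC0 β f hf hc) := by
  refine hT.isGenerated_of_approx fun ε hε => ?_
  -- The generator error is at most the chosen tolerance times `x z + β z ≤ 1 + β`.
  obtain ⟨q, hq⟩ := exists_polynomial_approx_testFunction hf hc (ε := ε / (1 + β)) (by positivity)
  obtain ⟨h, g, hg, H⟩ := exists_isGenerated_polynomial hgen q
  have hη : ε / (1 + β) ≤ ε := div_le_self hε.le (by linarith)
  refine ⟨h, g, hg, C0_norm_le hε.le fun x => ?_, C0_norm_le hε.le fun x => ?_⟩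
  · obtain ⟨h1, -, -⟩ := hq x _ x.2 rfl
    have e1 : Real.exp (-(x : ℝ)) ≤ 1 := Real.exp_le_one_iff.2 (by simp)
    change |h x - f x| ≤ ε
    rw [(H x _ rfl).1]
    exact h1.trans ((mul_le_of_le_one_right (by positivity) e1).trans hη)
  · obtain ⟨-, h2, h3⟩ := hq x _ x.2 rfl
    have e1 : Real.exp (-(x : ℝ)) ≤ 1 := Real.exp_le_one_iff.2 (by simp)
    have e2 : (x : ℝ) * Real.exp (-(x : ℝ)) ≤ 1 := by
      simpa using pow_mul_exp_neg_le one_pos 1 x.coe_nonneg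
    change |g x - (x * deriv (deriv f) x + β * deriv f x)| ≤ ε
    rw [(H x _ rfl).2]
    rw [show ∀ a b c d : ℝ, (x : ℝ) * a + β * b - (x * c + β * d) = x * (a - c) + β * (b - d) by
      intros; ring]
    refine (abs_add_le _ _).trans ?_
    rw [abs_mul, abs_mul, abs_of_nonneg x.coe_nonneg, abs_of_nonneg hβ]
    calc _ ≤ x * (ε / (1 + β) * Real.exp (-(x : ℝ))) +
          β * (ε / (1 + β) * Real.exp (-(x : ℝ))) := by gcongr
      _ = (ε / (1 + β)) * (x * Real.exp (-(x : ℝ)) + β * Real.exp (-(x : ℝ))) := by ring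
      _ ≤ (ε / (1 + β)) * (1 + β * 1) := by gcongr
      _ = ε := by field_simp

theorem isSquaredBesselSemigroup_besselKernel {β : ℝ} (hβ : 0 ≤ β) :
    IsSquaredBesselSemigroup β (besselKernel β) where
  feller := isFellerSemigroup_besselKernel hβ
  generator f hf hc :=
    ((isFellerSemigroup_besselKernel hβ).inGenerator_iff (testC0 f hf hc) (testGenC0 β f hf hc)).2
      (isGenerated_testC0_of_expC0 hβ (isFellerSemigroup_besselKernel hβ).isContractionSemigroup
        (fun _ hl => isGenerated_expC0_besselKernel hβ hl) hf hc)

theorem exists_smooth_cutoff : ∃ χ : ℝ → ℝ, ContDiff ℝ ∞ χ ∧ HasCompactSupport χ ∧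
    (∀ x, 0 ≤ χ x) ∧ (∀ x, χ x ≤ 1) ∧ ∀ x, |x| ≤ 1 → χ x = 1 := by
  let χ : ContDiffBump (0 : ℝ) := ⟨1, 2, one_pos, one_lt_two⟩
  refine ⟨χ, χ.contDiff, χ.hasCompactSupport, fun x => χ.nonneg, fun x => χ.le_one, fun x hx => ?_⟩
  exact χ.one_of_mem_closedBall (mem_closedBall_zero_iff.2 hx)

/-- The exponential is cut off by `χ (x / R)`. The errors in the function and in its image under `x
∂² + β ∂` are `O(1/R)` uniformly in `x`, as the exponential absorbs the polynomial factors;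
closedness concludes. -/
theorem isGenerated_expC0_of_testC0 {T : ℝ≥0 → C₀(ℝ≥0, ℝ) →L[ℝ] C₀(ℝ≥0, ℝ)} {β : ℝ} (hβ : 0 ≤ β)
    (hT : IsContractionSemigroup T)
    (hgen : ∀ (f : ℝ → ℝ) (hf : ContDiff ℝ ∞ f) (hc : HasCompactSupport f),
      IsGenerated T (testC0 f hf hc) (testGenC0 β f hf hc)) {l : ℝ} (hl : 0 < l) :
    IsGenerated T (isCoordinate_nnreal.expC0 l hl) (besselExpC0 β l hl) := by
  obtain ⟨χ, χs, χc, χ0, χ1, χone⟩ := exists_smooth_cutoff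
  have χs1 : ContDiff ℝ ∞ (deriv χ) := (contDiff_infty_iff_deriv.1 χs).2
  have χs2 : ContDiff ℝ ∞ (deriv (deriv χ)) := (contDiff_infty_iff_deriv.1 χs1).2
  obtain ⟨C1, hC1⟩ := χc.deriv.exists_bound_of_continuous χs1.continuous
  obtain ⟨C2, hC2⟩ := χc.deriv.deriv.exists_bound_of_continuous χs2.continuous
  have hC10 : 0 ≤ C1 := (norm_nonneg _).trans (hC1 0)
  have hC20 : 0 ≤ C2 := (norm_nonneg _).trans (hC2 0)
  -- One quadratic dominates both errors: the summand `1` in the coefficient of `x` serves the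
  -- function itself, the other terms its image.
  obtain ⟨K, hK0, hK⟩ := exists_quadratic_mul_exp_le hl (l ^ 2) (1 + 2 * l * C1 + C2 + β * l)
    (β * C1)
  refine hT.isGenerated_of_approx fun ε hε => ?_
  -- `R ≥ 1` allows `1 / R²` to be replaced by `1 / R` in the term with `χ''`.
  obtain ⟨R, hR1, hR⟩ : ∃ R : ℝ, 1 ≤ R ∧ K / R ≤ ε := by
    refine ⟨max 1 (K / ε), le_max_left _ _, ?_⟩
    rw [div_le_comm₀ (by positivity) hε]
    exact le_max_right _ _
  have hR0 : 0 < R := zero_lt_one.trans_le hR1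
  let f : ℝ → ℝ := fun x => Real.exp (-(l * x)) * χ (x / R)
  have hf : ContDiff ℝ ∞ f := by
    have : ContDiff ℝ ∞ fun x : ℝ => χ (x / R) := χs.comp (contDiff_id.div_const R)
    exact ((contDiff_const.mul contDiff_id).neg.exp).mul this
  have hc : HasCompactSupport f := by
    have : HasCompactSupport fun x : ℝ => χ (x / R) :=
      χc.comp_isClosedEmbedding (Homeomorph.mulRight₀ R⁻¹ (inv_pos.2 hR0).ne').isClosedEmbedding
    exact HasCompactSupport.mul_left this
  have hdiv (x : ℝ) : HasDerivAt (fun x => x / R) (1 / R) x := (hasDerivAt_id x).div_const R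
  have hexp (x : ℝ) : HasDerivAt (fun x => Real.exp (-(l * x))) (-l * Real.exp (-(l * x))) x := by
    have := ((hasDerivAt_id x).const_mul l).neg.exp
    refine this.congr_deriv ?_
    simp
    ring
  have d1 : deriv f = fun x => Real.exp (-(l * x)) * (-l * χ (x / R) + deriv χ (x / R) / R) := by
    funext x
    have h1 := ((χs.differentiable (by simp) (x / R)).hasDerivAt).comp x (hdiv x)
    refine ((hexp x).mul h1).deriv.trans ?_
    simp only [Function.comp]
    ring
  have d2 (x : ℝ) : deriv (deriv f) x = Real.exp (-(l * x)) *
      (l ^ 2 * χ (x / R) - 2 * l * (deriv χ (x / R) / R) + deriv (deriv χ) (x / R) / R ^ 2) := by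
    have h1 := ((χs.differentiable (by simp) (x / R)).hasDerivAt).comp x (hdiv x)
    have h2 := ((χs1.differentiable (by simp) (x / R)).hasDerivAt).comp x (hdiv x)
    rw [d1]
    refine ((hexp x).mul ((h1.const_mul (-l)).add (h2.div_const R))).deriv.trans ?_
    simp only [Function.comp, Pi.add_apply]
    field_simp
    ring
  have hχ (x : ℝ) (hx : 0 ≤ x) : |χ (x / R) - 1| ≤ x / R := by
    rcases le_or_gt (x / R) 1 with h | h
    · rw [χone _ (by rwa [abs_of_nonneg (by positivity)]), sub_self, abs_zero]
      positivity
    · rw [abs_le]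
      constructor <;> linarith [χ0 (x / R), χ1 (x / R)]
  have hquad (x : ℝ) (hx : 0 ≤ x) (u : ℝ) (hu : u ≤ (l ^ 2 * x ^ 2 +
      (1 + 2 * l * C1 + C2 + β * l) * x + β * C1) * Real.exp (-(l * x)) / R) : u ≤ ε :=
    hu.trans (le_trans (by gcongr; exact hK x hx) hR)
  refine ⟨testC0 f hf hc, testGenC0 β f hf hc, hgen f hf hc, C0_norm_le hε.le fun x => ?_,
    C0_norm_le hε.le fun x => ?_⟩
  · refine hquad x x.2 _ ?_
    change |Real.exp (-(l * x)) * χ (x / R) - Real.exp (-(l * x))| ≤ _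
    rw [← mul_sub_one, abs_mul, abs_of_pos (Real.exp_pos _)]
    calc _ ≤ Real.exp (-(l * x)) * (x / R) := by
          gcongr
          exact hχ x x.2
      _ = (1 * x) * Real.exp (-(l * x)) / R := by ring
      _ ≤ _ := by
          gcongr
          have hx := x.coe_nonneg
          have : 0 ≤ l ^ 2 * (x : ℝ) ^ 2 + (2 * l * C1 + C2 + β * l) * x + β * C1 := by positivity
          linarith
  · refine hquad x x.2 _ ?_
    have hx := x.coe_nonneg
    change |(x * deriv (deriv f) x + β * deriv f x) - besselExpC0 β l hl x| ≤ _
    rw [d2, d1, besselExpC0_apply]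
    calc _ = |x * (l ^ 2 * (χ (x / R) - 1) - 2 * l * (deriv χ (x / R) / R) +
          deriv (deriv χ) (x / R) / R ^ 2) + β * (-l * (χ (x / R) - 1) + deriv χ (x / R) / R)| *
          Real.exp (-(l * x)) := by
          rw [← abs_of_pos (Real.exp_pos (-(l * x))), ← abs_mul, abs_of_pos (Real.exp_pos _)]
          congr 1
          ring
      _ ≤ (x * (l ^ 2 * (x / R) + 2 * l * (C1 / R) + C2 / R) + β * (l * (x / R) + C1 / R)) *
          Real.exp (-(l * x)) := by
          gcongr
          have a1 : |l ^ 2 * (χ (x / R) - 1)| ≤ l ^ 2 * (x / R) := by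
            rw [abs_mul, abs_of_nonneg (by positivity)]
            gcongr
            exact hχ x hx
          have a2 : |2 * l * (deriv χ (x / R) / R)| ≤ 2 * l * (C1 / R) := by
            rw [abs_mul, abs_of_nonneg (by positivity), abs_div, abs_of_pos hR0]
            gcongr
            exact hC1 _
          have a3 : |deriv (deriv χ) (x / R) / R ^ 2| ≤ C2 / R := by
            rw [abs_div, abs_of_pos (pow_pos hR0 2)]
            refine div_le_div₀ hC20 (hC2 _) hR0 (by nlinarith)
          have a4 : |-l * (χ (x / R) - 1)| ≤ l * (x / R) := by
            rw [abs_mul, abs_neg, abs_of_pos hl]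
            gcongr
            exact hχ x hx
          have a5 : |deriv χ (x / R) / R| ≤ C1 / R := by
            rw [abs_div, abs_of_pos hR0]
            gcongr
            exact hC1 _
          refine (abs_add_le _ _).trans ?_
          rw [abs_mul, abs_mul, abs_of_nonneg hx, abs_of_nonneg hβ]
          gcongr
          · refine (abs_add_le _ _).trans (add_le_add ((abs_sub _ _).trans ?_) a3)
            exact add_le_add a1 a2
          · exact (abs_add_le _ _).trans (add_le_add a4 a5)
      _ = (l ^ 2 * x ^ 2 + (2 * l * C1 + C2 + β * l) * x + β * C1) * Real.exp (-(l * x)) / R := by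
          ring
      _ ≤ _ := by
          gcongr
          linarith

/-- The orbit of an exponential under the explicit semigroup consists of multiples of exponentials,
where the generator of `Q` is known from its values on test functions. -/
theorem IsSquaredBesselSemigroup.eq_besselKernel {β : ℝ} (hβ : 0 ≤ β)
    {Q : ℝ≥0 → Kernel ℝ≥0 ℝ≥0} (hQ : IsSquaredBesselSemigroup β Q) : Q = besselKernel β := by
  have hgen (l : ℝ) (hl : 0 < l) :
      IsGenerated hQ.feller.op (isCoordinate_nnreal.expC0 l hl) (besselExpC0 β l hl) :=
    isGenerated_expC0_of_testC0 hβ hQ.feller.isContractionSemigroup (fun f hf hc =>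
      (hQ.feller.inGenerator_iff (testC0 f hf hc) (testGenC0 β f hf hc)).1
        (hQ.generator f hf hc)) hl
  refine isCoordinate_nnreal.fellerSemigroup_eq (isFellerSemigroup_besselKernel hβ) hQ.feller ?_
  intro l hl s
  rw [op_besselKernel_expC0 hβ]
  exact ⟨_, (isGenerated_expC0_besselKernel hβ _).smul _, (hgen _ _).smul _⟩

end SquaredBessel

/-! ### The gateway operators and the kernel intertwinings -/

section Intertwining

/-- The geometric sequence `n ↦ s ^ n`. -/
noncomputable def powC0 (s : ℝ) (hs : 0 < s) (hs1 : s < 1) : C₀(ℕ, ℝ) :=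
  isCoordinate_nat.expC0 (-Real.log s) (neg_pos.2 (Real.log_neg hs hs1))

theorem powC0_apply (s : ℝ) (hs : 0 < s) (hs1 : s < 1) (n : ℕ) : powC0 s hs hs1 n = s ^ n := by
  rw [powC0, isCoordinate_nat.expC0_apply, neg_mul, neg_neg, mul_comm, Real.exp_nat_mul,
    Real.exp_log hs]

theorem expC0_nat_apply {l : ℝ} (hl : 0 < l) (n : ℕ) :
    isCoordinate_nat.expC0 l hl n = Real.exp (-l) ^ n := by
  rw [isCoordinate_nat.expC0_apply, ← Real.exp_nat_mul]
  ring_nf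

theorem exp_neg_lt_one {l : ℝ} (hl : 0 < l) : Real.exp (-l) < 1 :=
  Real.exp_lt_one_iff.2 (by linarith)

theorem expC0_nat_eq_powC0 {l : ℝ} (hl : 0 < l) :
    isCoordinate_nat.expC0 l hl = powC0 (Real.exp (-l)) (Real.exp_pos _) (exp_neg_lt_one hl) := by
  ext n
  rw [expC0_nat_apply, powC0_apply]

theorem preservesC0_poissonGateway : PreservesC0 poissonGateway := by
  have := isMarkovKernel_poissonGateway
  refine isCoordinate_nat.preservesC0 _ fun l hl =>
    ⟨isCoordinate_nnreal.expC0 (1 - Real.exp (-l)) (sub_pos.2 (exp_neg_lt_one hl)), fun x => ?_⟩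
  rw [integral_exp_eq_toReal_laplace, laplace_nat]
  change _ = (∫⁻ n, _ ∂(poissonMeasure x)).toReal
  rw [lintegral_pow_poissonMeasure x (Real.exp_pos _).le, ENNReal.toReal_ofReal (Real.exp_pos _).le,
    isCoordinate_nnreal.expC0_apply, mul_comm]

theorem inv_one_add_lt_one {l : ℝ} (hl : 0 < l) : (1 + l)⁻¹ < 1 :=
  inv_lt_one_of_one_lt₀ (by linarith)

theorem integral_expC0_gammaGateway {β : ℝ} (hβ : 0 ≤ β) {l : ℝ} (hl : 0 < l) (n : ℕ) :
    ∫ y, isCoordinate_nnreal.expC0 l hl y ∂(gammaGateway β n) =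
      (1 + l) ^ (-β) * ((1 + l)⁻¹) ^ n := by
  rw [integral_exp_eq_toReal_laplace, laplace_gammaGateway hβ _ (by linarith),
    ENNReal.toReal_ofReal (by positivity)]

theorem preservesC0_gammaGateway {β : ℝ} (hβ : 0 ≤ β) : PreservesC0 (gammaGateway β) := by
  have := isMarkovKernel_gammaGateway hβ
  refine isCoordinate_nnreal.preservesC0 _ fun l hl =>
    ⟨(1 + l) ^ (-β) • powC0 (1 + l)⁻¹ (by positivity) (inv_one_add_lt_one hl), fun n => ?_⟩
  rw [integral_expC0_gammaGateway hβ, ZeroAtInftyContinuousMap.smul_apply, powC0_apply, smul_eq_mul]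

/-- The gamma gateway as an operator on functions vanishing at infinity. -/
noncomputable def gammaOp {β : ℝ} (hβ : 0 ≤ β) : C₀(ℝ≥0, ℝ) →L[ℝ] C₀(ℕ, ℝ) :=
  haveI := isMarkovKernel_gammaGateway hβ
  (preservesC0_gammaGateway hβ).toCLM

theorem gammaOp_apply {β : ℝ} (hβ : 0 ≤ β) (f : C₀(ℝ≥0, ℝ)) (n : ℕ) :
    gammaOp hβ f n = ∫ y, f y ∂(gammaGateway β n) :=
  haveI := isMarkovKernel_gammaGateway hβ
  (preservesC0_gammaGateway hβ).toCLM_apply f n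

theorem gammaOp_expC0 {β : ℝ} (hβ : 0 ≤ β) {l : ℝ} (hl : 0 < l) :
    gammaOp hβ (isCoordinate_nnreal.expC0 l hl) =
      (1 + l) ^ (-β) • powC0 (1 + l)⁻¹ (by positivity) (inv_one_add_lt_one hl) := by
  ext n
  rw [gammaOp_apply, integral_expC0_gammaGateway hβ, ZeroAtInftyContinuousMap.smul_apply,
    powC0_apply, smul_eq_mul]

/-- The Poisson gateway as an operator on functions vanishing at infinity. -/
noncomputable def poissonOp : C₀(ℕ, ℝ) →L[ℝ] C₀(ℝ≥0, ℝ) :=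
  haveI := isMarkovKernel_poissonGateway
  preservesC0_poissonGateway.toCLM

theorem poissonOp_apply (f : C₀(ℕ, ℝ)) (x : ℝ≥0) :
    poissonOp f x = ∫ n, f n ∂(poissonGateway x) :=
  haveI := isMarkovKernel_poissonGateway
  preservesC0_poissonGateway.toCLM_apply f x

theorem laplace_birthDeathKernel {β : ℝ} (hβ : 0 ≤ β) (t : ℝ≥0) (n : ℕ) {l : ℝ} (hl : 0 ≤ l) :
    laplace (fun n : ℕ => (n : ℝ)) (birthDeathKernel β t n) l =
      ENNReal.ofReal ((1 + t * (1 - Real.exp (-l))) ^ (-β) *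
        (1 - (1 - Real.exp (-l)) / (1 + t * (1 - Real.exp (-l)))) ^ n) := by
  rw [laplace_nat, lintegral_pow_birthDeathKernel hβ t n (Real.exp_pos _).le
    (Real.exp_le_one_iff.2 (by linarith))]

theorem div_one_add_mul_lt_one {u t : ℝ} (hu0 : 0 ≤ u) (hu : u < 1) (ht : 0 ≤ t) :
    u / (1 + t * u) < 1 := by
  have : 0 < 1 + t * u := by positivity
  rw [div_lt_one this]
  nlinarith [mul_nonneg ht hu0]

/-- `Λ* Q_t = D_t Λ*`. -/
theorem besselKernel_comp_gammaGateway {β : ℝ} (hβ : 0 ≤ β) (t : ℝ≥0) :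
    besselKernel β t ∘ₖ gammaGateway β = gammaGateway β ∘ₖ birthDeathKernel β t := by
  have := isMarkovKernel_gammaGateway hβ
  have := isMarkovKernel_besselKernel hβ t
  -- Kernels compose in the order opposite to their operators. Both prefactors reduce to `(1 + l + l
  -- t)^(-β)`.
  refine isCoordinate_nnreal.kernel_ext fun n l hl => ?_
  have hl0 := hl.1.le
  have ht := t.coe_nonneg
  have h1 : 1 + l ≠ 0 := by positivity
  have h2 : 1 + l * (t : ℝ) ≠ 0 := by positivity
  rw [Kernel.comp_apply, Kernel.comp_apply, laplace_comp isCoordinate_nnreal,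
    laplace_comp isCoordinate_nnreal]
  simp only [laplace_besselKernel hβ _ _ hl0, laplace_gammaGateway hβ _ (by linarith : -1 < l),
    ENNReal.ofReal_mul (by positivity : 0 ≤ (1 + l * (t : ℝ)) ^ (-β)),
    ENNReal.ofReal_mul (by positivity : 0 ≤ (1 + l) ^ (-β))]
  have hpos : 0 ≤ l / (1 + l * (t : ℝ)) := by positivity
  have h := laplace_gammaGateway hβ n (l := l / (1 + l * t)) (by linarith)
  rw [laplace] at h
  have hs : (1 + l)⁻¹ ≤ 1 := (inv_one_add_lt_one hl.1).le
  rw [lintegral_const_mul _ (by fun_prop), h, lintegral_const_mul _ (by fun_prop),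
    lintegral_pow_birthDeathKernel hβ t n (by positivity) hs, ← ENNReal.ofReal_mul (by positivity),
    ← ENNReal.ofReal_mul (by positivity), ← mul_assoc, ← mul_assoc,
    ← Real.mul_rpow (by positivity) (by positivity),
    ← Real.mul_rpow (by positivity) (by have := sub_nonneg.2 hs; positivity)]
  have h3 : 1 + l * (t : ℝ) + l ≠ 0 := by positivity
  have h4 : 1 + (t : ℝ) * (1 - (1 + l)⁻¹) = (1 + l * t + l) / (1 + l) := by
    field_simp
    ring
  rw [h4]
  congr 3
  · field_simp
  · field_simp
    ring

/-- `Q_t Λ = Λ D_t`. -/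
theorem birthDeathKernel_comp_poissonGateway {β : ℝ} (hβ : 0 ≤ β) (t : ℝ≥0) :
    birthDeathKernel β t ∘ₖ poissonGateway = poissonGateway ∘ₖ besselKernel β t := by
  have := isMarkovKernel_poissonGateway
  have := isMarkovKernel_birthDeathKernel hβ t
  refine isCoordinate_nat.kernel_ext fun x l hl => ?_
  have ht := t.coe_nonneg
  have hu : 0 ≤ 1 - Real.exp (-l) := sub_nonneg.2 (exp_neg_lt_one hl.1).le
  have hu1 : 1 - Real.exp (-l) < 1 := by linarith [Real.exp_pos (-l)]
  rw [Kernel.comp_apply, Kernel.comp_apply, laplace_comp isCoordinate_nat,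
    laplace_comp isCoordinate_nat]
  simp only [laplace_birthDeathKernel hβ _ _ hl.1.le,
    ENNReal.ofReal_mul (by positivity : 0 ≤ (1 + t * (1 - Real.exp (-l))) ^ (-β))]
  rw [lintegral_const_mul _ (by fun_prop)]
  change _ * ∫⁻ n, _ ∂(poissonMeasure x) = ∫⁻ y, laplace _ (poissonMeasure y) l ∂_
  simp only [laplace_nat, lintegral_pow_poissonMeasure _ (Real.exp_pos _).le]
  rw [lintegral_pow_poissonMeasure _
    (sub_nonneg.2 (div_one_add_mul_lt_one hu hu1 ht).le)]
  have h := laplace_besselKernel hβ t x hu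
  rw [laplace] at h
  simp only [mul_comm _ (1 - Real.exp (-l))]
  rw [h, ← ENNReal.ofReal_mul (by positivity)]
  congr 4
  ring

/-- `Λ Λ* = Q_1`. -/
theorem gammaGateway_comp_poissonGateway {β : ℝ} (hβ : 0 ≤ β) :
    gammaGateway β ∘ₖ poissonGateway = besselKernel β 1 := by
  have := isMarkovKernel_poissonGateway
  have := isMarkovKernel_gammaGateway hβ
  refine isCoordinate_nnreal.kernel_ext fun x l hl => ?_
  rw [Kernel.comp_apply, laplace_besselKernel hβ _ _ hl.1.le]
  change laplace _ (gammaGateway β ∘ₘ poissonMeasure x) l = _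
  rw [laplace_gamma_comp_poisson hβ _ hl.1.le]
  simp

end Intertwining

/-! ### Existence and uniqueness of the birth-death semigroup -/

section BirthDeath

theorem gammaOp_op_besselKernel_apply {β : ℝ} (hβ : 0 ≤ β) (t : ℝ≥0) (f : C₀(ℝ≥0, ℝ)) (n : ℕ) :
    gammaOp hβ ((isFellerSemigroup_besselKernel hβ).op t f) n =
      ∫ m, gammaOp hβ f m ∂(birthDeathKernel β t n) := by
  have := isMarkovKernel_gammaGateway hβ
  have := isMarkovKernel_besselKernel hβ t
  have := isMarkovKernel_birthDeathKernel hβ t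
  simp only [gammaOp_apply, IsFellerSemigroup.op_apply]
  rw [← Kernel.integral_comp (C0_integrable f _), ← Kernel.integral_comp (C0_integrable f _),
    besselKernel_comp_gammaGateway hβ]

/-- The choice `l = 1/s - 1` solves `(1 + l)⁻¹ = s`. Facts about the Bessel semigroup on
exponentials thereby pass through `Λ*` to geometric sequences, without new estimates. -/
theorem exists_gammaOp_expC0_eq {β : ℝ} (hβ : 0 ≤ β) {s : ℝ} (hs : 0 < s) (hs1 : s < 1) :
    ∃ (l : ℝ) (hl : 0 < l), s = (1 + l)⁻¹ ∧
      powC0 s hs hs1 = ((1 + l) ^ (-β))⁻¹ • gammaOp hβ (isCoordinate_nnreal.expC0 l hl) := by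
  have hl : 0 < s⁻¹ - 1 := sub_pos.2 ((one_lt_inv₀ hs).2 hs1)
  have e : s = (1 + (s⁻¹ - 1))⁻¹ := by simp
  refine ⟨s⁻¹ - 1, hl, e, ?_⟩
  have hc : (1 + (s⁻¹ - 1)) ^ (-β) ≠ 0 := by positivity
  rw [gammaOp_expC0, smul_smul, inv_mul_cancel₀ hc, one_smul]
  ext n
  rw [powC0_apply, powC0_apply, ← e]

theorem isFellerSemigroup_birthDeathKernel {β : ℝ} (hβ : 0 ≤ β) :
    IsFellerSemigroup (birthDeathKernel β) := by
  have hmk := isMarkovKernel_birthDeathKernel hβ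
  have hu {l : ℝ} (hl : 0 < l) : 0 ≤ 1 - Real.exp (-l) := sub_nonneg.2 (exp_neg_lt_one hl).le
  have hu1 (l : ℝ) : 1 - Real.exp (-l) < 1 := by linarith [Real.exp_pos (-l)]
  refine isCoordinate_nat.isFellerSemigroup hmk ?_ ?_ ?_ ?_
  · refine isCoordinate_nat.kernel_ext fun n l hl => ?_
    rw [laplace_birthDeathKernel hβ _ _ hl.1.le, laplace_nat, Kernel.id_apply, lintegral_dirac]
    simp
  · intro s t n l hl
    have h0 := hu hl.1
    have h1 := hu1 l
    have hs' := s.coe_nonneg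
    have ht := t.coe_nonneg
    rw [Kernel.comp_apply, laplace_comp isCoordinate_nat]
    simp only [laplace_birthDeathKernel hβ _ _ hl.1.le]
    set u := 1 - Real.exp (-l) with hudef
    have hp : 0 < 1 + t * u := by positivity
    have hp' : 0 < 1 + t * u + s * u := by positivity
    have hlt := div_one_add_mul_lt_one h0 h1 ht
    have hnn : 0 ≤ u / (1 + t * u) := by positivity
    simp only [ENNReal.ofReal_mul (by positivity : 0 ≤ (1 + t * u) ^ (-β))]
    rw [lintegral_const_mul _ (by fun_prop),
      lintegral_pow_birthDeathKernel hβ s n (by linarith) (by linarith),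
      ← ENNReal.ofReal_mul (by positivity), sub_sub_cancel, ← mul_assoc,
      ← Real.mul_rpow hp.le (by positivity)]
    push_cast
    congr 3
    · field_simp
      ring
    · field_simp
      ring
  · intro t l hl
    have h0 := hu hl
    have h1 := hu1 l
    have ht := t.coe_nonneg
    set u := 1 - Real.exp (-l) with hudef
    have hlt := div_one_add_mul_lt_one h0 h1 ht
    have hupos : 0 < u := sub_pos.2 (exp_neg_lt_one hl)
    have hnn : 0 < u / (1 + t * u) := by positivity
    refine ⟨(1 + t * u) ^ (-β) • powC0 (1 - u / (1 + t * u)) (by linarith) (by linarith),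
      fun n => ?_⟩
    rw [integral_exp_eq_toReal_laplace, laplace_birthDeathKernel hβ _ _ hl.le,
      ENNReal.toReal_ofReal, ZeroAtInftyContinuousMap.smul_apply, powC0_apply, smul_eq_mul]
    exact mul_nonneg (by positivity) (pow_nonneg (by linarith) _)
  -- Strong continuity is inherited: the geometric sequence is a multiple of `Λ* e_m`, and `D_t Λ* =
  -- Λ* Q_t`.
  · intro l hl
    obtain ⟨m, hm, -, h⟩ := exists_gammaOp_expC0_eq hβ (Real.exp_pos (-l)) (exp_neg_lt_one hl)
    rw [expC0_nat_eq_powC0 hl, h]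
    set c := ((1 + m) ^ (-β))⁻¹
    set T := (isFellerSemigroup_besselKernel hβ).op
    have hT := (isFellerSemigroup_besselKernel hβ).isContractionSemigroup
    have h2 := (((gammaOp hβ).continuous.tendsto _).comp
      (hT.continuous (isCoordinate_nnreal.expC0 m hm))).const_smul c
    rw [ZeroAtInftyContinuousMap.tendsto_iff_tendstoUniformly] at h2
    refine (tendstoUniformly_congr (Eventually.of_forall fun t => funext fun n => ?_)).1 h2
    simp only [Function.comp, ZeroAtInftyContinuousMap.smul_apply,
      gammaOp_op_besselKernel_apply, smul_eq_mul, integral_const_mul]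

/-- The generator of the birth-death semigroup. -/
def birthDeathGen (β : ℝ) (f : ℕ → ℝ) (n : ℕ) : ℝ :=
  ((n : ℝ) + β) * (f (n + 1) - f n) + (n : ℝ) * (f (n - 1) - f n)

theorem op_birthDeathKernel_gammaOp {β : ℝ} (hβ : 0 ≤ β) (t : ℝ≥0) (f : C₀(ℝ≥0, ℝ)) :
    (isFellerSemigroup_birthDeathKernel hβ).op t (gammaOp hβ f) =
      gammaOp hβ ((isFellerSemigroup_besselKernel hβ).op t f) := by
  ext n
  rw [gammaOp_op_besselKernel_apply, IsFellerSemigroup.op_apply]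

/-- The infinitesimal form of `D_t Λ* = Λ* Q_t`, checked on exponentials. -/
theorem gammaOp_besselExpC0 {β : ℝ} (hβ : 0 ≤ β) {l : ℝ} (hl : 0 < l) (n : ℕ) :
    gammaOp hβ (besselExpC0 β l hl) n =
      (1 + l) ^ (-β) * birthDeathGen β (fun n => ((1 + l)⁻¹) ^ n) n := by
  have hmk := isMarkovKernel_gammaGateway hβ
  have h1 : gammaOp hβ (mulExpC0 l hl) n = (n + β) * ((1 + l) ^ (-β) * ((1 + l)⁻¹) ^ (n + 1)) := by
    rw [gammaOp_apply]
    change ∫ y : ℝ≥0, (y : ℝ) * Real.exp (-(l * y)) ∂(gammaLaw (n + β)) = _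
    rw [integral_eq_lintegral_of_nonneg_ae (ae_of_all _ fun x => by positivity)
      (by fun_prop), lintegral_mul_exp_gammaLaw (by positivity) (by linarith),
      ENNReal.toReal_ofReal (by positivity), ← rpow_neg_nat_add (by linarith)]
    push_cast
    ring_nf
  rw [besselExpC0, map_sub, map_smul, map_smul, ZeroAtInftyContinuousMap.sub_apply,
    ZeroAtInftyContinuousMap.smul_apply, ZeroAtInftyContinuousMap.smul_apply, h1, gammaOp_expC0,
    ZeroAtInftyContinuousMap.smul_apply, powC0_apply, birthDeathGen]
  have hne : 1 + l ≠ 0 := by positivity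
  simp only [smul_eq_mul]
  -- At `n = 0` the truncated `n - 1` is harmless, since its coefficient is `n`.
  rcases n with _ | n
  · simp
    field_simp
    ring
  · simp only [Nat.add_sub_cancel, pow_succ]
    push_cast
    field_simp
    ring

theorem isGenerated_powC0_birthDeathKernel {β : ℝ} (hβ : 0 ≤ β) {s : ℝ} (hs : 0 < s)
    (hs1 : s < 1) : ∃ g : C₀(ℕ, ℝ), (∀ n, g n = birthDeathGen β (fun n => s ^ n) n) ∧
      IsGenerated (isFellerSemigroup_birthDeathKernel hβ).op (powC0 s hs hs1) g := by
  obtain ⟨l, hl, e, h⟩ := exists_gammaOp_expC0_eq hβ hs hs1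
  refine ⟨((1 + l) ^ (-β))⁻¹ • gammaOp hβ (besselExpC0 β l hl), fun n => ?_, ?_⟩
  · have hc : (1 + l) ^ (-β) ≠ 0 := by positivity
    rw [ZeroAtInftyContinuousMap.smul_apply, gammaOp_besselExpC0, smul_eq_mul,
      inv_mul_cancel_left₀ hc, e]
  · rw [h]
    exact ((isGenerated_expC0_besselKernel hβ hl).map (op_birthDeathKernel_gammaOp hβ)).smul _

theorem exists_nat_mul_pow_le {r : ℝ} (hr : 0 < r) (hr1 : r < 1) :
    ∃ C, 0 ≤ C ∧ ∀ n : ℕ, n * r ^ n ≤ C := by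
  have hm : 0 < -Real.log r := neg_pos.2 (Real.log_neg hr hr1)
  refine ⟨1 ! / (-Real.log r) ^ 1, by positivity, fun n => ?_⟩
  have h := pow_mul_exp_neg_le hm 1 (n.cast_nonneg (α := ℝ))
  have e := powC0_apply r hr hr1 n
  rw [powC0, isCoordinate_nat.expC0_apply] at e
  rwa [e, pow_one] at h

/-- The rates grow linearly, so a small sup norm of `d` does not control its image. Geometric decay
does, because `n r^n` is bounded; approximations must therefore carry the weight `r^n`. -/
theorem exists_birthDeathGen_bound {β : ℝ} (hβ : 0 ≤ β) {r : ℝ} (hr : 0 < r) (hr1 : r < 1) :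
    ∃ K, 0 < K ∧ ∀ (ε : ℝ) (d : ℕ → ℝ), 0 ≤ ε → (∀ n, |d n| ≤ ε * r ^ n) →
      ∀ n, |birthDeathGen β d n| ≤ ε * K := by
  obtain ⟨C, hC0, hC⟩ := exists_nat_mul_pow_le hr hr1
  -- Births contribute `2C + 2β` and deaths `C/r + C`, the division by `r` coming from `r^(n-1)`;
  -- the final `1` ensures strict positivity.
  refine ⟨2 * C + 2 * β + C / r + C + 1, by positivity, fun ε d hε hd n => ?_⟩
  have hpow (k : ℕ) : r ^ k ≤ 1 := pow_le_one₀ hr.le hr1.le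
  have hn := n.cast_nonneg (α := ℝ)
  have b1 : |((n : ℝ) + β) * (d (n + 1) - d n)| ≤ ε * (2 * C + 2 * β) := by
    rw [abs_mul, abs_of_nonneg (by positivity)]
    have h1 : |d (n + 1) - d n| ≤ ε * (2 * r ^ n) := by
      refine (abs_sub _ _).trans ((add_le_add (hd _) (hd _)).trans ?_)
      have : r ^ (n + 1) ≤ r ^ n := pow_le_pow_of_le_one hr.le hr1.le n.le_succ
      nlinarith
    calc _ ≤ ((n : ℝ) + β) * (ε * (2 * r ^ n)) := by gcongr
      _ = ε * (2 * (n * r ^ n) + 2 * (β * r ^ n)) := by ring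
      _ ≤ ε * (2 * C + 2 * (β * 1)) := by
          gcongr
          · exact hC n
          · exact hpow n
      _ = _ := by ring
  have b2 : |(n : ℝ) * (d (n - 1) - d n)| ≤ ε * (C / r + C) := by
    rw [abs_mul, abs_of_nonneg hn]
    have h1 : |d (n - 1) - d n| ≤ ε * (r ^ (n - 1) + r ^ n) := by
      refine (abs_sub _ _).trans ((add_le_add (hd _) (hd _)).trans_eq ?_)
      ring
    have h2 : (n : ℝ) * r ^ (n - 1) ≤ C / r := by
      rcases n with _ | n
      · simp
        positivity
      · rw [le_div_iff₀ hr, Nat.add_sub_cancel, mul_assoc, ← pow_succ]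
        exact hC (n + 1)
    calc _ ≤ (n : ℝ) * (ε * (r ^ (n - 1) + r ^ n)) := by gcongr
      _ = ε * (n * r ^ (n - 1) + n * r ^ n) := by ring
      _ ≤ _ := by
          gcongr
          exact hC n
  refine (abs_add_le _ _).trans ((add_le_add b1 b2).trans ?_)
  nlinarith

theorem birthDeathGen_sub (β : ℝ) (f g : ℕ → ℝ) (n : ℕ) :
    birthDeathGen β f n - birthDeathGen β g n = birthDeathGen β (fun n => f n - g n) n := by
  simp only [birthDeathGen]
  ring

/-- An eventually vanishing sequence, as a sequence vanishing at infinity. -/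
noncomputable def eventuallyZeroC0 (f : ℕ → ℝ) (hf : ∃ N, ∀ n, N ≤ n → f n = 0) : C₀(ℕ, ℝ) where
  toFun := f
  continuous_toFun := continuous_of_discreteTopology
  zero_at_infty' := by
    rw [Filter.cocompact_eq_cofinite, Nat.cofinite_eq_atTop]
    obtain ⟨N, hN⟩ := hf
    refine tendsto_const_nhds.congr' ?_
    filter_upwards [eventually_ge_atTop N] with n hn
    exact (hN n hn).symm

theorem birthDeathGen_eventually_zero (β : ℝ) {f : ℕ → ℝ} (hf : ∃ N, ∀ n, N ≤ n → f n = 0) :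
    ∃ N, ∀ n, N ≤ n → birthDeathGen β f n = 0 := by
  obtain ⟨N, hN⟩ := hf
  refine ⟨N + 1, fun n hn => ?_⟩
  simp only [birthDeathGen]
  rw [hN _ (by omega), hN _ (by omega), hN (n - 1) (by omega)]
  ring

open Polynomial in
theorem isGenerated_eventuallyZero_birthDeathKernel {β : ℝ} (hβ : 0 ≤ β) {f : ℕ → ℝ}
    (hf : ∃ N, ∀ n, N ≤ n → f n = 0) :
    IsGenerated (isFellerSemigroup_birthDeathKernel hβ).op (eventuallyZeroC0 f hf)
      (eventuallyZeroC0 _ (birthDeathGen_eventually_zero β hf)) := by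
  have poly (q : ℝ[X]) : ∃ h g : C₀(ℕ, ℝ),
      IsGenerated (isFellerSemigroup_birthDeathKernel hβ).op h g ∧
      (∀ n : ℕ, h n = Real.exp (-n) * q.eval (Real.exp (-n))) ∧
      ∀ n, g n = birthDeathGen β h n := by
    induction q using Polynomial.induction_on' with
    | add p r hp hr =>
      obtain ⟨h, g, hg, H, H'⟩ := hp
      obtain ⟨k, j, hj, J, J'⟩ := hr
      refine ⟨h + k, g + j, hg.add hj, fun n => by simp [H, J, mul_add], fun n => ?_⟩
      rw [ZeroAtInftyContinuousMap.add_apply, H', J']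
      simp only [birthDeathGen, ZeroAtInftyContinuousMap.add_apply]
      ring
    | monomial k a =>
      have hk : (0 : ℝ) < k + 1 := by positivity
      obtain ⟨g, hg, hg'⟩ := isGenerated_powC0_birthDeathKernel hβ (Real.exp_pos (-(k + 1 : ℝ)))
        (exp_neg_lt_one hk)
      refine ⟨_, _, hg'.smul a, fun n => ?_, fun n => ?_⟩
      · rw [ZeroAtInftyContinuousMap.smul_apply, powC0_apply, eval_monomial, smul_eq_mul,
          ← Real.exp_nat_mul, ← Real.exp_nat_mul, mul_left_comm, ← Real.exp_add]
        ring_nf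
      · rw [ZeroAtInftyContinuousMap.smul_apply, hg]
        simp only [birthDeathGen, ZeroAtInftyContinuousMap.smul_apply, powC0_apply, smul_eq_mul]
        ring
  have hr1 : Real.exp (-1) < 1 := exp_neg_lt_one one_pos
  obtain ⟨K, hK0, hK⟩ := exists_birthDeathGen_bound hβ (Real.exp_pos (-1)) hr1
  -- Approximating `exp n · f n`, still eventually zero, and then multiplying by `exp (-n)` yields
  -- an error with the geometric weight required by `hK`.
  have hf' : ∃ N, ∀ n, N ≤ n → Real.exp (n : ℕ) * f n = 0 := by
    obtain ⟨N, hN⟩ := hf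
    exact ⟨N, fun n hn => by rw [hN n hn, mul_zero]⟩
  refine (isFellerSemigroup_birthDeathKernel hβ).isContractionSemigroup.isGenerated_of_approx
    fun ε hε => ?_
  -- The minimum serves the function error by `ε` and the generator error by `ε / K`.
  obtain ⟨q, hq⟩ := isCoordinate_nat.exists_polynomial_near (eventuallyZeroC0 _ hf')
    (ε := min ε (ε / K)) (by positivity)
  obtain ⟨h, g, hg, H, H'⟩ := poly (X * q)
  have hd (n : ℕ) : |h n - f n| ≤ min ε (ε / K) * Real.exp (-1) ^ n := by
    have h1 := hq n
    have e1 : h n - f n = Real.exp (-(n : ℝ)) *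
        (Real.exp (-(n : ℝ)) * q.eval (Real.exp (-(n : ℝ))) - Real.exp n * f n) := by
      have : Real.exp (-(n : ℝ)) * Real.exp n = 1 := by rw [← Real.exp_add]; simp
      rw [H, eval_mul, eval_X, mul_sub, ← mul_assoc (Real.exp (-(n : ℝ))) (Real.exp n), this,
        one_mul]
    have e2 : Real.exp (-1) ^ n = Real.exp (-(n : ℝ)) := by
      rw [← Real.exp_nat_mul]
      ring_nf
    rw [e1, e2, abs_mul, abs_of_pos (Real.exp_pos _), mul_comm]
    gcongr
    exact h1
  refine ⟨h, g, hg, C0_norm_le hε.le fun n => ?_, C0_norm_le hε.le fun n => ?_⟩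
  · refine (hd n).trans ?_
    exact (mul_le_of_le_one_right (by positivity) (pow_le_one₀ (Real.exp_pos _).le hr1.le)).trans
      (min_le_left _ _)
  · change |g n - birthDeathGen β f n| ≤ ε
    rw [H', birthDeathGen_sub]
    refine (hK _ _ (by positivity) hd n).trans ?_
    calc _ ≤ ε / K * K := by gcongr; exact min_le_right _ _
      _ = ε := by field_simp

theorem isBirthDeathSemigroup_birthDeathKernel {β : ℝ} (hβ : 0 ≤ β) :
    IsBirthDeathSemigroup β (birthDeathKernel β) where
  feller := isFellerSemigroup_birthDeathKernel hβ
  generator f hf := by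
    have hf' : ∃ N, ∀ n, N ≤ n → f n = 0 := by
      obtain ⟨N, hN⟩ := hf.bddAbove
      refine ⟨N + 1, fun n hn => ?_⟩
      by_contra h
      have := hN (Function.mem_support.2 h)
      omega
    exact ((isFellerSemigroup_birthDeathKernel hβ).inGenerator_iff (eventuallyZeroC0 f hf')
      (eventuallyZeroC0 _ (birthDeathGen_eventually_zero β hf'))).2
      (isGenerated_eventuallyZero_birthDeathKernel hβ hf')

theorem IsBirthDeathSemigroup.isGenerated_powC0 {β : ℝ} (hβ : 0 ≤ β) {D : ℝ≥0 → Kernel ℕ ℕ}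
    (hD : IsBirthDeathSemigroup β D) {s : ℝ} (hs : 0 < s) (hs1 : s < 1) {g : C₀(ℕ, ℝ)}
    (hg : ∀ n, g n = birthDeathGen β (fun n => s ^ n) n) :
    IsGenerated hD.feller.op (powC0 s hs hs1) g := by
  -- The tail removed by truncation at `N` satisfies `s^n ≤ √s^N √s^n` for `n ≥ N`: one square root
  -- gives smallness, the other the geometric weight.
  have hr : 0 < √s := Real.sqrt_pos.2 hs
  have hr1 : √s < 1 := by rw [Real.sqrt_lt' one_pos]; simpa using hs1
  have hrs : s = √s * √s := (Real.mul_self_sqrt hs.le).symm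
  obtain ⟨K, hK0, hK⟩ := exists_birthDeathGen_bound hβ hr hr1
  refine hD.feller.isContractionSemigroup.isGenerated_of_approx fun ε hε => ?_
  obtain ⟨N, hN⟩ := exists_pow_lt_of_lt_one (show 0 < min ε (ε / K) by positivity) hr1
  let f : ℕ → ℝ := fun n => if n < N then s ^ n else 0
  have hf : ∃ N, ∀ n, N ≤ n → f n = 0 := ⟨N, fun n hn => if_neg (not_lt.2 hn)⟩
  have hfs : f.support.Finite := by
    refine (Set.finite_Iio N).subset fun n hn => ?_
    by_contra h
    exact hn (if_neg h)
  have hd (n : ℕ) : |f n - s ^ n| ≤ min ε (ε / K) * √s ^ n := by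
    by_cases hn : n < N
    · simp only [f, if_pos hn, sub_self, abs_zero]
      positivity
    · simp only [f, if_neg hn, zero_sub, abs_neg]
      rw [abs_of_pos (by positivity)]
      nth_rw 1 [hrs]
      rw [mul_pow]
      gcongr
      exact (pow_le_pow_of_le_one hr.le hr1.le (not_lt.1 hn)).trans hN.le
  refine ⟨eventuallyZeroC0 f hf, eventuallyZeroC0 _ (birthDeathGen_eventually_zero β hf),
    (hD.feller.inGenerator_iff (eventuallyZeroC0 f hf)
      (eventuallyZeroC0 _ (birthDeathGen_eventually_zero β hf))).1 (hD.generator f hfs),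
    C0_norm_le hε.le fun n => ?_, C0_norm_le hε.le fun n => ?_⟩
  · rw [ZeroAtInftyContinuousMap.sub_apply, powC0_apply]
    refine (hd n).trans ?_
    exact (mul_le_of_le_one_right (by positivity) (pow_le_one₀ hr.le hr1.le)).trans
      (min_le_left _ _)
  · change |birthDeathGen β f n - g n| ≤ ε
    rw [hg, birthDeathGen_sub]
    refine (hK _ _ (by positivity) hd n).trans ?_
    calc _ ≤ ε / K * K := by gcongr; exact min_le_right _ _
      _ = ε := by field_simp

theorem IsBirthDeathSemigroup.eq_birthDeathKernel {β : ℝ} (hβ : 0 ≤ β)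
    {D : ℝ≥0 → Kernel ℕ ℕ} (hD : IsBirthDeathSemigroup β D) : D = birthDeathKernel β := by
  refine isCoordinate_nat.fellerSemigroup_eq (isFellerSemigroup_birthDeathKernel hβ) hD.feller ?_
  intro l hl t
  have ht := t.coe_nonneg
  set u := 1 - Real.exp (-l) with hudef
  have hu : 0 < u := sub_pos.2 (exp_neg_lt_one hl)
  have hu1 : u < 1 := by linarith [Real.exp_pos (-l)]
  have hlt := div_one_add_mul_lt_one hu.le hu1 ht
  have hnn : 0 < u / (1 + t * u) := by positivity
  have hs : 0 < 1 - u / (1 + t * u) := by linarith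
  have hs1 : 1 - u / (1 + t * u) < 1 := by linarith
  have e : (isFellerSemigroup_birthDeathKernel hβ).op t (isCoordinate_nat.expC0 l hl) =
      (1 + t * u) ^ (-β) • powC0 _ hs hs1 := by
    ext n
    rw [IsFellerSemigroup.op_apply, integral_exp_eq_toReal_laplace,
      laplace_birthDeathKernel hβ _ _ hl.le, ENNReal.toReal_ofReal,
      ZeroAtInftyContinuousMap.smul_apply, powC0_apply, smul_eq_mul]
    exact mul_nonneg (by positivity) (pow_nonneg hs.le _)
  rw [e]
  obtain ⟨g, hg, hg'⟩ := isGenerated_powC0_birthDeathKernel hβ hs hs1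
  exact ⟨_, hg'.smul _, (hD.isGenerated_powC0 hβ hs hs1 hg).smul _⟩

end BirthDeath

/-! ### Kernels acting on square integrable functions -/

section L2

variable {X Y Z : Type*} [MeasurableSpace X] [MeasurableSpace Y] [MeasurableSpace Z]

theorem eLpNorm_two_sq_eq (μ : Measure X) (f : X → ℝ) :
    eLpNorm f 2 μ ^ 2 = ∫⁻ x, ‖f x‖ₑ ^ 2 ∂μ := by
  have := eLpNorm_nnreal_pow_eq_lintegral (μ := μ) (f := f) (p := 2) two_ne_zero
  simpa using this

/-- Fubini for `|f|²`, applied to a measurable representative; a null set of `κ ∘ₘ μ` is `κ x`-null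
for almost every `x`. -/
theorem ae_memLp_two_of_memLp_comp {κ : Kernel X Y} {μ : Measure X} {f : Y → ℝ}
    (hf : MemLp f 2 (κ ∘ₘ μ)) : ∀ᵐ x ∂μ, MemLp f 2 (κ x) := by
  have h1 : ∫⁻ x, ∫⁻ y, ‖hf.1.mk f y‖ₑ ^ 2 ∂(κ x) ∂μ ≠ ⊤ := by
    rw [← Measure.lintegral_bind κ.measurable.aemeasurable
      (hf.1.stronglyMeasurable_mk.measurable.enorm.pow_const 2).aemeasurable, ← eLpNorm_two_sq_eq,
      ← eLpNorm_congr_ae hf.1.ae_eq_mk]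
    exact (ENNReal.pow_lt_top hf.2).ne
  have hm : Measurable fun y => ‖hf.1.mk f y‖ₑ ^ 2 :=
    hf.1.stronglyMeasurable_mk.measurable.enorm.pow_const 2
  filter_upwards [ae_lt_top hm.lintegral_kernel h1, Measure.ae_ae_of_ae_comp hf.1.ae_eq_mk]
    with x hx hx'
  have hae : f =ᵐ[κ x] hf.1.mk f := hx'
  refine MemLp.ae_eq hae.symm ⟨hf.1.stronglyMeasurable_mk.aestronglyMeasurable, ?_⟩
  rw [← eLpNorm_two_sq_eq] at hx
  by_contra h
  rw [not_lt_top_iff.1 h] at hx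
  simp at hx

theorem aestronglyMeasurable_integral_of_comp {κ : Kernel X Y} {μ : Measure X} {f : Y → ℝ}
    (hf : AEStronglyMeasurable f (κ ∘ₘ μ)) : AEStronglyMeasurable (fun x => ∫ y, f y ∂(κ x)) μ := by
  refine ⟨_, hf.stronglyMeasurable_mk.integral_kernel (κ := κ), ?_⟩
  filter_upwards [Measure.ae_ae_of_ae_comp hf.ae_eq_mk] with x hx
  exact integral_congr_ae hx

/-- Jensen's inequality for each probability measure `κ x`, integrated against `μ`. -/
theorem eLpNorm_integral_kernel_le {κ : Kernel X Y} [IsMarkovKernel κ] {μ : Measure X} {f : Y → ℝ}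
    (hf : MemLp f 2 (κ ∘ₘ μ)) :
    eLpNorm (fun x => ∫ y, f y ∂(κ x)) 2 μ ≤ eLpNorm f 2 (κ ∘ₘ μ) := by
  have key : eLpNorm (fun x => ∫ y, f y ∂(κ x)) 2 μ ^ 2 ≤ eLpNorm f 2 (κ ∘ₘ μ) ^ 2 := by
    rw [eLpNorm_two_sq_eq, eLpNorm_two_sq_eq, Measure.lintegral_bind κ.measurable.aemeasurable
      (hf.1.enorm.pow_const 2)]
    refine lintegral_mono_ae ?_
    filter_upwards [ae_memLp_two_of_memLp_comp hf] with x hx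
    rw [← eLpNorm_two_sq_eq]
    gcongr
    refine (enorm_integral_le_lintegral_enorm _).trans ?_
    rw [← eLpNorm_one_eq_lintegral_enorm]
    exact eLpNorm_le_eLpNorm_of_exponent_le one_le_two hx.1
  exact (ENNReal.pow_le_pow_left_iff two_ne_zero).1 key

theorem memLp_integral_kernel {κ : Kernel X Y} [IsMarkovKernel κ] {μ : Measure X} {f : Y → ℝ}
    (hf : MemLp f 2 (κ ∘ₘ μ)) : MemLp (fun x => ∫ y, f y ∂(κ x)) 2 μ :=
  ⟨aestronglyMeasurable_integral_of_comp hf.1, (eLpNorm_integral_kernel_le hf).trans_lt hf.2⟩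

/-- A Markov kernel which transports `μ` to `ν` defines a contraction from `L²(ν)` to `L²(μ)`. -/
theorem exists_isL2Operator (κ : Kernel X Y) [IsMarkovKernel κ] {μ : Measure X} {ν : Measure Y}
    (h : κ ∘ₘ μ = ν) : ∃ T : Lp ℝ 2 ν →L[ℝ] Lp ℝ 2 μ, IsL2Operator κ ν μ T := by
  subst h
  have hm (f : Lp ℝ 2 (κ ∘ₘ μ)) := memLp_integral_kernel (Lp.memLp f)
  let T : Lp ℝ 2 (κ ∘ₘ μ) →ₗ[ℝ] Lp ℝ 2 μ :=
    { toFun := fun f => (hm f).toLp _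
      map_add' := fun f g => by
        rw [← MemLp.toLp_add]
        refine MemLp.toLp_congr _ _ ?_
        filter_upwards [ae_memLp_two_of_memLp_comp (Lp.memLp f),
          ae_memLp_two_of_memLp_comp (Lp.memLp g),
          Measure.ae_ae_of_ae_comp (Lp.coeFn_add f g)] with x hf hg hfg
        rw [Pi.add_apply, ← integral_add (hf.integrable one_le_two) (hg.integrable one_le_two)]
        exact integral_congr_ae hfg
      map_smul' := fun c f => by
        rw [RingHom.id_apply, ← MemLp.toLp_const_smul]
        refine MemLp.toLp_congr _ _ ?_
        filter_upwards [Measure.ae_ae_of_ae_comp (Lp.coeFn_smul c f)] with x hf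
        rw [Pi.smul_apply, smul_eq_mul, ← integral_const_mul]
        exact integral_congr_ae hf }
  refine ⟨T.mkContinuous 1 fun f => ?_, fun f hf => ⟨?_, ?_⟩⟩
  · rw [one_mul]
    change ‖(hm f).toLp _‖ ≤ _
    rw [Lp.norm_toLp, Lp.norm_def]
    exact ENNReal.toReal_mono (Lp.eLpNorm_ne_top f) (eLpNorm_integral_kernel_le (Lp.memLp f))
  · filter_upwards [ae_memLp_two_of_memLp_comp hf] with x hx
    exact hx.integrable one_le_two
  · refine (MemLp.coeFn_toLp (hm (hf.toLp f))).trans ?_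
    filter_upwards [Measure.ae_ae_of_ae_comp hf.coeFn_toLp] with x hx
    exact integral_congr_ae hx

/-- The operator `T''` of the composite kernel supplies the almost everywhere integrability which
permits interchanging the two integrations. -/
theorem IsL2Operator.comp_eq {κ : Kernel X Y} {η : Kernel Y Z} {μ : Measure X} {ν : Measure Y}
    {ρ : Measure Z} {T : Lp ℝ 2 ν →L[ℝ] Lp ℝ 2 μ} {T' : Lp ℝ 2 ρ →L[ℝ] Lp ℝ 2 ν}
    {T'' : Lp ℝ 2 ρ →L[ℝ] Lp ℝ 2 μ} (h : IsL2Operator κ ν μ T) (h' : IsL2Operator η ρ ν T')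
    (h'' : IsL2Operator (η ∘ₖ κ) ρ μ T'') : T ∘L T' = T'' := by
  ext1 f
  have hf := Lp.memLp f
  have e : f = hf.toLp f := (Lp.toLp_coeFn f _).symm
  have h1 := (h' _ hf).2
  rw [← e] at h1
  have hg : MemLp (fun y => ∫ z, f z ∂(η y)) 2 ν := (Lp.memLp (T' f)).ae_eq h1
  have e2 : T' f = hg.toLp _ := by
    refine Lp.ext (h1.trans hg.coeFn_toLp.symm)
  have h2 := (h _ hg).2
  rw [← e2] at h2
  have h3 := h'' _ hf
  rw [← e] at h3
  refine Lp.ext (h2.trans (EventuallyEq.trans ?_ h3.2.symm))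
  filter_upwards [h3.1] with x hx
  rw [Kernel.integral_comp hx]

end L2

/-! ### Exponentials are total -/

section Total

variable {E : Type*} [TopologicalSpace E] [MeasurableSpace E] [BorelSpace E] {ι : E → ℝ}
  {ρ : Measure E}

/-- Weighted by a positive exponential the measure is finite. σ-finiteness is what lets equal
measures have almost everywhere equal densities. -/
theorem IsCoordinate.sigmaFinite (hι : IsCoordinate ι) {l : ℝ} (h : laplace ι ρ l ≠ ⊤) :
    SigmaFinite ρ := by
  set w : E → ℝ≥0∞ := fun x => ENNReal.ofReal (Real.exp (-(l * ι x))) with hw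
  have wm : Measurable w := hι.measurable_exp _
  have : IsFiniteMeasure (ρ.withDensity w) := isFiniteMeasure_withDensity h
  have inv : (ρ.withDensity w).withDensity w⁻¹ = ρ :=
    withDensity_inv_same wm (ae_of_all _ fun x => by simp [hw, Real.exp_pos])
      (ae_of_all _ fun x => by simp [hw])
  rw [← inv]
  exact SigmaFinite.withDensity_of_ne_top (ae_of_all _ fun x => by simp [hw, Real.exp_pos])

theorem IsCoordinate.memLp_exp (hι : IsCoordinate ι) (hρ : ∀ l, 0 < l → laplace ι ρ l ≠ ⊤) {l : ℝ}
    (hl : 0 < l) : MemLp (fun x => Real.exp (-(l * ι x))) 2 ρ := by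
  have := hι.measurable
  refine ⟨by fun_prop, ?_⟩
  have h : eLpNorm (fun x => Real.exp (-(l * ι x))) 2 ρ ^ 2 = laplace ι ρ (2 * l) := by
    rw [eLpNorm_two_sq_eq]
    refine lintegral_congr fun x => ?_
    rw [Real.enorm_of_nonneg (Real.exp_pos _).le, ← ENNReal.ofReal_pow (Real.exp_pos _).le,
      ← Real.exp_nat_mul]
    push_cast
    ring_nf
  by_contra h'
  rw [not_lt_top_iff.1 h'] at h
  exact hρ (2 * l) (by positivity) (by rw [← h]; simp)

/-- The measures `f⁺ ρ` and `f⁻ ρ` have the same finite Laplace transforms on `(0, 1)`, so they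
coincide and `f⁺ = f⁻` almost everywhere. Frequencies below `1` must suffice, as `Λ` only produces
the rates `1 - exp (-l)`. -/
theorem IsCoordinate.ae_eq_zero_of_integral_mul_exp (hι : IsCoordinate ι)
    (hρ : ∀ l, 0 < l → laplace ι ρ l ≠ ⊤) {f : E → ℝ} (hf : MemLp f 2 ρ)
    (h : ∀ l ∈ Set.Ioo (0 : ℝ) 1, ∫ x, f x * Real.exp (-(l * ι x)) ∂ρ = 0) : f =ᵐ[ρ] 0 := by
  have := hι.sigmaFinite (hρ 1 one_pos)
  have hint (l : ℝ) (hl : 0 < l) : Integrable (fun x => f x * Real.exp (-(l * ι x))) ρ :=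
    hf.integrable_mul (hι.memLp_exp hρ hl)
  have lap (g : E → ℝ) (hg : AEMeasurable g ρ) (l : ℝ) :
      laplace ι (ρ.withDensity fun x => ENNReal.ofReal (g x)) l =
        ∫⁻ x, ENNReal.ofReal (g x * Real.exp (-(l * ι x))) ∂ρ := by
    rw [laplace, lintegral_withDensity_eq_lintegral_mul₀ hg.ennreal_ofReal
      (hι.measurable_exp l).aemeasurable]
    refine lintegral_congr fun x => ?_
    rw [Pi.mul_apply, ENNReal.ofReal_mul' (Real.exp_pos _).le]
  have hfm := hf.1.aemeasurable
  have fin (l : ℝ) (hl : 0 < l) : ∫⁻ x, ENNReal.ofReal (f x * Real.exp (-(l * ι x))) ∂ρ ≠ ⊤ :=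
    (hint l hl).lintegral_lt_top.ne
  have fin' (l : ℝ) (hl : 0 < l) : ∫⁻ x, ENNReal.ofReal (-f x * Real.exp (-(l * ι x))) ∂ρ ≠ ⊤ := by
    simp only [neg_mul]
    exact (hint l hl).neg.lintegral_lt_top.ne
  have key : (ρ.withDensity fun x => ENNReal.ofReal (f x)) =
      ρ.withDensity fun x => ENNReal.ofReal (-f x) := by
    refine hι.ext_of_laplace (fun l hl => ?_) fun l hl => ?_
    · rw [lap f hfm, lap (fun x => -f x) hfm.neg]
      have h1 := h l hl
      rw [integral_eq_lintegral_pos_part_sub_lintegral_neg_part (hint l hl.1), sub_eq_zero] at h1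
      have e (x : E) : -(f x * Real.exp (-(l * ι x))) = -f x * Real.exp (-(l * ι x)) :=
        (neg_mul _ _).symm
      simp only [e] at h1
      exact (ENNReal.toReal_eq_toReal_iff' (fin l hl.1) (fin' l hl.1)).1 h1
    · rw [lap f hfm]
      exact fin l hl.1
  have key' := (withDensity_eq_iff_of_sigmaFinite (g := fun x => ENNReal.ofReal (-f x))
    hfm.ennreal_ofReal hfm.neg.ennreal_ofReal).1 key
  filter_upwards [key'] with x hx
  rcases le_total 0 (f x) with h0 | h0
  · rw [ENNReal.ofReal_of_nonpos (neg_nonpos.2 h0), ENNReal.ofReal_eq_zero] at hx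
    exact le_antisymm hx h0
  · rw [ENNReal.ofReal_of_nonpos h0, eq_comm, ENNReal.ofReal_eq_zero] at hx
    exact le_antisymm h0 (neg_nonpos.1 hx)

/-- The class of `x ↦ exp (-l * ι x)` in `L²(ρ)`. -/
noncomputable def IsCoordinate.expL2 (hι : IsCoordinate ι) (hρ : ∀ l, 0 < l → laplace ι ρ l ≠ ⊤)
    (l : ℝ) (hl : 0 < l) : Lp ℝ 2 ρ :=
  (hι.memLp_exp hρ hl).toLp _

theorem IsCoordinate.inner_expL2 (hι : IsCoordinate ι) (hρ : ∀ l, 0 < l → laplace ι ρ l ≠ ⊤)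
    {l k : ℝ} (hl : 0 < l) (hk : 0 < k) :
    inner ℝ (hι.expL2 hρ l hl) (hι.expL2 hρ k hk) = (laplace ι ρ (l + k)).toReal := by
  have := hι.measurable
  rw [L2.inner_def]
  calc _ = ∫ x, Real.exp (-((l + k) * ι x)) ∂ρ := by
        refine integral_congr_ae ?_
        filter_upwards [(hι.memLp_exp hρ hl).coeFn_toLp, (hι.memLp_exp hρ hk).coeFn_toLp]
          with x h1 h2
        rw [expL2, expL2, h1, h2, RCLike.inner_apply, conj_trivial, ← Real.exp_add]
        ring_nf
    _ = _ := by
        rw [integral_eq_lintegral_of_nonneg_ae (ae_of_all _ fun x => (Real.exp_pos _).le)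
          (by fun_prop), laplace]

theorem IsCoordinate.eq_zero_of_inner_expL2 (hι : IsCoordinate ι)
    (hρ : ∀ l, 0 < l → laplace ι ρ l ≠ ⊤) {f : Lp ℝ 2 ρ}
    (h : ∀ l (hl : 0 < l), l < 1 → inner ℝ (hι.expL2 hρ l hl) f = 0) : f = 0 := by
  rw [Lp.eq_zero_iff_ae_eq_zero]
  refine hι.ae_eq_zero_of_integral_mul_exp hρ (Lp.memLp f) fun l hl => ?_
  rw [← h l hl.1 hl.2, L2.inner_def]
  refine integral_congr_ae ?_
  filter_upwards [(hι.memLp_exp hρ hl.1).coeFn_toLp] with x h1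
  rw [expL2, h1, RCLike.inner_apply, conj_trivial]

/-- Operators which are in duality on the exponentials are adjoint to each other. -/
theorem IsCoordinate.adjoint_eq (hι : IsCoordinate ι) (hρ : ∀ l, 0 < l → laplace ι ρ l ≠ ⊤)
    {E' : Type*} [TopologicalSpace E'] [MeasurableSpace E'] [BorelSpace E'] {ι' : E' → ℝ}
    (hι' : IsCoordinate ι') {ρ' : Measure E'} (hρ' : ∀ l, 0 < l → laplace ι' ρ' l ≠ ⊤)
    {T : Lp ℝ 2 ρ →L[ℝ] Lp ℝ 2 ρ'} {T' : Lp ℝ 2 ρ' →L[ℝ] Lp ℝ 2 ρ}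
    (h : ∀ l (hl : 0 < l) k (hk : 0 < k), inner ℝ (T (hι.expL2 hρ l hl)) (hι'.expL2 hρ' k hk) =
      inner ℝ (hι.expL2 hρ l hl) (T' (hι'.expL2 hρ' k hk))) (u : Lp ℝ 2 ρ) (v : Lp ℝ 2 ρ') :
    inner ℝ (T u) v = inner ℝ u (T' v) := by
  -- Totality is used twice: in `L²(ρ)` it shows that the adjoint of `T` equals `T'` on
  -- exponentials, then in `L²(ρ')` that `T` is the adjoint of `T'` everywhere.
  have h1 (k : ℝ) (hk : 0 < k) :
      T.adjoint (hι'.expL2 hρ' k hk) = T' (hι'.expL2 hρ' k hk) := by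
    rw [← sub_eq_zero]
    refine hι.eq_zero_of_inner_expL2 hρ fun l hl _ => ?_
    rw [inner_sub_right, ContinuousLinearMap.adjoint_inner_right, h, sub_self]
  have h2 (u : Lp ℝ 2 ρ) : T u = T'.adjoint u := by
    rw [← sub_eq_zero]
    refine hι'.eq_zero_of_inner_expL2 hρ' fun k hk _ => ?_
    rw [inner_sub_right, ContinuousLinearMap.adjoint_inner_right, ← h1,
      ContinuousLinearMap.adjoint_inner_left, sub_self]
  rw [h2, ContinuousLinearMap.adjoint_inner_left]

theorem IsL2Operator.apply_expL2 {E' : Type*} [TopologicalSpace E'] [MeasurableSpace E']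
    [BorelSpace E'] (hι : IsCoordinate ι) (hρ : ∀ l, 0 < l → laplace ι ρ l ≠ ⊤)
    {ι' : E' → ℝ} (hι' : IsCoordinate ι') {ρ' : Measure E'}
    (hρ' : ∀ l, 0 < l → laplace ι' ρ' l ≠ ⊤) {κ : Kernel E' E}
    {T : Lp ℝ 2 ρ →L[ℝ] Lp ℝ 2 ρ'} (hT : IsL2Operator κ ρ ρ' T) {l k c : ℝ} (hl : 0 < l)
    (hk : 0 < k) (hc : 0 ≤ c)
    (h : ∀ x, laplace ι (κ x) l = ENNReal.ofReal (c * Real.exp (-(k * ι' x)))) :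
    T (hι.expL2 hρ l hl) = c • hι'.expL2 hρ' k hk := by
  refine Lp.ext ((hT _ (hι.memLp_exp hρ hl)).2.trans ?_)
  refine EventuallyEq.trans ?_ (Lp.coeFn_smul c (hι'.expL2 hρ' k hk)).symm
  filter_upwards [(hι'.memLp_exp hρ' hk).coeFn_toLp] with x hx
  rw [Pi.smul_apply, IsCoordinate.expL2, hx, smul_eq_mul]
  have := integral_exp_eq_toReal_laplace hι hl (κ x)
  simp only [hι.expC0_apply] at this
  rw [this, h, ENNReal.toReal_ofReal (by positivity)]

end Total

/-! ### Invariance of the reference measures -/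

section Invariance

variable {β : ℝ}

theorem Gamma_add_nat_eq_prod (hβ : 0 < β) (n : ℕ) :
    Real.Gamma (β + n) = (∏ k ∈ Finset.range n, (β + (k : ℝ))) * Real.Gamma β := by
  induction n with
  | zero => simp
  | succ n ih =>
    rw [Nat.cast_succ, ← add_assoc, Real.Gamma_add_one (by positivity), ih,
      Finset.prod_range_succ]
    ring

/-- The mass at `n` is the gamma integral `Γ(β + n) / (n! Γ(β))`. -/
theorem poissonGateway_comp_besselMeasure (hβ : 0 < β) :
    poissonGateway ∘ₘ besselMeasure β = birthDeathMeasure β := by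
  refine Measure.ext_of_singleton fun n => ?_
  rw [Measure.bind_apply (measurableSet_singleton n) poissonGateway.measurable.aemeasurable,
    birthDeathMeasure, Measure.sum_smul_dirac_singleton]
  change ∫⁻ x, poissonMeasure x {n} ∂_ = _
  have hG := (Real.Gamma_pos_of_pos hβ).ne'
  calc _ = ∫⁻ x : ℝ≥0, ENNReal.ofReal (1 / (n ! : ℝ)) *
        ENNReal.ofReal ((x : ℝ) ^ (n : ℝ) * Real.exp (-(1 * x))) ∂(besselMeasure β) := by
        refine lintegral_congr fun x => ?_
        rw [poissonMeasure_singleton, ← ENNReal.ofReal_mul (by positivity), Real.rpow_natCast,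
          one_mul]
        congr 1
        ring
    _ = _ := by
        rw [lintegral_const_mul _ (by fun_prop),
          lintegral_rpow_mul_exp_besselMeasure hβ one_pos (Nat.cast_nonneg n),
          ← ENNReal.ofReal_mul (by positivity), Gamma_add_nat_eq_prod hβ, Real.one_rpow,
          mul_div_assoc, div_self hG]
        congr 1
        ring

theorem laplace_besselMeasure_ne_top (hβ : 0 < β) (l : ℝ) (hl : 0 < l) :
    laplace (fun x : ℝ≥0 => (x : ℝ)) (besselMeasure β) l ≠ ⊤ := by
  rw [laplace_besselMeasure hβ hl]
  exact ENNReal.ofReal_ne_top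

/-- The transform of `μ_β` is `l^(-β)`, and `(1 + l t)^(-β) (l/(1+lt))^(-β) = l^(-β)`. -/
theorem besselKernel_comp_besselMeasure (hβ : 0 < β) (t : ℝ≥0) :
    besselKernel β t ∘ₘ besselMeasure β = besselMeasure β := by
  refine (isCoordinate_nnreal.ext_of_laplace (fun l hl => ?_) fun l hl =>
    laplace_besselMeasure_ne_top hβ l hl.1).symm
  have hl0 := hl.1
  rw [laplace_comp isCoordinate_nnreal]
  simp only [laplace_besselKernel hβ.le _ _ hl.1.le,
    ENNReal.ofReal_mul (by positivity : 0 ≤ (1 + l * (t : ℝ)) ^ (-β))]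
  rw [lintegral_const_mul _ (by fun_prop)]
  have h := laplace_besselMeasure hβ (l := l / (1 + l * t)) (by positivity)
  rw [laplace] at h
  rw [h, laplace_besselMeasure hβ hl.1, ← ENNReal.ofReal_mul (by positivity),
    ← Real.mul_rpow (by positivity) (by positivity), mul_div_cancel₀ _ (by positivity)]

/-- No computation with `m_β` is needed: `m_β Λ* = μ_β Λ Λ* = μ_β Q_1 = μ_β`. -/
theorem gammaGateway_comp_birthDeathMeasure (hβ : 0 < β) :
    gammaGateway β ∘ₘ birthDeathMeasure β = besselMeasure β := by
  rw [← poissonGateway_comp_besselMeasure hβ, Measure.comp_assoc,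
    gammaGateway_comp_poissonGateway hβ.le, besselKernel_comp_besselMeasure hβ]

theorem birthDeathKernel_comp_birthDeathMeasure (hβ : 0 < β) (t : ℝ≥0) :
    birthDeathKernel β t ∘ₘ birthDeathMeasure β = birthDeathMeasure β := by
  rw [← poissonGateway_comp_besselMeasure hβ, Measure.comp_assoc,
    birthDeathKernel_comp_poissonGateway hβ.le, ← Measure.comp_assoc,
    besselKernel_comp_besselMeasure hβ]

theorem laplace_poissonGateway (x : ℝ≥0) (l : ℝ) :
    laplace (fun n : ℕ => (n : ℝ)) (poissonGateway x) l =
      ENNReal.ofReal (Real.exp (-((1 - Real.exp (-l)) * x))) := by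
  rw [laplace_nat]
  change ∫⁻ n, _ ∂(poissonMeasure x) = _
  rw [lintegral_pow_poissonMeasure x (Real.exp_pos _).le, mul_comm]

theorem laplace_birthDeathMeasure (hβ : 0 < β) {l : ℝ} (hl : 0 < l) :
    laplace (fun n : ℕ => (n : ℝ)) (birthDeathMeasure β) l =
      ENNReal.ofReal ((1 - Real.exp (-l)) ^ (-β)) := by
  rw [← poissonGateway_comp_besselMeasure hβ, laplace_comp isCoordinate_nat]
  simp only [laplace_poissonGateway]
  exact laplace_besselMeasure hβ (sub_pos.2 (exp_neg_lt_one hl))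

theorem laplace_birthDeathMeasure_ne_top (hβ : 0 < β) (l : ℝ) (hl : 0 < l) :
    laplace (fun n : ℕ => (n : ℝ)) (birthDeathMeasure β) l ≠ ⊤ := by
  rw [laplace_birthDeathMeasure hβ hl]
  exact ENNReal.ofReal_ne_top

end Invariance

/-! ### Unitary equivalence from a factorization of a square -/

section Hilbert

variable {H K : Type*} [NormedAddCommGroup H] [InnerProductSpace ℝ H]
  [NormedAddCommGroup K] [InnerProductSpace ℝ K] [CompleteSpace K]

theorem denseRange_of_injective_adjoint {T : H →L[ℝ] K} {T' : K →L[ℝ] H}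
    (h : ∀ u v, inner ℝ (T u) v = inner ℝ u (T' v)) (hT' : Function.Injective T') :
    DenseRange T := by
  have hcl : T.range.topologicalClosure = ⊤ := by
    rw [Submodule.topologicalClosure_eq_top_iff, eq_bot_iff]
    intro v hv
    refine (Submodule.mem_bot ℝ).2 (hT' ?_)
    rw [map_zero, ← inner_self_eq_zero (𝕜 := ℝ), ← h]
    exact (Submodule.mem_orthogonal _ _).1 hv _ ⟨_, rfl⟩
  exact Submodule.dense_iff_topologicalClosure_eq_top.2 hcl

/-- If `A B = G²` where `B` is the adjoint of `A` and `G` is symmetric, with `A` and `B`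
injective, then `G v ↦ B v` extends to a unitary operator, which carries every family commuting
with `G` and intertwined by `B`. -/
theorem exists_unitary_of_comp_eq_sq [CompleteSpace H] {ι : Type*} {A : H →L[ℝ] K}
    {B : K →L[ℝ] H} {G : K →L[ℝ] K}
    (hAB : ∀ u v, inner ℝ (A u) v = inner ℝ u (B v))
    (hG : ∀ u v, inner ℝ (G u) v = inner ℝ u (G v)) (hsq : G ∘L G = A ∘L B)
    (hA : Function.Injective A) (hB : Function.Injective B) {S : ι → K →L[ℝ] K}
    {R : ι → H →L[ℝ] H} (hSG : ∀ t, S t ∘L G = G ∘L S t) (hRB : ∀ t, R t ∘L B = B ∘L S t) :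
    ∃ U : H ≃ₗᵢ[ℝ] K, ∀ t f, S t (U f) = U (R t f) := by
  -- `‖B v‖² = ⟨A B v, v⟩ = ⟨G² v, v⟩ = ‖G v‖²`, so `G v ↦ B v` is a well-defined isometry.
  have hn (v : K) : ‖B v‖ = ‖G v‖ := by
    rw [← sq_eq_sq₀ (norm_nonneg _) (norm_nonneg _), ← real_inner_self_eq_norm_sq,
      ← real_inner_self_eq_norm_sq, ← hAB, real_inner_comm, hG, real_inner_comm]
    have := DFunLike.congr_fun hsq v
    simp only [ContinuousLinearMap.comp_apply] at this
    rw [this, real_inner_comm]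
  have hGi : Function.Injective G := by
    refine (injective_iff_map_eq_zero G).2 fun v hv => hB ?_
    rw [map_zero, ← norm_eq_zero, hn, hv, norm_zero]
  have dG : DenseRange G := denseRange_of_injective_adjoint hG hGi
  have dB : DenseRange B := denseRange_of_injective_adjoint
    (fun u v => by rw [real_inner_comm, ← hAB, real_inner_comm]) hA
  let V : K ≃ₗᵢ[ℝ] H := (LinearEquiv.refl ℝ K).extendOfIsometry (G : K →ₗ[ℝ] K) (B : K →ₗ[ℝ] H)
    dG dB hn
  have hV (v : K) : V (G v) = B v := LinearEquiv.extendOfIsometry_eq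
    (LinearEquiv.refl ℝ K) (G : K →ₗ[ℝ] K) (B : K →ₗ[ℝ] H) dG dB hn v
  have key (t : ι) (y : K) : V (S t y) = R t (V y) := by
    refine dG.induction_on y (isClosed_eq (by fun_prop) (by fun_prop)) fun z => ?_
    have h1 := DFunLike.congr_fun (hSG t) z
    have h2 := DFunLike.congr_fun (hRB t) z
    simp only [ContinuousLinearMap.comp_apply] at h1 h2
    rw [h1, hV, hV, h2]
  refine ⟨V.symm, fun t f => V.injective ?_⟩
  rw [key, V.apply_symm_apply, V.apply_symm_apply]

end Hilbert

/-! ### The gateways in the Hilbert spaces -/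

section HilbertGateways

variable {β : ℝ}

/-- The exponentials in `L²` of the reference measure on `[0, ∞)`. -/
noncomputable def besselExp (hβ : 0 < β) (l : ℝ) (hl : 0 < l) : Lp ℝ 2 (besselMeasure β) :=
  isCoordinate_nnreal.expL2 (laplace_besselMeasure_ne_top hβ) l hl

/-- The geometric sequences in `ℓ²` of the reference measure on the nonnegative integers. -/
noncomputable def birthDeathExp (hβ : 0 < β) (l : ℝ) (hl : 0 < l) :
    Lp ℝ 2 (birthDeathMeasure β) :=
  isCoordinate_nat.expL2 (laplace_birthDeathMeasure_ne_top hβ) l hl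

theorem inner_besselExp (hβ : 0 < β) {l k : ℝ} (hl : 0 < l) (hk : 0 < k) :
    inner ℝ (besselExp hβ l hl) (besselExp hβ k hk) = (l + k) ^ (-β) := by
  rw [besselExp, besselExp, IsCoordinate.inner_expL2, laplace_besselMeasure hβ (by positivity),
    ENNReal.toReal_ofReal (by positivity)]

theorem inner_birthDeathExp (hβ : 0 < β) {l k : ℝ} (hl : 0 < l) (hk : 0 < k) :
    inner ℝ (birthDeathExp hβ l hl) (birthDeathExp hβ k hk) = (1 - Real.exp (-(l + k))) ^ (-β) := by
  have h : 0 < 1 - Real.exp (-(l + k)) := sub_pos.2 (exp_neg_lt_one (by positivity))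
  rw [birthDeathExp, birthDeathExp, IsCoordinate.inner_expL2,
    laplace_birthDeathMeasure hβ (by positivity), ENNReal.toReal_ofReal (by positivity)]

theorem poissonL2_birthDeathExp (hβ : 0 < β)
    {L : Lp ℝ 2 (birthDeathMeasure β) →L[ℝ] Lp ℝ 2 (besselMeasure β)}
    (hL : IsL2Operator poissonGateway (birthDeathMeasure β) (besselMeasure β) L) {l : ℝ}
    (hl : 0 < l) : L (birthDeathExp hβ l hl) =
      besselExp hβ (1 - Real.exp (-l)) (sub_pos.2 (exp_neg_lt_one hl)) := by
  have := hL.apply_expL2 isCoordinate_nat (laplace_birthDeathMeasure_ne_top hβ)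
    isCoordinate_nnreal (laplace_besselMeasure_ne_top hβ) hl (sub_pos.2 (exp_neg_lt_one hl))
    zero_le_one (fun x => by rw [laplace_poissonGateway, one_mul])
  rwa [one_smul] at this

theorem gammaL2_besselExp (hβ : 0 < β)
    {L' : Lp ℝ 2 (besselMeasure β) →L[ℝ] Lp ℝ 2 (birthDeathMeasure β)}
    (hL' : IsL2Operator (gammaGateway β) (besselMeasure β) (birthDeathMeasure β) L') {l : ℝ}
    (hl : 0 < l) : L' (besselExp hβ l hl) =
      (1 + l) ^ (-β) • birthDeathExp hβ (Real.log (1 + l)) (Real.log_pos (by linarith)) := by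
  have := isMarkovKernel_gammaGateway hβ.le
  refine hL'.apply_expL2 isCoordinate_nnreal (laplace_besselMeasure_ne_top hβ)
    isCoordinate_nat (laplace_birthDeathMeasure_ne_top hβ) hl (Real.log_pos (by linarith))
    (by positivity) (fun n => ?_)
  rw [laplace_gammaGateway hβ.le n (by linarith), mul_comm (Real.log _), ← mul_neg,
    Real.exp_nat_mul, Real.exp_neg, Real.exp_log (by positivity)]

theorem besselL2_besselExp (hβ : 0 < β) (t : ℝ≥0)
    {S : Lp ℝ 2 (besselMeasure β) →L[ℝ] Lp ℝ 2 (besselMeasure β)}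
    (hS : IsL2Operator (besselKernel β t) (besselMeasure β) (besselMeasure β) S) {l : ℝ}
    (hl : 0 < l) : S (besselExp hβ l hl) =
      (1 + l * t) ^ (-β) • besselExp hβ (l / (1 + l * t)) (by positivity) := by
  have := isMarkovKernel_besselKernel hβ.le t
  exact hS.apply_expL2 isCoordinate_nnreal (laplace_besselMeasure_ne_top hβ)
    isCoordinate_nnreal (laplace_besselMeasure_ne_top hβ) hl (by positivity)
    (by positivity) (fun x => laplace_besselKernel hβ.le t x hl.le)

/-- On exponentials, `⟨Q_t e_l, e_k⟩ = (l + k + l k t)^(-β)` is symmetric in `l` and `k`. -/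
theorem inner_besselL2 (hβ : 0 < β) (t : ℝ≥0)
    {S : Lp ℝ 2 (besselMeasure β) →L[ℝ] Lp ℝ 2 (besselMeasure β)}
    (hS : IsL2Operator (besselKernel β t) (besselMeasure β) (besselMeasure β) S)
    (u v : Lp ℝ 2 (besselMeasure β)) : inner ℝ (S u) v = inner ℝ u (S v) := by
  have aux {l k : ℝ} (hl : 0 < l) (hk : 0 < k) : inner ℝ (S (besselExp hβ l hl))
      (besselExp hβ k hk) = (l + k + l * k * t) ^ (-β) := by
    have ht : 1 + l * (t : ℝ) ≠ 0 := by positivity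
    rw [besselL2_besselExp hβ t hS, real_inner_smul_left, inner_besselExp,
      ← Real.mul_rpow (by positivity) (by positivity)]
    congr 1
    field_simp
    ring
  refine isCoordinate_nnreal.adjoint_eq (laplace_besselMeasure_ne_top hβ) isCoordinate_nnreal
    (laplace_besselMeasure_ne_top hβ) (fun l hl k hk => ?_) u v
  refine (aux hl hk).trans (Eq.trans ?_ ((real_inner_comm _ _).trans (aux hk hl)).symm)
  ring_nf

/-- On exponentials both sides equal `(1 - exp (-l) + k)^(-β)`. -/
theorem inner_poissonL2 (hβ : 0 < β)
    {L : Lp ℝ 2 (birthDeathMeasure β) →L[ℝ] Lp ℝ 2 (besselMeasure β)}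
    (hL : IsL2Operator poissonGateway (birthDeathMeasure β) (besselMeasure β) L)
    {L' : Lp ℝ 2 (besselMeasure β) →L[ℝ] Lp ℝ 2 (birthDeathMeasure β)}
    (hL' : IsL2Operator (gammaGateway β) (besselMeasure β) (birthDeathMeasure β) L')
    (u : Lp ℝ 2 (birthDeathMeasure β)) (v : Lp ℝ 2 (besselMeasure β)) :
    inner ℝ (L u) v = inner ℝ u (L' v) := by
  refine isCoordinate_nat.adjoint_eq (laplace_birthDeathMeasure_ne_top hβ) isCoordinate_nnreal
    (laplace_besselMeasure_ne_top hβ) (fun l hl k hk => ?_) u v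
  change inner ℝ (L (birthDeathExp hβ l hl)) (besselExp hβ k hk) =
    inner ℝ (birthDeathExp hβ l hl) (L' (besselExp hβ k hk))
  have h1 : 0 < 1 - Real.exp (-l) := sub_pos.2 (exp_neg_lt_one hl)
  have h2 : 0 ≤ 1 - Real.exp (-(l + Real.log (1 + k))) :=
    (sub_pos.2 (exp_neg_lt_one (add_pos hl (Real.log_pos (by linarith))))).le
  rw [poissonL2_birthDeathExp hβ hL, gammaL2_besselExp hβ hL', inner_besselExp,
    real_inner_smul_right, inner_birthDeathExp, ← Real.mul_rpow (by positivity) h2]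
  congr 1
  rw [neg_add, Real.exp_add, Real.exp_neg (Real.log _), Real.exp_log (by positivity)]
  field_simp
  ring

theorem injective_gammaL2 (hβ : 0 < β)
    {L : Lp ℝ 2 (birthDeathMeasure β) →L[ℝ] Lp ℝ 2 (besselMeasure β)}
    (hL : IsL2Operator poissonGateway (birthDeathMeasure β) (besselMeasure β) L)
    {L' : Lp ℝ 2 (besselMeasure β) →L[ℝ] Lp ℝ 2 (birthDeathMeasure β)}
    (hL' : IsL2Operator (gammaGateway β) (besselMeasure β) (birthDeathMeasure β) L') :
    Function.Injective L' := by
  refine (injective_iff_map_eq_zero L').2 fun v hv => ?_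
  refine isCoordinate_nnreal.eq_zero_of_inner_expL2 (laplace_besselMeasure_ne_top hβ)
    fun l hl hl1 => ?_
  -- The rate `-log (1 - l)` is chosen so that `Λ` maps the geometric sequence exactly to `e_l`;
  -- this needs `l < 1`.
  have h := inner_poissonL2 hβ hL hL'
    (birthDeathExp hβ (-Real.log (1 - l)) (neg_pos.2 (Real.log_neg (by linarith) (by linarith)))) v
  rw [hv, inner_zero_right, poissonL2_birthDeathExp hβ hL] at h
  simp only [neg_neg, Real.exp_log (sub_pos.2 hl1), sub_sub_cancel] at h
  exact h

theorem injective_poissonL2 (hβ : 0 < β)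
    {L : Lp ℝ 2 (birthDeathMeasure β) →L[ℝ] Lp ℝ 2 (besselMeasure β)}
    (hL : IsL2Operator poissonGateway (birthDeathMeasure β) (besselMeasure β) L)
    {L' : Lp ℝ 2 (besselMeasure β) →L[ℝ] Lp ℝ 2 (birthDeathMeasure β)}
    (hL' : IsL2Operator (gammaGateway β) (besselMeasure β) (birthDeathMeasure β) L') :
    Function.Injective L := by
  refine (injective_iff_map_eq_zero L).2 fun u hu => ?_
  refine isCoordinate_nat.eq_zero_of_inner_expL2 (laplace_birthDeathMeasure_ne_top hβ)
    fun l hl hl1 => ?_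
  -- With `k = exp l - 1`, `Λ* e_k` is a nonzero multiple of `n ↦ exp (-l n)`.
  have hk : 0 < Real.exp l - 1 := sub_pos.2 (Real.one_lt_exp_iff.2 hl)
  have h := inner_poissonL2 hβ hL hL' u (besselExp hβ (Real.exp l - 1) hk)
  rw [hu, inner_zero_left, gammaL2_besselExp hβ hL', real_inner_smul_right, eq_comm,
    mul_eq_zero, or_iff_right (by positivity), real_inner_comm] at h
  simp only [add_sub_cancel, Real.log_exp] at h
  exact h

end HilbertGateways

/-! ### Assembly of the theorem. -/

theorem theorem1 (β : ℝ) (hβ : 0 ≤ β) :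
    -- the two semigroups exist and are determined by their generators
    (∃! Q : ℝ≥0 → Kernel ℝ≥0 ℝ≥0, IsSquaredBesselSemigroup β Q) ∧
    (∃! D : ℝ≥0 → Kernel ℕ ℕ, IsBirthDeathSemigroup β D) ∧
    ∀ (Q : ℝ≥0 → Kernel ℝ≥0 ℝ≥0) (D : ℝ≥0 → Kernel ℕ ℕ),
      IsSquaredBesselSemigroup β Q → IsBirthDeathSemigroup β D →
      -- the intertwinings on functions vanishing at infinity
      (∃ (L : C₀(ℕ, ℝ) →L[ℝ] C₀(ℝ≥0, ℝ)) (L' : C₀(ℝ≥0, ℝ) →L[ℝ] C₀(ℕ, ℝ))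
          (S : ℝ≥0 → C₀(ℝ≥0, ℝ) →L[ℝ] C₀(ℝ≥0, ℝ)) (R : ℝ≥0 → C₀(ℕ, ℝ) →L[ℝ] C₀(ℕ, ℝ)),
          IsC0Operator poissonGateway L ∧ IsC0Operator (gammaGateway β) L' ∧
          (∀ t, IsC0Operator (Q t) (S t)) ∧ (∀ t, IsC0Operator (D t) (R t)) ∧
          (∀ t, S t ∘L L = L ∘L R t) ∧
          (∀ t, R t ∘L L' = L' ∘L S t)) ∧
      -- the intertwinings in the Hilbert spaces, and the unitary equivalence
      (0 < β →
        ∃ (L : Lp ℝ 2 (birthDeathMeasure β) →L[ℝ] Lp ℝ 2 (besselMeasure β))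
          (L' : Lp ℝ 2 (besselMeasure β) →L[ℝ] Lp ℝ 2 (birthDeathMeasure β))
          (S : ℝ≥0 → Lp ℝ 2 (besselMeasure β) →L[ℝ] Lp ℝ 2 (besselMeasure β))
          (R : ℝ≥0 → Lp ℝ 2 (birthDeathMeasure β) →L[ℝ] Lp ℝ 2 (birthDeathMeasure β)),
          IsL2Operator poissonGateway (birthDeathMeasure β) (besselMeasure β) L ∧
          IsL2Operator (gammaGateway β) (besselMeasure β) (birthDeathMeasure β) L' ∧
          (∀ t, IsL2Operator (Q t) (besselMeasure β) (besselMeasure β) (S t)) ∧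
          (∀ t, IsL2Operator (D t) (birthDeathMeasure β) (birthDeathMeasure β) (R t)) ∧
          (∀ t, S t ∘L L = L ∘L R t) ∧
          (∀ t, R t ∘L L' = L' ∘L S t) ∧
          IsQuasiAffinity L ∧
          ∃ U : Lp ℝ 2 (birthDeathMeasure β) ≃ₗᵢ[ℝ] Lp ℝ 2 (besselMeasure β),
            ∀ t f, S t (U f) = U (R t f)) := by
  refine ⟨⟨besselKernel β, isSquaredBesselSemigroup_besselKernel hβ,
    fun Q hQ => hQ.eq_besselKernel hβ⟩, ⟨birthDeathKernel β,
    isBirthDeathSemigroup_birthDeathKernel hβ, fun D hD => hD.eq_birthDeathKernel hβ⟩,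
    fun Q D hQ hD => ?_⟩
  obtain rfl := hQ.eq_besselKernel hβ
  obtain rfl := hD.eq_birthDeathKernel hβ
  have := isMarkovKernel_gammaGateway hβ
  have := isMarkovKernel_poissonGateway
  have := isMarkovKernel_besselKernel hβ
  have := isMarkovKernel_birthDeathKernel hβ
  refine ⟨⟨poissonOp, gammaOp hβ, hQ.feller.op, hD.feller.op, poissonOp_apply, gammaOp_apply hβ,
    hQ.feller.op_apply, hD.feller.op_apply, fun t => ?_, fun t => ?_⟩, fun hβ => ?_⟩
  · ext g x
    have h := DFunLike.congr_fun (birthDeathKernel_comp_poissonGateway hβ t) x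
    have e1 := Kernel.integral_comp (κ := poissonGateway) (η := birthDeathKernel β t) (a := x)
      (C0_integrable g _)
    have e2 := Kernel.integral_comp (κ := besselKernel β t) (η := poissonGateway) (a := x)
      (C0_integrable g _)
    simp only [ContinuousLinearMap.comp_apply, IsFellerSemigroup.op_apply, poissonOp_apply]
    rw [← e1, ← e2, h]
  · ext f
    exact DFunLike.congr_fun (op_birthDeathKernel_gammaOp hβ t f) _
  · obtain ⟨L, hL⟩ := exists_isL2Operator _ (poissonGateway_comp_besselMeasure hβ)
    obtain ⟨L', hL'⟩ := exists_isL2Operator _ (gammaGateway_comp_birthDeathMeasure hβ)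
    choose S hS using fun t => exists_isL2Operator _ (besselKernel_comp_besselMeasure hβ t)
    choose R hR using fun t => exists_isL2Operator _ (birthDeathKernel_comp_birthDeathMeasure hβ t)
    -- Both sides of an intertwining are identified with the operator of one composite kernel,
    -- bounded because it transports one reference measure to the other.
    obtain ⟨M, hM⟩ : ∃ M : ℝ≥0 → _, ∀ t, IsL2Operator (birthDeathKernel β t ∘ₖ poissonGateway)
        (birthDeathMeasure β) (besselMeasure β) (M t) := by
      choose M hM using fun t => exists_isL2Operator (birthDeathKernel β t ∘ₖ poissonGateway)
        (μ := besselMeasure β) (ν := birthDeathMeasure β) (by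
          rw [← Measure.comp_assoc, poissonGateway_comp_besselMeasure hβ,
            birthDeathKernel_comp_birthDeathMeasure hβ])
      exact ⟨M, hM⟩
    obtain ⟨N, hN⟩ : ∃ N : ℝ≥0 → _, ∀ t, IsL2Operator (besselKernel β t ∘ₖ gammaGateway β)
        (besselMeasure β) (birthDeathMeasure β) (N t) := by
      choose N hN using fun t => exists_isL2Operator (besselKernel β t ∘ₖ gammaGateway β)
        (μ := birthDeathMeasure β) (ν := besselMeasure β) (by
          rw [← Measure.comp_assoc, gammaGateway_comp_birthDeathMeasure hβ,
            besselKernel_comp_besselMeasure hβ])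
      exact ⟨N, hN⟩
    have hSL (t : ℝ≥0) : S t ∘L L = L ∘L R t :=
      ((hS t).comp_eq hL (birthDeathKernel_comp_poissonGateway hβ.le t ▸ hM t)).trans
        (hL.comp_eq (hR t) (hM t)).symm
    have hRL (t : ℝ≥0) : R t ∘L L' = L' ∘L S t :=
      ((hR t).comp_eq hL' (besselKernel_comp_gammaGateway hβ.le t ▸ hN t)).trans
        (hL'.comp_eq (hS t) (hN t)).symm
    have hSS (s t : ℝ≥0) : S s ∘L S t = S (s + t) :=
      (hS s).comp_eq (hS t) (hQ.feller.add s t ▸ hS (s + t))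
    -- The self-adjoint square root of `Λ Λ* = Q_1` is read off from the semigroup itself.
    have hsq : S (1 / 2) ∘L S (1 / 2) = L ∘L L' := by
      rw [hSS, add_halves]
      exact (hL.comp_eq hL' (gammaGateway_comp_poissonGateway hβ.le ▸ hS 1)).symm
    have hLi := injective_poissonL2 hβ hL hL'
    have hLi' := injective_gammaL2 hβ hL hL'
    exact ⟨L, L', S, R, hL, hL', hS, hR, hSL, hRL,
      ⟨hLi, denseRange_of_injective_adjoint (inner_poissonL2 hβ hL hL') hLi'⟩,
      exists_unitary_of_comp_eq_sq (inner_poissonL2 hβ hL hL') (inner_besselL2 hβ _ (hS _)) hsq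
        hLi hLi' (fun t => by rw [hSS, hSS, add_comm]) hRL⟩
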